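/- Let $n\ge 3$, $r\ge 1$, $S\ge 0$, $\hat m$ be integers, $L=n(n-1)/2$, $\mathbb I=\{(i,j):1\le i<j\le n\}$, $\langle A,B\rangle=\mathrm{Tr}(A^\top B)$. Write $\|\cdot\|$ and $\|\cdot\|_F$ for the operator and Frobenius norms of a matrix, $e_{ij}=e_ie_j^\top$, and $\mathbf 1$ for the all-ones vector. For $\alpha=(i,j)\in\mathbb I$ put $w_\alpha=e_{ii}+e_{jj}-e_{ij}-e_{ji}$ and $v_\alpha=-\tfrac12(ab^\top+ba^\top)$ with $a=e_i-\tfrac1n\mathbf 1$, $b=e_j-\tfrac1n\mathbf 1$. For a finite sequence $\Omega$ in $\mathbb I$ put $\mathcal R_\Omega(Y)=\sum_{\alpha\in\Omega}\langle Y,w_\alpha\rangle v_\alpha$ (with multiplicity). For $U$ with $r$ orthonormal columns put $\mathcal P_UY=UU^\top Y$ and $\mathcal P_{\mathbb T}Y=UU^\top Y+YUU^\top-UU^\top YUU^\top$. The hard thresholding $\mathcal H_r$ sends a symmetric matrix $\sum_{i=1}^n\lambda_iu_iu_i^\top$ ($u_i$ orthonormal, $|\lambda_1|\ge\dots\ge|\lambda_n|$)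 to $\sum_{i=1}^r\lambda_iu_iu_i^\top$. Let $X\in\mathbb R^{n\times n}$ be symmetric with $X\mathbf 1=0$ and $\mathrm{rank}\,X=r$, with thin spectral decomposition $X=UDU^\top$, smallest nonzero singular value $\sigma_{\min}(X)$ and condition number $\kappa=\|X\|/\sigma_{\min}(X)$. Let $\nu\ge1$ and $\mu_1$ be real numbers such that for all $\alpha=(i,j)\in\mathbb I$ $$\|\mathcal P_Ue_{ij}\|_F\le\sqrt{\tfrac{\nu r}{128n}},\quad \|\mathcal P_Uw_\alpha\|_F\le\sqrt{\tfrac{\nu r}{8n}},\quad \|\mathcal P_Uv_\alpha\|_F\le\sqrt{\tfrac{\nu r}{2n}},$$ the same three bounds hold with $\mathcal P_{\mathbb T}$ (the tangent-space projection at $X$) in place of $\mathcal P_U$, and $\max_{i,j}|X_{ij}|\le\mu_1\sqrt{r/n^2}\,\|X\|$. Draw $(S+1)\hat m$ elements of $\mathbb I$ independently and uniformly (with replacement), in $S+1$ groups $\Omega_0,\dots,\Omega_S$ of size $\hat m$. Set $Z_0=\mathcal H_r\big(\tfrac L{\hat m}\mathcal R_{\Omega_0}(X)\big)$ and, for $l=0,\dots,S-1$,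 $$Z_{l+1}=\mathcal H_r\Big(\hat Z_l+\tfrac L{\hat m}\mathcal P_{\hat{\mathbb T}_l}\mathcal R_{\Omega_{l+1}}(X-\hat Z_l)\Big),$$ where $\hat Z_l=A_lD_lA_l^\top$ is obtained from a thin spectral decomposition $Z_l=U_lD_lU_l^\top$ by replacing each row $u$ of $U_l$ by $\frac{u}{\|u\|_2}\min\{\|u\|_2,\sqrt{\nu r/n}\}$ (zero rows stay zero), and $\mathcal P_{\hat{\mathbb T}_l}$ is the tangent-space projection at $\hat Z_l$, defined as above from a thin spectral decomposition of $\hat Z_l$. The output is $X_0=Z_S$. Then for every $\beta>1$, if $$\hat m\ \ge\ \max\{1.61\cdot10^5\,\nu^2,\ 7.77\cdot10^5\,\kappa^4\mu_1^2\}\,\kappa^2r^2\,\beta\,n\log n,$$ with probability at least $1-(2+4S)n^{1-\beta}$ the output satisfies (whichever thin spectral decompositions are used) $$\|X_0-X\|_F\le\Big(\frac56\Big)^S\frac{\sigma_{\min}(X)}{256\,\kappa^2}.$$ -/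

import Mathlib

open Matrix MeasureTheory ProbabilityTheory

noncomputable section

/-- The index set `𝕀 = {(i, j) : i < j}` of pairs of points. -/
abbrev PairIdx (n : ℕ) : Type := {p : Fin n × Fin n // p.1 < p.2}

/-- `L = n (n - 1) / 2`, the number of pairs, which is the dimension of the space of symmetric
matrices with zero row sums. -/
def numPairs (n : ℕ) : ℝ := (n : ℝ) * ((n : ℝ) - 1) / 2

/-- Trace inner product `⟨A, B⟩ = Tr (Aᵀ B)`. -/
def trInner {n : ℕ} (A B : Matrix (Fin n) (Fin n) ℝ) : ℝ := (Aᵀ * B).trace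

/-- Frobenius norm. -/
def frobNorm {n : ℕ} (A : Matrix (Fin n) (Fin n) ℝ) : ℝ := Real.sqrt (trInner A A)

/-- Operator norm of a matrix with respect to the Euclidean norm. -/
def specNorm {n : ℕ} (A : Matrix (Fin n) (Fin n) ℝ) : ℝ :=
  ‖Matrix.toEuclideanCLM (n := Fin n) (𝕜 := ℝ) A‖

/-- `r`-th largest singular value (Mathlib's singular values are indexed from `0`). For a matrix
of rank `r ≥ 1` this is the smallest nonzero singular value. -/
def sigmaMin {n : ℕ} (r : ℕ) (A : Matrix (Fin n) (Fin n) ℝ) : ℝ :=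
  (Matrix.toEuclideanLin A).singularValues (r - 1)

/-- Condition number `‖A‖ / σ_min(A)` of a rank-`r` matrix. -/
def condNum {n : ℕ} (r : ℕ) (A : Matrix (Fin n) (Fin n) ℝ) : ℝ := specNorm A / sigmaMin r A

/-- The measurement basis `w_α = e_ii + e_jj - e_ij - e_ji`, `α = (i, j)`. -/
def wBasis {n : ℕ} (α : PairIdx n) : Matrix (Fin n) (Fin n) ℝ :=
  Matrix.single α.1.1 α.1.1 1 + Matrix.single α.1.2 α.1.2 1
    - Matrix.single α.1.1 α.1.2 1 - Matrix.single α.1.2 α.1.1 1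

/-- The vector `e_i - (1/n) 𝟏`. -/
def centeredVec {n : ℕ} (i : Fin n) : Fin n → ℝ := fun k => (if k = i then 1 else 0) - 1 / (n : ℝ)

/-- The dual basis `v_α = -(a bᵀ + b aᵀ) / 2`, `a = e_i - 𝟏/n`, `b = e_j - 𝟏/n`. -/
def vBasis {n : ℕ} (α : PairIdx n) : Matrix (Fin n) (Fin n) ℝ :=
  (-(1 / 2 : ℝ)) •
    (Matrix.vecMulVec (centeredVec α.1.1) (centeredVec α.1.2)
      + Matrix.vecMulVec (centeredVec α.1.2) (centeredVec α.1.1))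

/-- Sampling operator `R_Ω(Y) = ∑_{α ∈ Ω} ⟨Y, w_α⟩ v_α` for a finite sequence `ω` of sampled pairs;
repeated pairs are counted with multiplicity. -/
def sampleOp {n m : ℕ} (ω : Fin m → PairIdx n) (Y : Matrix (Fin n) (Fin n) ℝ) :
    Matrix (Fin n) (Fin n) ℝ :=
  ∑ k, trInner Y (wBasis (ω k)) • vBasis (ω k)

/-- `Y = U D Uᵀ` with `U` an `n × r` matrix with orthonormal columns and `D = diag d`. -/
def IsThinEig {n r : ℕ} (Y : Matrix (Fin n) (Fin n) ℝ) (U : Matrix (Fin n) (Fin r) ℝ)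
    (d : Fin r → ℝ) : Prop :=
  Uᵀ * U = 1 ∧ Y = U * Matrix.diagonal d * Uᵀ

/-- `P_U Y = U Uᵀ Y`. -/
def projU {n r : ℕ} (U : Matrix (Fin n) (Fin r) ℝ) (Y : Matrix (Fin n) (Fin n) ℝ) :
    Matrix (Fin n) (Fin n) ℝ :=
  U * Uᵀ * Y

/-- Orthogonal projection onto the tangent space, at `U D Uᵀ`, of the manifold of rank-`r`
matrices. -/
def projT {n r : ℕ} (U : Matrix (Fin n) (Fin r) ℝ) (Y : Matrix (Fin n) (Fin n) ℝ) :
    Matrix (Fin n) (Fin n) ℝ :=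
  U * Uᵀ * Y + Y * (U * Uᵀ) - U * Uᵀ * Y * (U * Uᵀ)

/-- Incoherence with parameter `ν` of the column space spanned by the orthonormal columns
of `U`. -/
structure Incoherent {n r : ℕ} (ν : ℝ) (U : Matrix (Fin n) (Fin r) ℝ) : Prop where
  one_le : 1 ≤ ν
  projU_e : ∀ α : PairIdx n,
    frobNorm (projU U (Matrix.single α.1.1 α.1.2 1)) ≤ Real.sqrt (ν * r / (128 * n))
  projU_w : ∀ α : PairIdx n, frobNorm (projU U (wBasis α)) ≤ Real.sqrt (ν * r / (8 * n))
  projU_v : ∀ α : PairIdx n, frobNorm (projU U (vBasis α)) ≤ Real.sqrt (ν * r / (2 * n))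
  projT_e : ∀ α : PairIdx n,
    frobNorm (projT U (Matrix.single α.1.1 α.1.2 1)) ≤ Real.sqrt (ν * r / (128 * n))
  projT_w : ∀ α : PairIdx n, frobNorm (projT U (wBasis α)) ≤ Real.sqrt (ν * r / (8 * n))
  projT_v : ∀ α : PairIdx n, frobNorm (projT U (vBasis α)) ≤ Real.sqrt (ν * r / (2 * n))

/-- `H` is a value of the hard thresholding operator `H_r` at `Y`: for some spectral decomposition
`Y = ∑ i, λ i u_i u_iᵀ` with `|λ 0| ≥ |λ 1| ≥ ⋯`, it is the sum of the first `r` terms. (The value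
is unique unless the `r`-th and `r+1`-st eigenvalues are tied in absolute value.) -/
def IsHardThreshold {n : ℕ} (r : ℕ) (Y H : Matrix (Fin n) (Fin n) ℝ) : Prop :=
  ∃ (V : Matrix (Fin n) (Fin n) ℝ) (lam : Fin n → ℝ),
    Vᵀ * V = 1 ∧ Y = V * Matrix.diagonal lam * Vᵀ ∧
    (∀ i j : Fin n, i ≤ j → |lam j| ≤ |lam i|) ∧
    H = V * Matrix.diagonal (fun i : Fin n => if (i : ℕ) < r then lam i else 0) * Vᵀ

/-- Euclidean norm of the `i`-th row of `U`. -/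
def rowNorm {n r : ℕ} (U : Matrix (Fin n) (Fin r) ℝ) (i : Fin n) : ℝ :=
  Real.sqrt (∑ k, U i k ^ 2)

/-- Row trimming: the `i`-th row `u` of `U` is replaced by `u / ‖u‖ * min ‖u‖ √(ν r / n)`
(a zero row is left unchanged). -/
def trimRows {n r : ℕ} (ν : ℝ) (U : Matrix (Fin n) (Fin r) ℝ) : Matrix (Fin n) (Fin r) ℝ :=
  Matrix.of fun i k =>
    U i k / rowNorm U i * min (rowNorm U i) (Real.sqrt (ν * r / n))

/-- `Zhat` is an output of the trimming algorithm at `Z = U D Uᵀ`, namely `A D Aᵀ` with `A` the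
row-trimmed `U`. -/
def IsTrim {n : ℕ} (r : ℕ) (ν : ℝ) (Z Zhat : Matrix (Fin n) (Fin n) ℝ) : Prop :=
  ∃ (U : Matrix (Fin n) (Fin r) ℝ) (d : Fin r → ℝ),
    IsThinEig Z U d ∧ Zhat = trimRows ν U * Matrix.diagonal d * (trimRows ν U)ᵀ

/-- `Z 0, …, Z S` are the iterates of a run of the Riemannian resampling algorithm on the batches
`ω 0, …, ω S` of sampled pairs, each of size `mhat`; the output is `Z S`. -/
structure IsResamplingRun {n S mhat : ℕ} (r : ℕ) (ν : ℝ) (X : Matrix (Fin n) (Fin n) ℝ)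
    (ω : Fin (S + 1) → Fin mhat → PairIdx n)
    (Z : Fin (S + 1) → Matrix (Fin n) (Fin n) ℝ) : Prop where
  init : IsHardThreshold r ((numPairs n / mhat) • sampleOp (ω 0) X) (Z 0)
  step : ∀ l : Fin S, ∃ (Zhat : Matrix (Fin n) (Fin n) ℝ)
      (Uhat : Matrix (Fin n) (Fin r) ℝ) (dhat : Fin r → ℝ),
    IsTrim r ν (Z l.castSucc) Zhat ∧ IsThinEig Zhat Uhat dhat ∧
    IsHardThreshold r
      (Zhat + (numPairs n / mhat) • projT Uhat (sampleOp (ω l.succ) (X - Zhat)))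
      (Z l.succ)

/-- The law of `S + 1` batches of `mhat` pairs, all drawn independently and uniformly (with
replacement): the uniform distribution on the finite set of all such sequences of pairs. -/
def sampleLaw (n S mhat : ℕ) : Measure (Fin (S + 1) → Fin mhat → PairIdx n) :=
  uniformOn Set.univ

theorem trInner_wBasis {n : ℕ} (Y : Matrix (Fin n) (Fin n) ℝ) (α : PairIdx n) :
    trInner Y (wBasis α)
      = Y α.1.1 α.1.1 + Y α.1.2 α.1.2 - Y α.1.1 α.1.2 - Y α.1.2 α.1.1 := by
  have h : ∀ i j : Fin n, (Yᵀ * Matrix.single i j (1 : ℝ)).trace = Y i j := by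
    intro i j
    rw [Matrix.trace_mul_single]
    simp
  simp only [trInner, wBasis, Matrix.mul_add, Matrix.mul_sub, Matrix.trace_sub,
    Matrix.trace_add, h]

/-- Biorthogonality of the two families. -/
theorem trInner_vBasis_wBasis {n : ℕ} (α γ : PairIdx n) :
    trInner (vBasis α) (wBasis γ) = if α = γ then 1 else 0 := by
  have key : trInner (vBasis α) (wBasis γ)
      = -(((if γ.1.1 = α.1.1 then (1 : ℝ) else 0) - if γ.1.2 = α.1.1 then 1 else 0)
        * ((if γ.1.1 = α.1.2 then 1 else 0) - if γ.1.2 = α.1.2 then 1 else 0)) := by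
    rw [trInner_wBasis]
    simp only [vBasis, centeredVec, Matrix.smul_apply, Matrix.add_apply, Matrix.vecMulVec_apply,
      smul_eq_mul]
    ring
  rw [key]
  obtain ⟨⟨i, j⟩, hij⟩ := α
  obtain ⟨⟨k, l⟩, hkl⟩ := γ
  simp only [Subtype.mk.injEq, Prod.mk.injEq] at hij hkl ⊢
  split_ifs <;> first | (exfalso; omega) | norm_num

theorem vBasis_transpose {n : ℕ} (α : PairIdx n) : (vBasis α)ᵀ = vBasis α := by
  ext k l
  simp only [vBasis, Matrix.transpose_apply, Matrix.smul_apply, Matrix.add_apply,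
    Matrix.vecMulVec_apply, smul_eq_mul]
  ring

theorem vBasis_mulVec_one {n : ℕ} (α : PairIdx n) : vBasis α *ᵥ (fun _ => (1 : ℝ)) = 0 := by
  have hn : (n : ℝ) ≠ 0 := by
    have := α.1.1.pos
    positivity
  have h : ∀ i : Fin n, ∑ l, centeredVec i l = 0 := by
    intro i
    simp [centeredVec, Finset.sum_sub_distrib, hn]
  ext k
  simp [Matrix.mulVec, dotProduct, vBasis, Matrix.vecMulVec_apply, mul_add,
    Finset.sum_add_distrib, ← Finset.mul_sum, h]

end

/-! Write $J$ for the centering projection, $\sigma=\sigma_{\min}(X)$ and $\tau=\sqrt{\nu r/n}$. For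
a centred symmetric $E$, the number $\langle E,w_\alpha\rangle$ is a squared distance of the Gram
matrix $E$, and $v_\alpha=-\frac12 J(e_{ij}+e_{ji})J$. Since $J\,\mathrm{edm}(E)\,J=-2E$, the
sampling error $\frac L{\hat m}\mathcal R_\Omega(E)-E$ equals $JNJ$, with $N$ a sum of independent
centred multiples of sparse edge matrices (`sampleOp_sub_eq`). Bernstein inequalities control $N$:
the operator norm through Golden–Thompson (`card_opNorm_sum_ge_le`), and linear images with values
in a Hilbert space through a cosh moment bound (`card_norm_sum_ge_le`).

The bound on $\mathcal P_Ue_{ij}$, or on $\mathcal P_{\mathbb T}e_{ij}$ for the last index, gives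
$\|(UU^\top)_i\|\le\tau/11$, because $\sqrt{128}>11$. This slack by a factor $11$ is what allows
every iterate to keep projection rows of norm at most $\tau$. That number is exactly the trimming
threshold, so trimming never acts (`IterateProj.trim_eq`).

Initialization. With high probability $\|N\|\le\sigma/(364\kappa^2\sqrt r)$; perturbation theory for
the dominant eigenspace then gives $\|Z_0-X\|_F\le\sigma/(256\kappa^2)$
(`TopSplit.frobNorm_sub_sq_le`). The rows of the new projection $P$ need a bound on $PN_i$, where
$P$ depends on $N_i$. The dependence is removed by leaving out the noise in row and column $i$:
resampling the edges at $i$ does not change the reduced matrix, so its eigenspace is fixed during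
the resampling and vector Bernstein applies (`card_loo_le`); a $\sin\Theta$ bound transfers the
estimate back to $P$ (`leave_one_out_bound`).

Iteration. Each batch is fresh, so $Z$ is fixed. With $P$ the projection onto its column space and
$G=JNJ$ the noise for $E=X-Z$, the matrix before thresholding differs from $X$ by $\mathcal
P_{\hat{\mathbb T}}G-(1-P)X(1-P)$ (`IterateProj.step_sub_eq`). The last term is quadratic in the
error, at most $\delta^2/\sigma$, and $\mathcal P_{\hat{\mathbb T}}G$ is at most $\delta/4$ with
high probability. Thresholding costs a factor $21/10$, and
$\frac{65}{256}\cdot\frac{21}{10}<\frac56$. Row bounds survive because the rows of $GP$ also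
concentrate (`goodIterate_step`).

Assembly. With high probability every step has one and only one possible result, and it is good
(`DeterminesGood`). The state is then a function of the past batches, and the failure counts
$2n\cdot n^{-\beta}$ and $4n\cdot n^{-\beta}$ add up along the run (`card_not_init_run_good_le`). -/

open scoped Matrix.Norms.L2Operator

noncomputable section

/-! ### Euclidean, operator and Frobenius norms -/

/-- Euclidean norm of a coordinate vector. -/
def vnorm {ι : Type*} [Fintype ι] (x : ι → ℝ) : ℝ := ‖(WithLp.toLp 2 x : EuclideanSpace ℝ ι)‖

section vnorm

variable {ι κ : Type*} [Fintype ι] [Fintype κ]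

theorem vnorm_sq (x : ι → ℝ) : vnorm x ^ 2 = ∑ i, x i ^ 2 := by
  rw [vnorm, EuclideanSpace.norm_sq_eq]
  simp

theorem vnorm_nonneg (x : ι → ℝ) : 0 ≤ vnorm x := norm_nonneg _

theorem vnorm_eq_sqrt (x : ι → ℝ) : vnorm x = Real.sqrt (∑ i, x i ^ 2) := by
  rw [← vnorm_sq, Real.sqrt_sq (vnorm_nonneg x)]

theorem vnorm_add_le (x y : ι → ℝ) : vnorm (x + y) ≤ vnorm x + vnorm y := by
  simpa [vnorm] using norm_add_le (WithLp.toLp 2 x : EuclideanSpace ℝ ι) (WithLp.toLp 2 y)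

theorem vnorm_sub_le (x y : ι → ℝ) : vnorm (x - y) ≤ vnorm x + vnorm y := by
  simpa [vnorm] using norm_sub_le (WithLp.toLp 2 x : EuclideanSpace ℝ ι) (WithLp.toLp 2 y)

theorem vnorm_smul (c : ℝ) (x : ι → ℝ) : vnorm (c • x) = |c| * vnorm x := by
  simp [vnorm, norm_smul]

@[simp] theorem vnorm_zero : vnorm (0 : ι → ℝ) = 0 := by
  simp [vnorm]

theorem vnorm_eq_zero {x : ι → ℝ} : vnorm x = 0 ↔ x = 0 := by
  simp [vnorm]

theorem vnorm_pos {x : ι → ℝ} (hx : x ≠ 0) : 0 < vnorm x :=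
  lt_of_le_of_ne (vnorm_nonneg x) fun h => hx (vnorm_eq_zero.1 h.symm)

theorem vnorm_sq_dotProduct (x : ι → ℝ) : vnorm x ^ 2 = x ⬝ᵥ x := by
  rw [vnorm_sq, dotProduct]
  exact Finset.sum_congr rfl fun i _ => pow_two _

theorem abs_dotProduct_le (x y : ι → ℝ) : |x ⬝ᵥ y| ≤ vnorm x * vnorm y := by
  have h := abs_real_inner_le_norm (WithLp.toLp 2 y : EuclideanSpace ℝ ι) (WithLp.toLp 2 x)
  simp only [EuclideanSpace.inner_toLp_toLp, star_trivial] at h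
  rw [mul_comm]
  exact h

theorem abs_apply_le_vnorm (x : ι → ℝ) (i : ι) : |x i| ≤ vnorm x := by
  apply abs_le_of_sq_le_sq _ (vnorm_nonneg x)
  rw [vnorm_sq]
  exact Finset.single_le_sum (f := fun i => x i ^ 2) (fun i _ => sq_nonneg _) (Finset.mem_univ i)

theorem vnorm_single [DecidableEq ι] (i : ι) : vnorm (Pi.single i (1 : ℝ)) = 1 := by
  simp [vnorm]

theorem vnorm_mulVec_le [DecidableEq κ] (A : Matrix ι κ ℝ) (x : κ → ℝ) :
    vnorm (A *ᵥ x) ≤ ‖A‖ * vnorm x := by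
  have h := Matrix.l2_opNorm_mulVec A (WithLp.toLp 2 x)
  simpa [vnorm] using h

theorem opNorm_le [DecidableEq κ] {A : Matrix ι κ ℝ} {c : ℝ} (hc : 0 ≤ c)
    (h : ∀ x, vnorm (A *ᵥ x) ≤ c * vnorm x) : ‖A‖ ≤ c := by
  rw [Matrix.l2_opNorm_def]
  refine ContinuousLinearMap.opNorm_le_bound _ hc fun x => ?_
  exact h (WithLp.ofLp x)

theorem opNorm_transpose [DecidableEq ι] [DecidableEq κ] (A : Matrix ι κ ℝ) : ‖Aᵀ‖ = ‖A‖ := by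
  rw [← Matrix.conjTranspose_eq_transpose_of_trivial, Matrix.l2_opNorm_conjTranspose]

theorem opNorm_transpose_mul_self [DecidableEq κ] [DecidableEq ι] (A : Matrix ι κ ℝ) :
    ‖Aᵀ * A‖ = ‖A‖ * ‖A‖ := by
  rw [← Matrix.conjTranspose_eq_transpose_of_trivial, Matrix.l2_opNorm_conjTranspose_mul_self]

theorem vnorm_mul_row_le [DecidableEq ι] [DecidableEq κ] {o : Type*}
    (A : Matrix o ι ℝ) (B : Matrix ι κ ℝ) (i : o) :
    vnorm ((A * B) i) ≤ vnorm (A i) * ‖B‖ := by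
  have h : (A * B) i = Bᵀ *ᵥ A i := by
    ext k
    simp [Matrix.mul_apply, Matrix.mulVec, dotProduct, mul_comm]
  rw [h, mul_comm, ← opNorm_transpose B]
  exact vnorm_mulVec_le _ _

theorem vnorm_row_le [DecidableEq ι] [DecidableEq κ] (A : Matrix ι κ ℝ) (i : ι) :
    vnorm (A i) ≤ ‖A‖ := by
  have h : A i = Aᵀ *ᵥ Pi.single i 1 := by
    ext k
    simp
  rw [h, ← opNorm_transpose A]
  simpa [vnorm_single] using vnorm_mulVec_le Aᵀ (Pi.single i 1)

theorem norm_diagonal_le [DecidableEq ι] {d : ι → ℝ} {c : ℝ} (hc : 0 ≤ c)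
    (h : ∀ i, |d i| ≤ c) : ‖Matrix.diagonal d‖ ≤ c := by
  rw [Matrix.l2_opNorm_diagonal]
  exact (pi_norm_le_iff_of_nonneg hc).2 h

theorem norm_le_of_transpose_mul_self_eq_one [DecidableEq ι] [DecidableEq κ]
    {U : Matrix ι κ ℝ} (h : Uᵀ * U = 1) : ‖U‖ ≤ 1 := by
  refine opNorm_le zero_le_one fun x => ?_
  rw [one_mul]
  apply le_of_sq_le_sq _ (vnorm_nonneg _)
  rw [vnorm_sq_dotProduct, vnorm_sq_dotProduct, Matrix.dotProduct_mulVec,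
    Matrix.vecMul_mulVec, h, Matrix.vecMul_one]

theorem vnorm_mulVec_of_transpose_mul_self_eq_one [DecidableEq κ]
    {U : Matrix ι κ ℝ} (h : Uᵀ * U = 1) (x : κ → ℝ) : vnorm (U *ᵥ x) = vnorm x := by
  have : vnorm (U *ᵥ x) ^ 2 = vnorm x ^ 2 := by
    rw [vnorm_sq_dotProduct, vnorm_sq_dotProduct, Matrix.dotProduct_mulVec,
      Matrix.vecMul_mulVec, h]
    simp
  exact (sq_eq_sq₀ (vnorm_nonneg _) (vnorm_nonneg _)).1 this

end vnorm

/-! ### The Frobenius norm and orthogonal projections -/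

section frob

variable {n : ℕ}

theorem frobNorm_sq (A : Matrix (Fin n) (Fin n) ℝ) : frobNorm A ^ 2 = ∑ i, vnorm (A i) ^ 2 := by
  have h : trInner A A = ∑ i, ∑ j, A i j ^ 2 := by
    simp only [trInner, Matrix.trace, Matrix.diag, Matrix.mul_apply, Matrix.transpose_apply]
    rw [Finset.sum_comm]
    simp [pow_two]
  simp only [vnorm_sq]
  rw [frobNorm, h, Real.sq_sqrt]
  positivity

theorem frobNorm_nonneg (A : Matrix (Fin n) (Fin n) ℝ) : 0 ≤ frobNorm A := Real.sqrt_nonneg _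

/-- The entries of a matrix as a Euclidean vector. -/
def vecLin (n : ℕ) : Matrix (Fin n) (Fin n) ℝ →ₗ[ℝ] EuclideanSpace ℝ (Fin n × Fin n) where
  toFun A := WithLp.toLp 2 fun p => A p.1 p.2
  map_add' A B := by ext; simp
  map_smul' c A := by ext; simp

theorem norm_vecLin (A : Matrix (Fin n) (Fin n) ℝ) : ‖vecLin n A‖ = frobNorm A := by
  rw [← sq_eq_sq₀ (norm_nonneg _) (frobNorm_nonneg _), frobNorm_sq, EuclideanSpace.norm_sq_eq,
    Fintype.sum_prod_type]
  simp [vecLin, vnorm_sq]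

theorem frobNorm_sub_le (A B : Matrix (Fin n) (Fin n) ℝ) :
    frobNorm (A - B) ≤ frobNorm A + frobNorm B := by
  simpa only [← norm_vecLin, map_sub] using norm_sub_le (vecLin n A) (vecLin n B)

theorem frobNorm_transpose (A : Matrix (Fin n) (Fin n) ℝ) : frobNorm Aᵀ = frobNorm A := by
  rw [← sq_eq_sq₀ (frobNorm_nonneg _) (frobNorm_nonneg _), frobNorm_sq, frobNorm_sq]
  simp only [vnorm_sq, Matrix.transpose_apply]
  rw [Finset.sum_comm]

theorem frobNorm_neg (A : Matrix (Fin n) (Fin n) ℝ) : frobNorm (-A) = frobNorm A := by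
  simp only [← norm_vecLin, map_neg, norm_neg]

theorem frobNorm_mul_le (A B : Matrix (Fin n) (Fin n) ℝ) :
    frobNorm (A * B) ≤ frobNorm A * ‖B‖ := by
  apply le_of_sq_le_sq _ (mul_nonneg (frobNorm_nonneg _) (norm_nonneg _))
  rw [mul_pow, frobNorm_sq, frobNorm_sq, Finset.sum_mul]
  refine Finset.sum_le_sum fun i _ => ?_
  rw [← mul_pow]
  exact pow_le_pow_left₀ (vnorm_nonneg _) (vnorm_mul_row_le A B i) 2

theorem frobNorm_mul_le' (A B : Matrix (Fin n) (Fin n) ℝ) :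
    frobNorm (A * B) ≤ ‖A‖ * frobNorm B := by
  rw [← frobNorm_transpose, Matrix.transpose_mul, mul_comm, ← opNorm_transpose A,
    ← frobNorm_transpose B]
  exact frobNorm_mul_le _ _

theorem norm_le_frobNorm (A : Matrix (Fin n) (Fin n) ℝ) : ‖A‖ ≤ frobNorm A := by
  refine opNorm_le (frobNorm_nonneg A) fun x => ?_
  apply le_of_sq_le_sq _ (mul_nonneg (frobNorm_nonneg _) (vnorm_nonneg _))
  rw [mul_pow, frobNorm_sq, vnorm_sq, Finset.sum_mul]
  refine Finset.sum_le_sum fun i _ => ?_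
  rw [← mul_pow, ← sq_abs]
  exact pow_le_pow_left₀ (abs_nonneg _) (abs_dotProduct_le _ _) 2

theorem specNorm_eq (A : Matrix (Fin n) (Fin n) ℝ) : specNorm A = ‖A‖ := rfl

/-- Orthogonal projections, as matrices. -/
structure IsOrthProj {ι : Type*} [Fintype ι] (P : Matrix ι ι ℝ) : Prop where
  symm : Pᵀ = P
  idem : P * P = P

namespace IsOrthProj

theorem compl {P : Matrix (Fin n) (Fin n) ℝ} (h : IsOrthProj P) : IsOrthProj (1 - P) where
  symm := by rw [Matrix.transpose_sub, h.symm, Matrix.transpose_one]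
  idem := by
    have := h.idem
    rw [mul_sub, sub_mul, sub_mul, this]
    simp

theorem norm_le {P : Matrix (Fin n) (Fin n) ℝ} (h : IsOrthProj P) : ‖P‖ ≤ 1 := by
  have h1 := opNorm_transpose_mul_self P
  rw [h.symm, h.idem] at h1
  by_contra hc
  push Not at hc
  nlinarith

theorem compl_mul {P : Matrix (Fin n) (Fin n) ℝ} (h : IsOrthProj P) : (1 - P) * P = 0 := by
  rw [sub_mul, h.idem, one_mul, sub_self]

theorem frobNorm_sq_eq {P : Matrix (Fin n) (Fin n) ℝ} (h : IsOrthProj P) :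
    frobNorm P ^ 2 = P.trace := by
  rw [frobNorm, trInner, h.symm, h.idem, Real.sq_sqrt]
  have : P.trace = trInner P P := by rw [trInner, h.symm, h.idem]
  rw [this]
  simp only [trInner, Matrix.trace, Matrix.diag, Matrix.mul_apply, Matrix.transpose_apply]
  exact Finset.sum_nonneg fun _ _ => Finset.sum_nonneg fun _ _ => mul_self_nonneg _

theorem row_sq {P : Matrix (Fin n) (Fin n) ℝ} (h : IsOrthProj P) (i : Fin n) :
    vnorm (P i) ^ 2 = P i i := by
  conv_rhs => rw [← h.idem]
  rw [vnorm_sq_dotProduct, Matrix.mul_apply, dotProduct]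
  refine Finset.sum_congr rfl fun j _ => ?_
  congr 1
  conv_lhs => rw [← h.symm]
  rfl

theorem frobNorm_mul_le {P : Matrix (Fin n) (Fin n) ℝ} (h : IsOrthProj P)
    (A : Matrix (Fin n) (Fin n) ℝ) : frobNorm (P * A) ≤ frobNorm A :=
  (frobNorm_mul_le' P A).trans (mul_le_of_le_one_left (frobNorm_nonneg _) h.norm_le)

theorem frobNorm_mul_le' {P : Matrix (Fin n) (Fin n) ℝ} (h : IsOrthProj P)
    (A : Matrix (Fin n) (Fin n) ℝ) : frobNorm (A * P) ≤ frobNorm A :=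
  (_root_.frobNorm_mul_le A P).trans (mul_le_of_le_one_right (frobNorm_nonneg _) h.norm_le)

theorem frobNorm_sq_add {P : Matrix (Fin n) (Fin n) ℝ} (h : IsOrthProj P)
    (A : Matrix (Fin n) (Fin n) ℝ) :
    frobNorm A ^ 2 = frobNorm (P * A) ^ 2 + frobNorm ((1 - P) * A) ^ 2 := by
  have key : ∀ B : Matrix (Fin n) (Fin n) ℝ, frobNorm B ^ 2 = (Bᵀ * B).trace := by
    intro B
    rw [frobNorm, Real.sq_sqrt, trInner]
    simp only [trInner, Matrix.trace, Matrix.diag, Matrix.mul_apply, Matrix.transpose_apply]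
    exact Finset.sum_nonneg fun _ _ => Finset.sum_nonneg fun _ _ => mul_self_nonneg _
  rw [key, key, key, ← Matrix.trace_add]
  congr 1
  rw [Matrix.transpose_mul, Matrix.transpose_mul, h.symm, h.compl.symm]
  have h1 : Aᵀ * P * (P * A) = Aᵀ * (P * P) * A := by noncomm_ring
  have h2 : Aᵀ * (1 - P) * ((1 - P) * A) = Aᵀ * ((1 - P) * (1 - P)) * A := by
    simp only [Matrix.mul_assoc]
  rw [h1, h2, h.idem, h.compl.idem]
  noncomm_ring

/-- When the range of `P` lies in that of `R`, the difference `R - P` is itself an orthogonal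
projection. Its squared Frobenius norm is its trace, which is zero. -/
theorem eq_of_trace {P R : Matrix (Fin n) (Fin n) ℝ} (hP : IsOrthProj P) (hR : IsOrthProj R)
    (htr : P.trace = R.trace) (hRP : R * P = P) : P = R := by
  have h1 : P * R = P := by
    have := congrArg Matrix.transpose hRP
    rwa [Matrix.transpose_mul, hP.symm, hR.symm] at this
  have h2 : IsOrthProj (R - P) :=
    ⟨by rw [Matrix.transpose_sub, hP.symm, hR.symm], by
      rw [sub_mul, mul_sub, mul_sub, hR.idem, hP.idem, hRP, h1, sub_self, sub_zero]⟩
  have h3 := h2.frobNorm_sq_eq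
  rw [Matrix.trace_sub, htr, sub_self, frobNorm_sq] at h3
  have h4 := (Finset.sum_eq_zero_iff_of_nonneg (fun _ _ => sq_nonneg _)).1 h3
  have h5 : R - P = 0 := by
    ext i j
    have := vnorm_eq_zero.1 (pow_eq_zero_iff (two_ne_zero) |>.1 (h4 i (Finset.mem_univ i)))
    exact congrFun this j
  exact (sub_eq_zero.1 h5).symm

end IsOrthProj

theorem isOrthProj_mul_transpose {ι κ : Type*} [Fintype ι] [Fintype κ] [DecidableEq κ]
    {U : Matrix ι κ ℝ} (h : Uᵀ * U = 1) : IsOrthProj (U * Uᵀ) where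
  symm := by rw [Matrix.transpose_mul, Matrix.transpose_transpose]
  idem := by
    rw [Matrix.mul_assoc, ← Matrix.mul_assoc Uᵀ, h, Matrix.one_mul]

end frob

/-! ### The Golden–Thompson inequality -/

section LieTrotter

open NormedSpace Filter Topology

variable {𝔸 : Type*} [NormedRing 𝔸] [NormOneClass 𝔸]

theorem norm_pow_sub_pow_le {x y : 𝔸} {M : ℝ} (hM : 1 ≤ M) (hx : ‖x‖ ≤ M) (hy : ‖y‖ ≤ M) (N : ℕ) :
    ‖x ^ N - y ^ N‖ ≤ N * M ^ N * ‖x - y‖ := by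
  induction N with
  | zero => simp
  | succ N ih =>
    have h : x ^ (N + 1) - y ^ (N + 1) = x ^ N * (x - y) + (x ^ N - y ^ N) * y := by
      rw [pow_succ, pow_succ]; noncomm_ring
    have hM0 : 0 ≤ M := by linarith
    have hxN : ‖x ^ N‖ ≤ M ^ N := (norm_pow_le x N).trans (pow_le_pow_left₀ (norm_nonneg _) hx N)
    have h1 : ‖x ^ N * (x - y)‖ ≤ M ^ (N + 1) * ‖x - y‖ := by
      refine (norm_mul_le _ _).trans ?_
      gcongr
      refine hxN.trans (pow_le_pow_right₀ hM (Nat.le_succ N))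
    have h2 : ‖(x ^ N - y ^ N) * y‖ ≤ N * M ^ N * ‖x - y‖ * M := by
      refine (norm_mul_le _ _).trans ?_
      gcongr
    rw [h]
    refine (norm_add_le _ _).trans ((add_le_add h1 h2).trans (le_of_eq ?_))
    push_cast
    ring

theorem norm_exp_le_exp_norm [NormedAlgebra ℝ 𝔸] (x : 𝔸) : ‖exp x‖ ≤ Real.exp ‖x‖ := by
  have h : exp x = ∑' n : ℕ, ((n.factorial : ℝ)⁻¹) • x ^ n := by rw [exp_eq_tsum ℝ]
  have hs : HasSum (fun n : ℕ => (n.factorial : ℝ)⁻¹ * ‖x‖ ^ n) (Real.exp ‖x‖) := by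
    have := exp_series_hasSum_exp' (𝕂 := ℝ) ‖x‖
    rwa [← Real.exp_eq_exp_ℝ] at this
  rw [h]
  refine tsum_of_norm_bounded hs fun n => ?_
  rw [norm_smul]
  have : ‖((n.factorial : ℝ)⁻¹)‖ = (n.factorial : ℝ)⁻¹ := by
    rw [Real.norm_eq_abs, abs_of_nonneg (by positivity)]
  rw [this]
  gcongr
  exact norm_pow_le x n

/-- Lie–Trotter product formula. The defect `f t` between `exp (t (A + B))` and `exp (tA) exp (tB)`
vanishes to first order at `0`, so `2 ^ k * ‖f (2 ^ -k)‖` tends to `0`. Telescoping the `2 ^ k`-th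
powers loses only the factor `2 ^ k` and a constant. Exponents that are powers of two suffice, and
the trace inequality below is proved for these. -/
theorem tendsto_exp_mul_exp_pow [NormedAlgebra ℝ 𝔸] [CompleteSpace 𝔸] (A B : 𝔸) :
    Tendsto (fun k : ℕ => (exp ((2 ^ k : ℝ)⁻¹ • A) * exp ((2 ^ k : ℝ)⁻¹ • B)) ^ 2 ^ k) atTop
      (𝓝 (exp (A + B))) := by
  let _ : NormedAlgebra ℚ 𝔸 := NormedAlgebra.restrictScalars ℚ ℝ 𝔸
  set f : ℝ → 𝔸 := fun t => exp (t • (A + B)) - exp (t • A) * exp (t • B) with hf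
  have hd : HasDerivAt f 0 0 := by
    have h1 := hasDerivAt_exp_smul_const (𝕂 := ℝ) (A + B) (0 : ℝ)
    have h2 := (hasDerivAt_exp_smul_const (𝕂 := ℝ) A (0 : ℝ)).mul
      (hasDerivAt_exp_smul_const (𝕂 := ℝ) B (0 : ℝ))
    have h3 := h1.sub h2
    have e : exp ((0 : ℝ) • (A + B)) * (A + B)
        - (exp ((0 : ℝ) • A) * A * exp ((0 : ℝ) • B) + exp ((0 : ℝ) • A) * (exp ((0 : ℝ) • B) * B))
        = 0 := by
      simp
    rw [e] at h3
    exact h3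
  have hlim : Tendsto (fun k : ℕ => (2 ^ k : ℝ) * ‖f ((2 ^ k : ℝ)⁻¹)‖) atTop (𝓝 0) := by
    have h0 : Tendsto (fun k : ℕ => (2 ^ k : ℝ)⁻¹) atTop (𝓝[>] 0) := by
      refine tendsto_inv_atTop_nhdsGT_zero.comp ?_
      exact tendsto_pow_atTop_atTop_of_one_lt (by norm_num)
    have h1 := (hd.tendsto_slope_zero_right.comp h0).norm
    simp only [norm_zero] at h1
    refine h1.congr fun k => ?_
    have : f 0 = 0 := by simp [hf]
    simp only [Function.comp, zero_add, this, sub_zero, norm_smul, inv_inv]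
    congr 1
    rw [Real.norm_eq_abs, abs_of_nonneg (by positivity)]
  set c := ‖A‖ + ‖B‖ with hc
  have hc0 : 0 ≤ c := by positivity
  have hbound : ∀ k : ℕ, ‖exp (A + B)
      - (exp ((2 ^ k : ℝ)⁻¹ • A) * exp ((2 ^ k : ℝ)⁻¹ • B)) ^ 2 ^ k‖
      ≤ Real.exp c * ((2 ^ k : ℝ) * ‖f ((2 ^ k : ℝ)⁻¹)‖) := by
    intro k
    set s : ℝ := (2 ^ k : ℝ)⁻¹ with hs
    have hs0 : 0 ≤ s := by positivity
    have hX : exp (A + B) = exp (s • (A + B)) ^ 2 ^ k := by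
      rw [← NormedSpace.exp_nsmul, ← Nat.cast_smul_eq_nsmul ℝ, smul_smul, hs]
      push_cast
      rw [mul_inv_cancel₀ (by positivity), one_smul]
    have n1 : ‖exp (s • (A + B))‖ ≤ Real.exp (s * c) := by
      refine (norm_exp_le_exp_norm _).trans (Real.exp_le_exp.2 ?_)
      rw [norm_smul, Real.norm_eq_abs, abs_of_nonneg hs0]
      exact mul_le_mul_of_nonneg_left (norm_add_le _ _) hs0
    have n2 : ‖exp (s • A) * exp (s • B)‖ ≤ Real.exp (s * c) := by
      refine (norm_mul_le _ _).trans ?_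
      rw [hc, mul_add, Real.exp_add]
      have a1 := norm_exp_le_exp_norm (s • A)
      have a2 := norm_exp_le_exp_norm (s • B)
      rw [norm_smul, Real.norm_eq_abs, abs_of_nonneg hs0] at a1 a2
      gcongr
    have h1 : 1 ≤ Real.exp (s * c) := Real.one_le_exp (by positivity)
    have := norm_pow_sub_pow_le h1 n1 n2 (2 ^ k)
    rw [hX]
    refine this.trans (le_of_eq ?_)
    have hE : Real.exp (s * c) ^ 2 ^ k = Real.exp c := by
      rw [← Real.exp_nat_mul, hs]
      congr 1
      push_cast
      field_simp
    rw [hE]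
    push_cast
    ring
  rw [tendsto_iff_norm_sub_tendsto_zero]
  refine squeeze_zero (fun _ => norm_nonneg _) (fun k => ?_)
      (by simpa using hlim.const_mul (Real.exp c))
  rw [norm_sub_rev]
  exact hbound k

end LieTrotter

/-! ### Trace inequalities for powers, and Golden–Thompson -/

section TracePowers

variable {ι : Type*} [Fintype ι]

theorem trace_transpose_mul_self_nonneg (M : Matrix ι ι ℝ) : 0 ≤ (Mᵀ * M).trace := by
  simp only [Matrix.trace, Matrix.diag, Matrix.mul_apply, Matrix.transpose_apply]
  exact Finset.sum_nonneg fun _ _ => Finset.sum_nonneg fun _ _ => mul_self_nonneg _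

theorem trace_mul_pow_comm [DecidableEq ι] (A B : Matrix ι ι ℝ) (N : ℕ) :
    ((A * B) ^ N).trace = ((B * A) ^ N).trace := by
  cases N with
  | zero => simp
  | succ N =>
    have h : (A * B) ^ (N + 1) = A * ((B * A) ^ N * B) := by
      rw [pow_succ, ← mul_assoc, ← mul_assoc, mul_pow_mul]
    rw [h, Matrix.trace_mul_comm, pow_succ, mul_assoc]

theorem two_mul_trace_mul_le {S T : Matrix ι ι ℝ} (hS : Sᵀ = S) (hT : Tᵀ = T) :
    2 * (S * T).trace ≤ (S * S).trace + (T * T).trace := by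
  have h := trace_transpose_mul_self_nonneg (S - T)
  rw [Matrix.transpose_sub, hS, hT, sub_mul, mul_sub, mul_sub] at h
  simp only [Matrix.trace_sub] at h
  rw [Matrix.trace_mul_comm T S] at h
  linarith

/-- The two inequalities feed each other in the induction. For the first, apply it to `M ^ 2`,
rotate `M²(Mᵀ)²` cyclically into `(MᵀM)(MMᵀ)`, split this product by the second inequality, and
finish with `2 tr(ST) ≤ tr S² + tr T²`. For the second, apply the first to `PQ`, rotate `PQQP` into
`Q²P²`, and use the second for the squares. -/
theorem trace_pow_two_pow_le [DecidableEq ι] (k : ℕ) :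
    (∀ M : Matrix ι ι ℝ, (M ^ 2 ^ (k + 1)).trace ≤ ((M * Mᵀ) ^ 2 ^ k).trace) ∧
    ∀ P Q : Matrix ι ι ℝ, Pᵀ = P → Qᵀ = Q →
      ((P * Q) ^ 2 ^ k).trace ≤ (P ^ 2 ^ k * Q ^ 2 ^ k).trace := by
  induction k with
  | zero =>
    refine ⟨fun M => ?_, fun P Q _ _ => by simp⟩
    have h := trace_transpose_mul_self_nonneg (M - Mᵀ)
    rw [Matrix.transpose_sub, Matrix.transpose_transpose, sub_mul, mul_sub, mul_sub] at h
    simp only [Matrix.trace_sub] at h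
    have h1 : (Mᵀ * Mᵀ).trace = (M * M).trace := by
      rw [← Matrix.transpose_mul, Matrix.trace_transpose]
    rw [h1, Matrix.trace_mul_comm Mᵀ M] at h
    simp only [zero_add, pow_one, pow_zero, pow_two]
    linarith
  | succ k ih =>
    obtain ⟨ihA, ihB⟩ := ih
    refine ⟨fun M => ?_, fun P Q hP hQ => ?_⟩
    · have h1 := ihA (M ^ 2)
      rw [← pow_mul, show 2 * 2 ^ (k + 1) = 2 ^ (k + 1 + 1) by ring] at h1
      have h2 : M ^ 2 * (M ^ 2)ᵀ = (M * M * Mᵀ) * Mᵀ := by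
        rw [pow_two, Matrix.transpose_mul]; simp only [mul_assoc]
      have h3 : Mᵀ * (M * M * Mᵀ) = (Mᵀ * M) * (M * Mᵀ) := by simp only [mul_assoc]
      rw [h2, trace_mul_pow_comm, h3] at h1
      have hP : (Mᵀ * M)ᵀ = Mᵀ * M := by simp
      have hQ : (M * Mᵀ)ᵀ = M * Mᵀ := by simp
      have h4 := ihB _ _ hP hQ
      have h5 := two_mul_trace_mul_le (S := (Mᵀ * M) ^ 2 ^ k) (T := (M * Mᵀ) ^ 2 ^ k)
        (by rw [Matrix.transpose_pow, hP]) (by rw [Matrix.transpose_pow, hQ])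
      rw [← pow_add, ← pow_add, ← two_mul, ← pow_succ', trace_mul_pow_comm Mᵀ M] at h5
      linarith
    · have h1 := ihA (P * Q)
      have h2 : P * Q * (P * Q)ᵀ = P * (Q * Q * P) := by
        rw [Matrix.transpose_mul, hP, hQ]; simp only [mul_assoc]
      have h3 : Q * Q * P * P = (Q * Q) * (P * P) := by simp only [mul_assoc]
      rw [h2, trace_mul_pow_comm P (Q * Q * P), h3] at h1
      have h4 := ihB (Q * Q) (P * P) (by rw [Matrix.transpose_mul, hQ])
        (by rw [Matrix.transpose_mul, hP])
      rw [← pow_two, ← pow_two, ← pow_mul, ← pow_mul, ← pow_succ', Matrix.trace_mul_comm] at h4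
      exact (h1.trans (by simp [pow_two])).trans h4

open NormedSpace in
/-- The **Golden–Thompson inequality** for real symmetric matrices. -/
theorem trace_exp_add_le [DecidableEq ι] [Nonempty ι] {A B : Matrix ι ι ℝ} (hA : Aᵀ = A)
    (hB : Bᵀ = B) :
    (exp (A + B)).trace ≤ (exp A * exp B).trace := by
  let _ : NormedAlgebra ℚ (Matrix ι ι ℝ) := NormedAlgebra.restrictScalars ℚ ℝ _
  have hlim := tendsto_exp_mul_exp_pow A B
  have htr : Continuous fun M : Matrix ι ι ℝ => M.trace := continuous_id.matrix_trace
  refine le_of_tendsto ((htr.tendsto _).comp hlim) (Filter.Eventually.of_forall fun k => ?_)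
  have hsymm : ∀ C : Matrix ι ι ℝ, Cᵀ = C →
      (exp ((2 ^ k : ℝ)⁻¹ • C))ᵀ = exp ((2 ^ k : ℝ)⁻¹ • C) := by
    intro C hC
    rw [← Matrix.exp_transpose, Matrix.transpose_smul, hC]
  have hpow : ∀ C : Matrix ι ι ℝ, exp ((2 ^ k : ℝ)⁻¹ • C) ^ 2 ^ k = exp C := by
    intro C
    rw [← NormedSpace.exp_nsmul, ← Nat.cast_smul_eq_nsmul ℝ, smul_smul]
    push_cast
    rw [mul_inv_cancel₀ (by positivity), one_smul]
  have := (trace_pow_two_pow_le k).2 _ _ (hsymm A hA) (hsymm B hB)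
  rwa [hpow, hpow] at this

end TracePowers

/-! ### A Bernstein inequality for sums of independent symmetric matrices -/

section MatrixBernstein

variable {ι : Type*} [Fintype ι]

theorem exists_diagonalization [DecidableEq ι] {A : Matrix ι ι ℝ} (hA : Aᵀ = A) :
    ∃ (V : Matrix ι ι ℝ) (lam : ι → ℝ), Vᵀ * V = 1 ∧ V * Vᵀ = 1 ∧
      A = V * Matrix.diagonal lam * Vᵀ := by
  have hH : A.IsHermitian := by
    rw [Matrix.IsHermitian, Matrix.conjTranspose_eq_transpose_of_trivial, hA]
  have hs := hH.spectral_theorem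
  rw [Unitary.conjStarAlgAut_apply] at hs
  refine ⟨hH.eigenvectorUnitary, hH.eigenvalues, ?_, ?_, ?_⟩
  · have := Unitary.coe_star_mul_self hH.eigenvectorUnitary
    rwa [Matrix.star_eq_conjTranspose, Matrix.conjTranspose_eq_transpose_of_trivial] at this
  · have := Unitary.coe_mul_star_self hH.eigenvectorUnitary
    rwa [Unitary.coe_star, Matrix.star_eq_conjTranspose,
      Matrix.conjTranspose_eq_transpose_of_trivial] at this
  · rw [Matrix.star_eq_conjTranspose, Matrix.conjTranspose_eq_transpose_of_trivial] at hs
    exact hs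

theorem exp_diagonalization [DecidableEq ι] {V : Matrix ι ι ℝ} {lam : ι → ℝ} (h1 : Vᵀ * V = 1)
    (h2 : V * Vᵀ = 1) :
    NormedSpace.exp (V * Matrix.diagonal lam * Vᵀ)
      = V * Matrix.diagonal (fun i => Real.exp (lam i)) * Vᵀ := by
  have hinv : V⁻¹ = Vᵀ := Matrix.inv_eq_left_inv h1
  have hu : IsUnit V := ⟨⟨V, Vᵀ, h2, h1⟩, rfl⟩
  rw [← hinv, Matrix.exp_conj _ _ hu, Matrix.exp_diagonal]
  have h : NormedSpace.exp lam = fun i => Real.exp (lam i) := by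
    let _ : NormedAlgebra ℚ ℝ := NormedAlgebra.restrictScalars ℚ ℝ ℝ
    rw [NormedSpace.exp_eq_tsum ℝ, Real.exp_eq_exp_ℝ]
    have := Pi.exp_def lam
    rwa [NormedSpace.exp_eq_tsum ℝ] at this
  rw [h]

theorem abs_eigenvalue_le [DecidableEq ι] {V : Matrix ι ι ℝ} {lam : ι → ℝ} (h1 : Vᵀ * V = 1)
    (i : ι) :
    |lam i| ≤ ‖V * Matrix.diagonal lam * Vᵀ‖ := by
  have h := vnorm_mulVec_le (V * Matrix.diagonal lam * Vᵀ) (V *ᵥ Pi.single i 1)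
  rw [Matrix.mulVec_mulVec, Matrix.mul_assoc, h1, Matrix.mul_one, ← Matrix.mulVec_mulVec,
    vnorm_mulVec_of_transpose_mul_self_eq_one h1, vnorm_mulVec_of_transpose_mul_self_eq_one h1,
    vnorm_single, mul_one] at h
  have h3 : Matrix.diagonal lam *ᵥ Pi.single i 1 = lam i • Pi.single i (1 : ℝ) := by
    ext j
    by_cases hj : j = i
    · subst hj; simp
    · simp [hj, Matrix.mulVec_single]
  rwa [h3, vnorm_smul, vnorm_single, mul_one] at h

theorem dotProduct_conj_diagonal [DecidableEq ι] (V : Matrix ι ι ℝ) (lam : ι → ℝ) (x : ι → ℝ) :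
    x ⬝ᵥ ((V * Matrix.diagonal lam * Vᵀ) *ᵥ x) = ∑ i, lam i * (Vᵀ *ᵥ x) i ^ 2 := by
  rw [← Matrix.mulVec_mulVec, ← Matrix.mulVec_mulVec, Matrix.dotProduct_mulVec,
    ← Matrix.mulVec_transpose, dotProduct]
  refine Finset.sum_congr rfl fun i _ => ?_
  rw [Matrix.mulVec_diagonal]
  ring

/-- The cubic Taylor remainder is absorbed into `ρ / 2 * x ^ 2`. Keeping `ρ` explicit brings the
variance factor close to `1 / 2`, which the numerical constants of the initialization require. -/
theorem exp_le_quadratic {x ρ : ℝ} (hx : |x| ≤ ρ) (hρ : ρ ≤ 1) :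
    Real.exp x ≤ 1 + x + (1 + ρ) / 2 * x ^ 2 := by
  have h := Real.exp_bound (hx.trans hρ) (n := 3) (by norm_num)
  norm_num [Finset.sum_range_succ, Nat.factorial] at h
  have h1 := (abs_le.1 h).2
  have h2 : |x| ^ 3 ≤ ρ * x ^ 2 := by
    rw [pow_succ, sq_abs, mul_comm]
    exact mul_le_mul_of_nonneg_right hx (sq_nonneg x)
  have h3 : 0 ≤ |x| ^ 3 := by positivity
  nlinarith

theorem dotProduct_exp_le [DecidableEq ι] {A : Matrix ι ι ℝ} (hA : Aᵀ = A) {ρ : ℝ}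
    (hn : ‖A‖ ≤ ρ) (hρ : ρ ≤ 1)
    (x : ι → ℝ) :
    x ⬝ᵥ (NormedSpace.exp A *ᵥ x)
      ≤ vnorm x ^ 2 + x ⬝ᵥ (A *ᵥ x) + (1 + ρ) / 2 * vnorm (A *ᵥ x) ^ 2 := by
  obtain ⟨V, lam, h1, h2, rfl⟩ := exists_diagonalization hA
  rw [exp_diagonalization h1 h2, dotProduct_conj_diagonal, dotProduct_conj_diagonal]
  have e1 : vnorm x ^ 2 = ∑ i, (Vᵀ *ᵥ x) i ^ 2 := by
    rw [← vnorm_sq]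
    have h2' : Vᵀᵀ * Vᵀ = 1 := by rwa [Matrix.transpose_transpose]
    rw [vnorm_mulVec_of_transpose_mul_self_eq_one h2']
  have e2 : vnorm ((V * Matrix.diagonal lam * Vᵀ) *ᵥ x) ^ 2
      = ∑ i, lam i ^ 2 * (Vᵀ *ᵥ x) i ^ 2 := by
    rw [← Matrix.mulVec_mulVec, ← Matrix.mulVec_mulVec,
      vnorm_mulVec_of_transpose_mul_self_eq_one h1, vnorm_sq]
    refine Finset.sum_congr rfl fun i _ => ?_
    rw [Matrix.mulVec_diagonal]
    ring
  rw [e1, e2, Finset.mul_sum, ← Finset.sum_add_distrib, ← Finset.sum_add_distrib]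
  refine Finset.sum_le_sum fun i _ => ?_
  have h := exp_le_quadratic ((abs_eigenvalue_le h1 i).trans hn) hρ
  nlinarith [mul_le_mul_of_nonneg_right h (sq_nonneg ((Vᵀ *ᵥ x) i))]

/-- The left trace is the sum of the quadratic form of `M` over the rows of `Y`. With `Y = exp (S /
2)` this replaces a factor `M` next to `exp S` by the scalar `c`. -/
theorem trace_mul_mul_self_le {M Y : Matrix ι ι ℝ} {c : ℝ}
    (hM : ∀ x, x ⬝ᵥ (M *ᵥ x) ≤ c * vnorm x ^ 2) (hY : Yᵀ = Y) :
    (M * (Y * Y)).trace ≤ c * (Y * Y).trace := by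
  have h1 : (M * (Y * Y)).trace = ∑ i, Y i ⬝ᵥ (M *ᵥ Y i) := by
    rw [← Matrix.mul_assoc, Matrix.trace_mul_comm]
    have hrow : ∀ i j, Y i j = Y j i := fun i j => by
      conv_lhs => rw [← hY]
      rfl
    simp only [Matrix.trace, Matrix.diag, Matrix.mul_apply, dotProduct, Matrix.mulVec]
    refine Finset.sum_congr rfl fun i _ => Finset.sum_congr rfl fun j _ => ?_
    congr 1
    exact Finset.sum_congr rfl fun k _ => by rw [hrow k i]
  have h2 : (Y * Y).trace = ∑ i, vnorm (Y i) ^ 2 := by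
    have hrow : ∀ i j, Y i j = Y j i := fun i j => by
      conv_lhs => rw [← hY]
      rfl
    simp only [Matrix.trace, Matrix.diag, Matrix.mul_apply, vnorm_sq]
    exact Finset.sum_congr rfl fun i _ => Finset.sum_congr rfl fun j _ => by
      rw [hrow j i, pow_two]
  rw [h1, h2, Finset.mul_sum]
  exact Finset.sum_le_sum fun i _ => hM _

open NormedSpace in
-- Golden–Thompson splits off the first draw as a factor `exp (ξ a)`. Summed over `a`, the linear
-- term of the exponential cancels, and the quadratic term leaves a form bounded by the scalar `|A|
-- exp ((1 + ρ) v / 2)`. Induction on the number of draws multiplies these scalars.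
theorem sum_trace_exp_sum_le [DecidableEq ι] [Nonempty ι] {A : Type*} [Fintype A]
    (ξ : A → Matrix ι ι ℝ)
    (hsymm : ∀ a, (ξ a)ᵀ = ξ a) (hzero : ∑ a, ξ a = 0) {ρ v : ℝ} (hρ : ρ ≤ 1)
    (hnorm : ∀ a, ‖ξ a‖ ≤ ρ)
    (hρ0 : 0 ≤ ρ)
    (hvar : ∀ x, ∑ a, vnorm (ξ a *ᵥ x) ^ 2 ≤ Fintype.card A * v * vnorm x ^ 2) (m : ℕ) :
    ∑ ω : Fin m → A, (exp (∑ k, ξ (ω k))).trace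
      ≤ Fintype.card ι * (Fintype.card A * Real.exp ((1 + ρ) / 2 * v)) ^ m := by
  have hM : ∀ x, x ⬝ᵥ ((∑ a, exp (ξ a)) *ᵥ x)
      ≤ (Fintype.card A * Real.exp ((1 + ρ) / 2 * v)) * vnorm x ^ 2 := by
    intro x
    rw [Matrix.sum_mulVec, dotProduct_sum]
    have h1 : ∑ a, x ⬝ᵥ (exp (ξ a) *ᵥ x)
        ≤ ∑ a, (vnorm x ^ 2 + x ⬝ᵥ (ξ a *ᵥ x) + (1 + ρ) / 2 * vnorm (ξ a *ᵥ x) ^ 2) :=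
      Finset.sum_le_sum fun a _ => dotProduct_exp_le (hsymm a) (hnorm a) hρ x
    have h2 : ∑ a, x ⬝ᵥ (ξ a *ᵥ x) = 0 := by
      rw [← dotProduct_sum, ← Matrix.sum_mulVec, hzero]
      simp
    rw [Finset.sum_add_distrib, Finset.sum_add_distrib, h2, ← Finset.mul_sum] at h1
    simp only [Finset.sum_const, Finset.card_univ, nsmul_eq_mul, add_zero] at h1
    have h3 := mul_le_mul_of_nonneg_left (hvar x) (by positivity : (0 : ℝ) ≤ (1 + ρ) / 2)
    have h4 := Real.add_one_le_exp ((1 + ρ) / 2 * v)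
    have h5 := mul_le_mul_of_nonneg_left h4
      (by positivity : 0 ≤ (Fintype.card A : ℝ) * vnorm x ^ 2)
    linarith
  induction m with
  | zero => simp [Matrix.trace_one]
  | succ m ih =>
    have hS : ∀ ω : Fin m → A, (∑ k, ξ (ω k))ᵀ = ∑ k, ξ (ω k) := fun ω => by
      rw [Matrix.transpose_sum]
      exact Finset.sum_congr rfl fun k _ => hsymm _
    rw [← (Fin.consEquiv fun _ => A).sum_comp, Fintype.sum_prod_type, Finset.sum_comm]
    calc ∑ ω : Fin m → A, ∑ a : A,
          (exp (∑ k, ξ ((Fin.consEquiv fun _ => A) (a, ω) k))).trace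
        ≤ ∑ ω : Fin m → A, (Fintype.card A * Real.exp ((1 + ρ) / 2 * v))
            * (exp (∑ k, ξ (ω k))).trace := by
          refine Finset.sum_le_sum fun ω _ => ?_
          set S := ∑ k, ξ (ω k) with hSdef
          have hY : exp S = exp ((1 / 2 : ℝ) • S) * exp ((1 / 2 : ℝ) • S) := by
            rw [← Matrix.exp_add_of_commute _ _ (Commute.refl _), ← add_smul]
            norm_num
          have hYs : (exp ((1 / 2 : ℝ) • S))ᵀ = exp ((1 / 2 : ℝ) • S) := by
            rw [← Matrix.exp_transpose, Matrix.transpose_smul, hS ω]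
          have key := trace_mul_mul_self_le hM hYs
          rw [← hY] at key
          refine le_trans ?_ key
          rw [Finset.sum_mul, Matrix.trace_sum]
          refine Finset.sum_le_sum fun a _ => ?_
          rw [Fin.sum_univ_succ]
          simp only [Fin.consEquiv_apply, Fin.cons_zero, Fin.cons_succ]
          exact trace_exp_add_le (hsymm a) (hS ω)
      _ ≤ _ := by
          rw [← Finset.mul_sum, pow_succ]
          have := mul_le_mul_of_nonneg_left ih
            (by positivity : 0 ≤ (Fintype.card A : ℝ) * Real.exp ((1 + ρ) / 2 * v))
          linarith

open NormedSpace in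
-- The norm is attained at some `|λ i|`, and either `exp (λ i)` or `exp (-λ i)` occurs in one of the
-- two traces, all of whose terms are positive.
theorem exp_le_trace_exp_add [DecidableEq ι] [Nonempty ι] {S : Matrix ι ι ℝ} (hS : Sᵀ = S)
    {t : ℝ} (ht : t ≤ ‖S‖) :
    Real.exp t ≤ (exp S).trace + (exp (-S)).trace := by
  obtain ⟨V, lam, h1, h2, rfl⟩ := exists_diagonalization hS
  have hneg : -(V * Matrix.diagonal lam * Vᵀ) = V * Matrix.diagonal (fun i => -lam i) * Vᵀ := by
    rw [← Matrix.diagonal_neg]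
    noncomm_ring
  have htr : ∀ d : ι → ℝ, (V * Matrix.diagonal d * Vᵀ).trace = ∑ i, d i := by
    intro d
    rw [Matrix.trace_mul_comm, ← Matrix.mul_assoc, h1, Matrix.one_mul, Matrix.trace_diagonal]
  obtain ⟨i, hi⟩ := Finite.exists_max fun i => |lam i|
  have hle : ‖V * Matrix.diagonal lam * Vᵀ‖ ≤ |lam i| := by
    have hV := norm_le_of_transpose_mul_self_eq_one h1
    have hV' : ‖Vᵀ‖ ≤ 1 := by rwa [opNorm_transpose]
    calc ‖V * Matrix.diagonal lam * Vᵀ‖ ≤ ‖V‖ * ‖Matrix.diagonal lam‖ * ‖Vᵀ‖ :=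
          (norm_mul_le _ _).trans (mul_le_mul_of_nonneg_right (norm_mul_le _ _) (norm_nonneg _))
      _ ≤ 1 * |lam i| * 1 := by
          gcongr
          exact norm_diagonal_le (abs_nonneg _) hi
      _ = |lam i| := by ring
  rw [hneg, exp_diagonalization h1 h2, exp_diagonalization h1 h2, htr, htr,
    ← Finset.sum_add_distrib]
  refine le_trans ?_ (Finset.single_le_sum
    (f := fun i => Real.exp (lam i) + Real.exp (-lam i)) (fun i _ => by positivity)
    (Finset.mem_univ i))
  refine (Real.exp_le_exp.2 (ht.trans hle)).trans ?_
  rcases abs_cases (lam i) with ⟨h, _⟩ | ⟨h, _⟩ <;> rw [h] <;>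
    linarith [Real.exp_pos (lam i), Real.exp_pos (-lam i)]

open scoped Classical in
/-- **Matrix Bernstein inequality**, for sampling with replacement from a finite population. -/
theorem card_opNorm_sum_ge_le [DecidableEq ι] [Nonempty ι] {A : Type*} [Fintype A]
    (ξ : A → Matrix ι ι ℝ)
    (hsymm : ∀ a, (ξ a)ᵀ = ξ a) (hzero : ∑ a, ξ a = 0) {ρ v θ : ℝ} (hρ0 : 0 ≤ ρ) (hρ : ρ ≤ 1)
    (hθ : 0 ≤ θ) (hnorm : ∀ a, θ * ‖ξ a‖ ≤ ρ)
    (hvar : ∀ x, ∑ a, vnorm (ξ a *ᵥ x) ^ 2 ≤ Fintype.card A * v * vnorm x ^ 2) (m : ℕ) (t : ℝ) :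
    ((Finset.univ.filter fun ω : Fin m → A => t ≤ ‖∑ k, ξ (ω k)‖).card : ℝ)
      ≤ 2 * Fintype.card ι * Real.exp (-(θ * t) + m * ((1 + ρ) / 2 * (θ ^ 2 * v)))
        * Fintype.card A ^ m := by
  -- Both signs are needed, because the operator norm sees the largest and the smallest eigenvalue.
  have main : ∀ s : ℝ, |s| = θ →
      ∑ ω : Fin m → A, (NormedSpace.exp (∑ k, s • ξ (ω k))).trace
        ≤ Fintype.card ι * (Fintype.card A * Real.exp ((1 + ρ) / 2 * (θ ^ 2 * v))) ^ m := by
    intro s hs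
    refine sum_trace_exp_sum_le (fun a => s • ξ a) (fun a => ?_) ?_ hρ (fun a => ?_) hρ0 ?_ m
    · rw [Matrix.transpose_smul, hsymm]
    · rw [← Finset.smul_sum, hzero, smul_zero]
    · rw [norm_smul, Real.norm_eq_abs, hs]
      exact hnorm a
    · intro x
      have h := mul_le_mul_of_nonneg_left (hvar x) (sq_nonneg θ)
      rw [Finset.mul_sum] at h
      calc ∑ a, vnorm ((s • ξ a) *ᵥ x) ^ 2 = ∑ a, θ ^ 2 * vnorm (ξ a *ᵥ x) ^ 2 := by
            refine Finset.sum_congr rfl fun a _ => ?_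
            rw [Matrix.smul_mulVec, vnorm_smul, hs, mul_pow]
        _ ≤ _ := h
        _ = _ := by ring
  have h1 := main θ (abs_of_nonneg hθ)
  have h2 := main (-θ) (by rw [abs_neg, abs_of_nonneg hθ])
  have h3 : ∑ ω ∈ Finset.univ.filter (fun ω : Fin m → A => t ≤ ‖∑ k, ξ (ω k)‖), Real.exp (θ * t)
      ≤ ∑ ω : Fin m → A, ((NormedSpace.exp (∑ k, θ • ξ (ω k))).trace
        + (NormedSpace.exp (∑ k, (-θ) • ξ (ω k))).trace) := by
    have hnn : ∀ ω : Fin m → A, ∀ u : ℝ, u ≤ ‖∑ k, θ • ξ (ω k)‖ →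
        Real.exp u ≤ (NormedSpace.exp (∑ k, θ • ξ (ω k))).trace
        + (NormedSpace.exp (∑ k, (-θ) • ξ (ω k))).trace := by
      intro ω u hu
      have hS : (∑ k, θ • ξ (ω k))ᵀ = ∑ k, θ • ξ (ω k) := by
        rw [Matrix.transpose_sum]
        exact Finset.sum_congr rfl fun k _ => by rw [Matrix.transpose_smul, hsymm]
      have e := exp_le_trace_exp_add hS hu
      have e2 : ∑ k, (-θ) • ξ (ω k) = -∑ k, θ • ξ (ω k) := by
        rw [← Finset.sum_neg_distrib]
        exact Finset.sum_congr rfl fun k _ => by rw [neg_smul]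
      rwa [e2]
    refine (Finset.sum_le_sum fun ω hω => hnn ω (θ * t) ?_).trans
      (Finset.sum_le_univ_sum_of_nonneg fun ω => (Real.exp_pos _).le.trans (hnn ω _ le_rfl))
    rw [← Finset.smul_sum, norm_smul, Real.norm_eq_abs, abs_of_nonneg hθ]
    exact mul_le_mul_of_nonneg_left (Finset.mem_filter.1 hω).2 hθ
  rw [Finset.sum_const, nsmul_eq_mul, Finset.sum_add_distrib] at h3
  have hpos := Real.exp_pos (θ * t)
  have h4 : ((Finset.univ.filter fun ω : Fin m → A => t ≤ ‖∑ k, ξ (ω k)‖).card : ℝ)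
      * Real.exp (θ * t)
      ≤ 2 * (Fintype.card ι
        * (Fintype.card A * Real.exp ((1 + ρ) / 2 * (θ ^ 2 * v))) ^ m) := by linarith
  rw [← le_div_iff₀ hpos] at h4
  refine h4.trans (le_of_eq ?_)
  rw [mul_pow, ← Real.exp_nat_mul, Real.exp_add, Real.exp_neg]
  field_simp

end MatrixBernstein

/-! ### A Bernstein inequality for sums of independent vectors -/

section VectorBernstein

variable {H : Type*} [NormedAddCommGroup H] [InnerProductSpace ℝ H]

/-- The hypothesis says that `s ^ 2` is the average of `(a + b) ^ 2` and `(a - b) ^ 2` with weights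
`(1 ± c) / 2`. As a power series in the square of its argument, cosh has nonnegative coefficients,
so each term is convex in that square. -/
theorem cosh_le_of_sq_eq {a b c s : ℝ} (hc : |c| ≤ 1)
    (hs : s ^ 2 = a ^ 2 + b ^ 2 + 2 * (c * (a * b))) :
    Real.cosh s ≤ Real.cosh a * Real.cosh b + c * (Real.sinh a * Real.sinh b) := by
  obtain ⟨hc1, hc2⟩ := abs_le.1 hc
  have h1 := ((Real.hasSum_cosh (a + b)).mul_left ((1 + c) / 2)).add
    ((Real.hasSum_cosh (a - b)).mul_left ((1 - c) / 2))
  have h2 : Real.cosh s ≤ (1 + c) / 2 * Real.cosh (a + b) + (1 - c) / 2 * Real.cosh (a - b) := by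
    refine hasSum_le (fun k => ?_) (Real.hasSum_cosh s) h1
    rw [← mul_div_assoc, ← mul_div_assoc, ← add_div]
    gcongr
    rw [pow_mul, pow_mul, pow_mul]
    have hconv := (convexOn_pow (𝕜 := ℝ) k).2 (Set.mem_Ici.2 (sq_nonneg (a + b)))
      (Set.mem_Ici.2 (sq_nonneg (a - b))) (show 0 ≤ (1 + c) / 2 by linarith)
      (show 0 ≤ (1 - c) / 2 by linarith) (by ring)
    simp only [smul_eq_mul] at hconv
    refine le_trans (le_of_eq ?_) hconv
    rw [hs]
    ring
  rw [Real.cosh_add, Real.cosh_sub] at h2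
  linarith

/-- With `c` the cosine of the angle between `x` and `y`, the previous bound applies to `‖x + y‖`.
Replacing `sinh ‖y‖` by `‖y‖` makes one term linear in `y`, so that it averages out over centred
draws; the error is absorbed by `exp b - b ≤ 1 + b ^ 2`. -/
theorem cosh_norm_add_le (x y : H) (hy : ‖y‖ ≤ 1) :
    Real.cosh ‖x + y‖ ≤ Real.cosh ‖x‖ * (1 + ‖y‖ ^ 2)
      + Real.sinh ‖x‖ / ‖x‖ * inner ℝ x y := by
  set a := ‖x‖
  set b := ‖y‖
  have ha : 0 ≤ a := norm_nonneg x
  have hb : 0 ≤ b := norm_nonneg y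
  set c := inner ℝ x y / (a * b) with hc
  have hc1 : |c| ≤ 1 := abs_real_inner_div_norm_mul_norm_le_one x y
  have hcab : c * (a * b) = inner ℝ x y := by
    by_cases h : a * b = 0
    · rw [h, mul_zero]
      rcases mul_eq_zero.1 h with h | h
      · rw [norm_eq_zero.1 h, inner_zero_left]
      · rw [norm_eq_zero.1 h, inner_zero_right]
    · rw [hc, div_mul_cancel₀ _ h]
  have h1 := cosh_le_of_sq_eq hc1 (s := ‖x + y‖) (a := a) (b := b) (by
    rw [hcab, norm_add_sq_real]; ring)
  have h2 : Real.sinh a / a * inner ℝ x y = Real.sinh a * (c * b) := by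
    rw [← hcab]
    by_cases h : a = 0
    · simp [h]
    · field_simp
  have hsa : 0 ≤ Real.sinh a := Real.sinh_nonneg_iff.2 ha
  have hsb : b ≤ Real.sinh b := Real.self_le_sinh_iff.2 hb
  have h3 : c * (Real.sinh b - b) ≤ Real.sinh b - b :=
    mul_le_of_le_one_left (by linarith) (abs_le.1 hc1).2
  have h4 : Real.cosh b + Real.sinh b - b ≤ 1 + b ^ 2 := by
    have h := (abs_le.1 (Real.abs_exp_sub_one_sub_id_le (x := b) (by rwa [abs_of_nonneg hb]))).2
    rw [Real.cosh_add_sinh]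
    linarith
  have h5 : Real.sinh a ≤ Real.cosh a := (Real.sinh_lt_cosh a).le
  rw [h2]
  have h6 := mul_le_mul_of_nonneg_left h3 hsa
  have h7 := mul_le_mul_of_nonneg_right h5 (by linarith : 0 ≤ Real.sinh b - b)
  have h8 := mul_le_mul_of_nonneg_left h4 (Real.cosh_pos a).le
  linarith

/-- The draws are peeled off one at a time: averaging over the first kills the term linear in it and
leaves the factor `1 + v 0 ≤ exp (v 0)`. The summands may depend on `k`, which the leave-one-out
argument uses to switch off single draws. -/
theorem sum_cosh_norm_sum_le {A : Type*} [Fintype A] {m : ℕ} (ξ : Fin m → A → H)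
    (hzero : ∀ k, ∑ a, ξ k a = 0) (hR : ∀ k a, ‖ξ k a‖ ≤ 1) (v : Fin m → ℝ)
    (hvar : ∀ k, ∑ a, ‖ξ k a‖ ^ 2 ≤ Fintype.card A * v k) :
    ∑ ω : Fin m → A, Real.cosh ‖∑ k, ξ k (ω k)‖
      ≤ Fintype.card A ^ m * Real.exp (∑ k, v k) := by
  induction m with
  | zero => simp
  | succ m ih =>
    rw [← (Fin.consEquiv fun _ => A).sum_comp, Fintype.sum_prod_type, Finset.sum_comm]
    have ih' := ih (fun k => ξ k.succ) (fun k => hzero _) (fun k a => hR _ _) (fun k => v k.succ)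
      (fun k => hvar _)
    calc ∑ ω : Fin m → A, ∑ a : A,
          Real.cosh ‖∑ k, ξ k ((Fin.consEquiv fun _ => A) (a, ω) k)‖
        ≤ ∑ ω : Fin m → A, (Fintype.card A * Real.exp (v 0))
            * Real.cosh ‖∑ k : Fin m, ξ k.succ (ω k)‖ := by
          refine Finset.sum_le_sum fun ω _ => ?_
          set x := ∑ k : Fin m, ξ k.succ (ω k) with hx
          have h1 : ∀ a, Real.cosh ‖∑ k, ξ k ((Fin.consEquiv fun _ => A) (a, ω) k)‖
              ≤ Real.cosh ‖x‖ * (1 + ‖ξ 0 a‖ ^ 2)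
                + Real.sinh ‖x‖ / ‖x‖ * inner ℝ x (ξ 0 a) := by
            intro a
            rw [Fin.sum_univ_succ]
            simp only [Fin.consEquiv_apply, Fin.cons_zero, Fin.cons_succ]
            rw [add_comm]
            exact cosh_norm_add_le x (ξ 0 a) (hR 0 a)
          refine (Finset.sum_le_sum fun a _ => h1 a).trans ?_
          rw [Finset.sum_add_distrib, ← Finset.mul_sum, ← Finset.mul_sum, ← inner_sum, hzero,
            inner_zero_right, mul_zero, add_zero, mul_comm]
          gcongr
          rw [Finset.sum_add_distrib]
          simp only [Finset.sum_const, Finset.card_univ, nsmul_eq_mul, mul_one]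
          have h2 := mul_le_mul_of_nonneg_left (Real.add_one_le_exp (v 0))
            (Nat.cast_nonneg (Fintype.card A) : (0 : ℝ) ≤ _)
          linarith [hvar 0]
      _ ≤ _ := by
          rw [← Finset.mul_sum, Fin.sum_univ_succ, Real.exp_add, pow_succ]
          refine (mul_le_mul_of_nonneg_left ih' (by positivity)).trans (le_of_eq ?_)
          ring

open scoped Classical in
/-- **Vector Bernstein inequality** (Pinelis), for independent draws from a finite population. -/
theorem card_norm_sum_ge_le {A : Type*} [Fintype A] {m : ℕ} (ξ : Fin m → A → H)
    (hzero : ∀ k, ∑ a, ξ k a = 0) {θ : ℝ} (hθ : 0 ≤ θ) (hR : ∀ k a, θ * ‖ξ k a‖ ≤ 1)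
    (v : Fin m → ℝ) (hvar : ∀ k, ∑ a, ‖ξ k a‖ ^ 2 ≤ Fintype.card A * v k) (t : ℝ) :
    ((Finset.univ.filter fun ω : Fin m → A => t ≤ ‖∑ k, ξ k (ω k)‖).card : ℝ)
      ≤ 2 * Real.exp (-(θ * t) + θ ^ 2 * ∑ k, v k) * Fintype.card A ^ m := by
  have h := sum_cosh_norm_sum_le (fun k a => θ • ξ k a)
    (fun k => by rw [← Finset.smul_sum, hzero, smul_zero])
    (fun k a => by rw [norm_smul, Real.norm_eq_abs, abs_of_nonneg hθ]; exact hR k a)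
    (fun k => θ ^ 2 * v k) (fun k => by
      have := mul_le_mul_of_nonneg_left (hvar k) (sq_nonneg θ)
      rw [Finset.mul_sum] at this
      simp only [norm_smul, Real.norm_eq_abs, mul_pow, sq_abs]
      linarith)
  have h1 : ∑ ω ∈ Finset.univ.filter (fun ω : Fin m → A => t ≤ ‖∑ k, ξ k (ω k)‖),
      Real.exp (θ * t) / 2 ≤ ∑ ω : Fin m → A, Real.cosh ‖∑ k, θ • ξ k (ω k)‖ := by
    refine (Finset.sum_le_sum fun ω hω => ?_).trans
      (Finset.sum_le_univ_sum_of_nonneg fun ω => (Real.cosh_pos _).le)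
    rw [← Finset.smul_sum, norm_smul, Real.norm_eq_abs, abs_of_nonneg hθ, Real.cosh_eq]
    have h2 := mul_le_mul_of_nonneg_left (Finset.mem_filter.1 hω).2 hθ
    have h3 := Real.exp_le_exp.2 h2
    have h4 := Real.exp_pos (-(θ * ‖∑ k, ξ k (ω k)‖))
    linarith
  rw [Finset.sum_const, nsmul_eq_mul] at h1
  have h2 := h1.trans h
  rw [← le_div_iff₀ (by positivity)] at h2
  refine h2.trans (le_of_eq ?_)
  rw [← Finset.mul_sum, Real.exp_add, Real.exp_neg]
  field_simp

end VectorBernstein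

/-! ### Perturbation of dominant eigenspaces -/

section Perturbation

variable {n r : ℕ}

/-- `P` is the spectral projection of the symmetric matrix `Y` onto `r` eigenvectors whose
eigenvalues are at least `a` in absolute value, the remaining eigenvalues being at most `b`, and
`Q` is the inverse of `Y` on the range of `P`. -/
structure TopSplit (r : ℕ) (Y P Q : Matrix (Fin n) (Fin n) ℝ) (a b : ℝ) : Prop where
  proj : IsOrthProj P
  trace_eq : P.trace = r
  comm : P * Y = Y * P
  inv_mul : Q * Y = P
  mul_inv : Y * Q = P
  proj_inv : P * Q = Q
  inv_proj : Q * P = Q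
  norm_inv : ‖Q‖ ≤ a⁻¹
  norm_tail : ‖(1 - P) * Y‖ ≤ b

theorem norm_conj_diagonal_le {ι : Type*} [Fintype ι] [DecidableEq ι] {U : Matrix (Fin n) ι ℝ}
    (hU : Uᵀ * U = 1) {d : ι → ℝ} {c : ℝ} (hc : 0 ≤ c) (hd : ∀ i, |d i| ≤ c) :
    ‖U * Matrix.diagonal d * Uᵀ‖ ≤ c := by
  have hV := norm_le_of_transpose_mul_self_eq_one hU
  have hV' : ‖Uᵀ‖ ≤ 1 := by rwa [opNorm_transpose]
  calc ‖U * Matrix.diagonal d * Uᵀ‖ ≤ ‖U‖ * ‖Matrix.diagonal d‖ * ‖Uᵀ‖ :=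
        (Matrix.l2_opNorm_mul _ _).trans
          (mul_le_mul_of_nonneg_right (Matrix.l2_opNorm_mul _ _) (norm_nonneg _))
    _ ≤ 1 * c * 1 := by
        gcongr
        exact norm_diagonal_le hc hd
    _ = c := by ring

theorem conj_diagonal_mul {ι : Type*} [Fintype ι] [DecidableEq ι] {U : Matrix (Fin n) ι ℝ}
    (hU : Uᵀ * U = 1) (d e : ι → ℝ) :
    (U * Matrix.diagonal d * Uᵀ) * (U * Matrix.diagonal e * Uᵀ)
      = U * Matrix.diagonal (fun i => d i * e i) * Uᵀ := by
  rw [← Matrix.diagonal_mul_diagonal]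
  calc (U * Matrix.diagonal d * Uᵀ) * (U * Matrix.diagonal e * Uᵀ)
      = U * Matrix.diagonal d * (Uᵀ * U) * Matrix.diagonal e * Uᵀ := by simp only [Matrix.mul_assoc]
    _ = _ := by rw [hU, Matrix.mul_one]; simp only [Matrix.mul_assoc]

theorem conj_diagonal_transpose {ι : Type*} [Fintype ι] [DecidableEq ι] (U : Matrix (Fin n) ι ℝ)
    (d : ι → ℝ) : (U * Matrix.diagonal d * Uᵀ)ᵀ = U * Matrix.diagonal d * Uᵀ := by
  rw [Matrix.transpose_mul, Matrix.transpose_mul, Matrix.transpose_transpose,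
    Matrix.diagonal_transpose, Matrix.mul_assoc]

theorem topSplit_of_isThinEig {X : Matrix (Fin n) (Fin n) ℝ} {U : Matrix (Fin n) (Fin r) ℝ}
    {d : Fin r → ℝ} (h : IsThinEig X U d) {σ : ℝ} (hσ : 0 < σ) (hd : ∀ k, σ ≤ |d k|) :
    TopSplit r X (U * Uᵀ) (U * Matrix.diagonal (fun k : Fin r => (d k)⁻¹) * Uᵀ) σ 0 := by
  obtain ⟨hU, rfl⟩ := h
  have hne : ∀ k, d k ≠ 0 := fun k => abs_pos.1 (hσ.trans_le (hd k))
  have hP : U * Uᵀ = U * Matrix.diagonal (fun _ : Fin r => (1 : ℝ)) * Uᵀ := by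
    rw [Matrix.diagonal_one, Matrix.mul_one]
  refine ⟨isOrthProj_mul_transpose hU, ?_, ?_, ?_, ?_, ?_, ?_, ?_, ?_⟩
  · rw [Matrix.trace_mul_comm, hU, Matrix.trace_one, Fintype.card_fin]
  · rw [hP, conj_diagonal_mul hU, conj_diagonal_mul hU]
    simp
  · rw [hP, conj_diagonal_mul hU]
    simp [hne]
  · rw [hP, conj_diagonal_mul hU]
    simp [hne]
  · rw [hP, conj_diagonal_mul hU]
    simp
  · rw [hP, conj_diagonal_mul hU]
    simp
  · refine norm_conj_diagonal_le hU (by positivity) fun k => ?_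
    rw [abs_inv]
    exact inv_anti₀ hσ (hd k)
  · rw [sub_mul, hP, conj_diagonal_mul hU]
    simp

theorem exists_ne_zero_map_eq_zero {ι κ : Type*} [Fintype ι] [Fintype κ]
    (f : (ι → ℝ) →ₗ[ℝ] (κ → ℝ)) (h : Fintype.card κ < Fintype.card ι) : ∃ c, c ≠ 0 ∧ f c = 0 := by
  have hk : LinearMap.ker f ≠ ⊥ := LinearMap.ker_ne_bot_of_finrank_lt (by simpa using h)
  obtain ⟨c, hc, hc0⟩ := Submodule.exists_mem_ne_zero_of_ne_bot hk
  exact ⟨c, hc0, hc⟩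

theorem vnorm_conj_diagonal_mulVec_sq {V : Matrix (Fin n) (Fin n) ℝ} (hV : Vᵀ * V = 1)
    (lam : Fin n → ℝ) (x : Fin n → ℝ) :
    vnorm ((V * Matrix.diagonal lam * Vᵀ) *ᵥ x) ^ 2 = ∑ i, lam i ^ 2 * (Vᵀ *ᵥ x) i ^ 2 := by
  rw [← Matrix.mulVec_mulVec, ← Matrix.mulVec_mulVec,
    vnorm_mulVec_of_transpose_mul_self_eq_one hV, vnorm_sq]
  refine Finset.sum_congr rfl fun i _ => ?_
  rw [Matrix.mulVec_diagonal]
  ring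

/-- Weyl's inequality for the small eigenvalues of a perturbed matrix of rank `r`. -/
theorem abs_eigenvalue_le_of_le {X : Matrix (Fin n) (Fin n) ℝ} {U : Matrix (Fin n) (Fin r) ℝ}
    {d : Fin r → ℝ} (h : IsThinEig X U d)
    {V : Matrix (Fin n) (Fin n) ℝ} (hV : Vᵀ * V = 1) {lam : Fin n → ℝ}
    (hlam : ∀ i j : Fin n, i ≤ j → |lam j| ≤ |lam i|) {η : ℝ}
    (hη : ‖V * Matrix.diagonal lam * Vᵀ - X‖ ≤ η) {i : Fin n} (hi : r ≤ i) : |lam i| ≤ η := by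
  obtain ⟨hU, rfl⟩ := h
  -- Dimension count: since `r ≤ i`, the `r + (n - 1 - i)` conditions leave a nonzero combination of
  -- the first `i + 1` eigenvectors that `X` annihilates.
  let f : (Fin n → ℝ) →ₗ[ℝ] (Fin r ⊕ {j : Fin n // i < j} → ℝ) :=
    LinearMap.pi (Sum.elim (fun k => LinearMap.proj k ∘ₗ (Uᵀ * V).mulVecLin)
      (fun j => LinearMap.proj j.1))
  have hcard : Fintype.card (Fin r ⊕ {j : Fin n // i < j}) < Fintype.card (Fin n) := by
    rw [Fintype.card_sum, Fintype.card_fin, Fintype.card_fin, Fintype.card_subtype]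
    have : (Finset.univ.filter fun j : Fin n => i < j) = Finset.Ioi i := by ext; simp
    rw [this, Fin.card_Ioi]
    omega
  obtain ⟨c, hc, hfc⟩ := exists_ne_zero_map_eq_zero f hcard
  have hc1 : (Uᵀ * V) *ᵥ c = 0 := by
    ext k
    exact congrFun hfc (Sum.inl k)
  have hc2 : ∀ j, i < j → c j = 0 := fun j hj => congrFun hfc (Sum.inr ⟨j, hj⟩)
  set x := V *ᵥ c with hx
  have hxn : vnorm x = vnorm c := vnorm_mulVec_of_transpose_mul_self_eq_one hV c
  have hVx : Vᵀ *ᵥ x = c := by rw [hx, Matrix.mulVec_mulVec, hV, Matrix.one_mulVec]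
  have hXx : (U * Matrix.diagonal d * Uᵀ) *ᵥ x = 0 := by
    rw [← Matrix.mulVec_mulVec, hx, Matrix.mulVec_mulVec _ Uᵀ V, hc1, Matrix.mulVec_zero]
  have h1 := vnorm_mulVec_le (V * Matrix.diagonal lam * Vᵀ - U * Matrix.diagonal d * Uᵀ) x
  rw [Matrix.sub_mulVec, hXx, sub_zero] at h1
  have h2 : (|lam i| * vnorm c) ^ 2 ≤ vnorm ((V * Matrix.diagonal lam * Vᵀ) *ᵥ x) ^ 2 := by
    rw [vnorm_conj_diagonal_mulVec_sq hV, hVx, mul_pow, vnorm_sq, Finset.mul_sum]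
    refine Finset.sum_le_sum fun j _ => ?_
    by_cases hj : i < j
    · simp [hc2 j hj]
    · rw [← sq_abs (lam j)]
      have := hlam j i (not_lt.1 hj)
      gcongr
  have h3 := (abs_le_of_sq_le_sq' h2 (vnorm_nonneg _)).2
  have hpos := vnorm_pos hc
  rw [hxn] at h1
  have h4 := mul_le_mul_of_nonneg_right hη hpos.le
  exact le_of_mul_le_mul_right (h3.trans (h1.trans h4)) hpos

/-- Weyl's inequality for the dominant eigenvalues of a perturbed matrix of rank `r`. -/
theorem le_abs_eigenvalue_of_lt {X : Matrix (Fin n) (Fin n) ℝ} {U : Matrix (Fin n) (Fin r) ℝ}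
    {d : Fin r → ℝ} (h : IsThinEig X U d) {σ : ℝ} (hσ : 0 ≤ σ) (hd : ∀ k, σ ≤ |d k|)
    {V : Matrix (Fin n) (Fin n) ℝ} (hV : Vᵀ * V = 1) {lam : Fin n → ℝ}
    (hlam : ∀ i j : Fin n, i ≤ j → |lam j| ≤ |lam i|) {η : ℝ}
    (hη : ‖V * Matrix.diagonal lam * Vᵀ - X‖ ≤ η) {i : Fin n} (hi : (i : ℕ) < r) :
    σ - η ≤ |lam i| := by
  obtain ⟨hU, rfl⟩ := h
  -- Dimension count: since `i < r`, some nonzero vector in the range of `U` is orthogonal to the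
  -- first `i` eigenvectors.
  let f : (Fin r → ℝ) →ₗ[ℝ] ({j : Fin n // j < i} → ℝ) :=
    LinearMap.pi (fun j => LinearMap.proj j.1 ∘ₗ (Vᵀ * U).mulVecLin)
  have hcard : Fintype.card {j : Fin n // j < i} < Fintype.card (Fin r) := by
    rw [Fintype.card_fin, Fintype.card_subtype]
    have : (Finset.univ.filter fun j : Fin n => j < i) = Finset.Iio i := by ext; simp
    rw [this, Fin.card_Iio]
    exact hi
  obtain ⟨z, hz, hfz⟩ := exists_ne_zero_map_eq_zero f hcard
  set x := U *ᵥ z with hx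
  have hxn : vnorm x = vnorm z := vnorm_mulVec_of_transpose_mul_self_eq_one hU z
  have hVx : ∀ j, j < i → (Vᵀ *ᵥ x) j = 0 := fun j hj => by
    rw [hx, Matrix.mulVec_mulVec]
    exact congrFun hfz ⟨j, hj⟩
  have hV' : V * Vᵀ = 1 := mul_eq_one_comm.1 hV
  have hVn : vnorm (Vᵀ *ᵥ x) = vnorm x :=
    vnorm_mulVec_of_transpose_mul_self_eq_one (by rwa [Matrix.transpose_transpose]) x
  have hXx : σ * vnorm z ≤ vnorm ((U * Matrix.diagonal d * Uᵀ) *ᵥ x) := by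
    rw [hx, Matrix.mulVec_mulVec, Matrix.mul_assoc, Matrix.mul_assoc, hU, Matrix.mul_one,
      ← Matrix.mulVec_mulVec, vnorm_mulVec_of_transpose_mul_self_eq_one hU]
    apply le_of_sq_le_sq _ (vnorm_nonneg _)
    rw [mul_pow, vnorm_sq, vnorm_sq, Finset.mul_sum]
    refine Finset.sum_le_sum fun k _ => ?_
    rw [Matrix.mulVec_diagonal, mul_pow, ← sq_abs (d k)]
    have := hd k
    gcongr
  have h1 := vnorm_mulVec_le (V * Matrix.diagonal lam * Vᵀ - U * Matrix.diagonal d * Uᵀ) x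
  rw [Matrix.sub_mulVec] at h1
  have h2 : vnorm ((V * Matrix.diagonal lam * Vᵀ) *ᵥ x) ^ 2 ≤ (|lam i| * vnorm x) ^ 2 := by
    rw [vnorm_conj_diagonal_mulVec_sq hV, mul_pow, ← hVn, vnorm_sq, Finset.mul_sum]
    refine Finset.sum_le_sum fun j _ => ?_
    by_cases hj : j < i
    · simp [hVx j hj]
    · rw [← sq_abs (lam j)]
      have := hlam i j (not_lt.1 hj)
      gcongr
  have h3 := (abs_le_of_sq_le_sq' h2 (mul_nonneg (abs_nonneg _) (vnorm_nonneg _))).2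
  have h4 := vnorm_sub_le ((V * Matrix.diagonal lam * Vᵀ) *ᵥ x)
    ((V * Matrix.diagonal lam * Vᵀ) *ᵥ x - (U * Matrix.diagonal d * Uᵀ) *ᵥ x)
  rw [sub_sub_cancel] at h4
  have hpos := vnorm_pos hz
  rw [hxn] at h1 h3
  have h5 := mul_le_mul_of_nonneg_right hη hpos.le
  refine le_of_mul_le_mul_right ?_ hpos
  linarith

/-- The two Weyl bounds put the first `r` eigenvalues above `σ - η` and the others below `η` in
absolute value. The projection, the partial inverse and a thin decomposition of `H` are then all
read off from the first `r` columns of `V`. -/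
theorem hardThreshold_topSplit {X : Matrix (Fin n) (Fin n) ℝ} {U : Matrix (Fin n) (Fin r) ℝ}
    {d : Fin r → ℝ} (h : IsThinEig X U d) (hrn : r ≤ n) {σ η : ℝ} (hησ : η < σ)
    (hd : ∀ k, σ ≤ |d k|) {Y H : Matrix (Fin n) (Fin n) ℝ} (hH : IsHardThreshold r Y H)
    (hη : ‖Y - X‖ ≤ η) :
    ∃ (P Q : Matrix (Fin n) (Fin n) ℝ) (U' : Matrix (Fin n) (Fin r) ℝ) (d' : Fin r → ℝ),
      TopSplit r Y P Q (σ - η) η ∧ H = P * Y ∧ H * Q = P ∧ IsThinEig H U' d' ∧ U' * U'ᵀ = P := by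
  obtain ⟨V, lam, hV, rfl, hlam, rfl⟩ := hH
  have hη0 : 0 ≤ η := (norm_nonneg _).trans hη
  have hbig : ∀ i : Fin n, (i : ℕ) < r → σ - η ≤ |lam i| := fun i hi =>
    le_abs_eigenvalue_of_lt h (by linarith) hd hV hlam hη hi
  have hsmall : ∀ i : Fin n, r ≤ (i : ℕ) → |lam i| ≤ η := fun i hi =>
    abs_eigenvalue_le_of_le h hV hlam hη hi
  have hne : ∀ i : Fin n, (i : ℕ) < r → lam i ≠ 0 := fun i hi =>
    abs_pos.1 (lt_of_lt_of_le (by linarith) (hbig i hi))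
  set e : Fin n → ℝ := fun i => if (i : ℕ) < r then 1 else 0 with he
  have hV' : V * Vᵀ = 1 := mul_eq_one_comm.1 hV
  set W : Matrix (Fin n) (Fin r) ℝ := V.submatrix id (Fin.castLE hrn) with hW
  have hsum : ∀ g : Fin n → ℝ, ∑ i : Fin n, (if (i : ℕ) < r then g i else 0)
      = ∑ k : Fin r, g (Fin.castLE hrn k) := by
    intro g
    symm
    rw [← Finset.sum_filter]
    refine Finset.sum_bij (fun k _ => Fin.castLE hrn k) ?_ ?_ ?_ ?_
    · intro k _; simp
    · intro a _ b _ hab; exact Fin.castLE_injective hrn hab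
    · intro i hi
      exact ⟨⟨i, (Finset.mem_filter.1 hi).2⟩, Finset.mem_univ _, rfl⟩
    · intro k _; rfl
  have hWd : ∀ g : Fin n → ℝ, W * Matrix.diagonal (fun k => g (Fin.castLE hrn k)) * Wᵀ
      = V * Matrix.diagonal (fun i : Fin n => if (i : ℕ) < r then g i else 0) * Vᵀ := by
    intro g
    ext a b
    rw [Matrix.mul_apply, Matrix.mul_apply]
    simp only [Matrix.mul_diagonal, Matrix.transpose_apply, hW, Matrix.submatrix_apply, id]
    rw [← hsum fun i => V a i * g i * V b i]
    exact Finset.sum_congr rfl fun i _ => by split_ifs <;> simp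
  have hWP : W * Wᵀ = V * Matrix.diagonal e * Vᵀ := by
    have := hWd fun _ => 1
    rwa [Matrix.diagonal_one, Matrix.mul_one] at this
  have hWW : Wᵀ * W = 1 := by
    ext a b
    have := congrFun (congrFun hV (Fin.castLE hrn a)) (Fin.castLE hrn b)
    rw [Matrix.mul_apply] at this ⊢
    simp only [hW, Matrix.transpose_apply, Matrix.submatrix_apply, id] at this ⊢
    rw [this, Matrix.one_apply, Matrix.one_apply]
    simp [Fin.ext_iff]
  refine ⟨V * Matrix.diagonal e * Vᵀ,
    V * Matrix.diagonal (fun i : Fin n => if (i : ℕ) < r then (lam i)⁻¹ else 0) * Vᵀ, W,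
    fun k => lam (Fin.castLE hrn k), ⟨?_, ?_, ?_, ?_, ?_, ?_, ?_, ?_, ?_⟩, ?_, ?_, ⟨hWW, ?_⟩, hWP⟩
  · rw [← hWP]
    exact isOrthProj_mul_transpose hWW
  · rw [← hWP, Matrix.trace_mul_comm, hWW, Matrix.trace_one, Fintype.card_fin]
  · rw [conj_diagonal_mul hV, conj_diagonal_mul hV]
    simp only [mul_comm]
  · rw [conj_diagonal_mul hV]
    congr 3
    ext i
    by_cases hi : (i : ℕ) < r <;> simp [he, hi, hne]
  · rw [conj_diagonal_mul hV]
    congr 3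
    ext i
    by_cases hi : (i : ℕ) < r <;> simp [he, hi, hne]
  · rw [conj_diagonal_mul hV]
    congr 3
    ext i
    by_cases hi : (i : ℕ) < r <;> simp [he, hi]
  · rw [conj_diagonal_mul hV]
    congr 3
    ext i
    by_cases hi : (i : ℕ) < r <;> simp [he, hi]
  · have hpos : 0 < σ - η := by linarith
    refine norm_conj_diagonal_le hV (by positivity) fun i => ?_
    split_ifs with hi
    · rw [abs_inv]
      exact inv_anti₀ hpos (hbig i hi)
    · simpa using hpos.le
  · have h1 : (1 : Matrix (Fin n) (Fin n) ℝ) - V * Matrix.diagonal e * Vᵀ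
        = V * Matrix.diagonal (fun i : Fin n => 1 - e i) * Vᵀ := by
      rw [← Matrix.diagonal_sub, Matrix.diagonal_one, Matrix.mul_sub, Matrix.sub_mul,
        Matrix.mul_one, hV']
    rw [h1, conj_diagonal_mul hV]
    refine norm_conj_diagonal_le hV hη0 fun i => ?_
    by_cases hi : (i : ℕ) < r
    · simpa [he, hi] using hη0
    · simpa [he, hi] using hsmall i (not_lt.1 hi)
  · rw [conj_diagonal_mul hV]
    congr 3
    ext i
    by_cases hi : (i : ℕ) < r <;> simp [he, hi]
  · rw [conj_diagonal_mul hV]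
    congr 3
    ext i
    by_cases hi : (i : ℕ) < r <;> simp [he, hi, hne]
  · rw [hWd lam]

theorem exists_hardThreshold {Y : Matrix (Fin n) (Fin n) ℝ} (hY : Yᵀ = Y) (r : ℕ) :
    ∃ H, IsHardThreshold r Y H := by
  obtain ⟨V, lam, h1, h2, h3⟩ := exists_diagonalization hY
  set s := Tuple.sort fun i => -|lam i| with hs
  have hmono := Tuple.monotone_sort fun i => -|lam i|
  refine ⟨_, V.submatrix id s, lam ∘ s, ?_, ?_, ?_, rfl⟩
  · ext a b
    have := congrFun (congrFun h1 (s a)) (s b)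
    rw [Matrix.mul_apply] at this ⊢
    simp only [Matrix.transpose_apply, Matrix.submatrix_apply, id] at this ⊢
    rw [this, Matrix.one_apply, Matrix.one_apply]
    simp
  · rw [h3]
    ext a b
    rw [Matrix.mul_apply, Matrix.mul_apply]
    simp only [Matrix.mul_diagonal, Matrix.transpose_apply, Matrix.submatrix_apply, id,
      Function.comp]
    exact (Equiv.sum_comp s fun j => V a j * lam j * V b j).symm
  · intro i j hij
    have := hmono hij
    simp only [Function.comp, neg_le_neg_iff] at this
    exact this

namespace TopSplit

variable {X Y P P' Q Q' : Matrix (Fin n) (Fin n) ℝ} {a b a' b' : ℝ}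

theorem comm_compl (h : TopSplit r Y P Q a b) : (1 - P) * Y = Y * (1 - P) := by
  rw [sub_mul, mul_sub, h.comm, one_mul, mul_one]

theorem tail_mul (h : TopSplit r Y P Q a b) : (1 - P) * Y = (1 - P) * Y * (1 - P) := by
  rw [Matrix.mul_assoc, ← h.comm_compl, ← Matrix.mul_assoc, h.proj.compl.idem]

/-- A `sin Θ` bound. -/
theorem norm_compl_mul_le (h1 : TopSplit r Y P Q a b) (ha : 0 < a)
    (h2 : TopSplit r X P' Q' a' b') :
    (a - b') * ‖(1 - P') * P‖ ≤ ‖(X - Y) * P‖ := by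
  -- Write `P = YQ` and `Y = X - (X - Y)`. The part with `X` reproduces `(1 - P') * P`, multiplied
  -- by the tail of `X` and by `Q`, so it has norm at most `b' / a` times the left side and can be
  -- absorbed.
  have e : (1 - P') * P = (1 - P') * X * ((1 - P') * P) * Q - (1 - P') * ((X - Y) * P) * Q := by
    have e1 : (1 - P') * X * ((1 - P') * P) * Q = (1 - P') * X * Q := by
      rw [← Matrix.mul_assoc, ← h2.tail_mul, Matrix.mul_assoc _ P Q, h1.proj_inv]
    have e2 : (1 - P') * ((X - Y) * P) * Q = (1 - P') * X * Q - (1 - P') * P := by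
      rw [← Matrix.mul_assoc, Matrix.mul_assoc _ P Q, h1.proj_inv, Matrix.mul_assoc,
        sub_mul X, h1.mul_inv, mul_sub, ← Matrix.mul_assoc]
    rw [e1, e2, sub_sub_cancel]
  have n1 : ‖(1 - P') * X * ((1 - P') * P) * Q‖ ≤ b' * ‖(1 - P') * P‖ * a⁻¹ :=
    (norm_mul_le _ _).trans (mul_le_mul ((norm_mul_le _ _).trans
      (mul_le_mul_of_nonneg_right h2.norm_tail (norm_nonneg _))) h1.norm_inv (norm_nonneg _)
      (mul_nonneg ((norm_nonneg _).trans h2.norm_tail) (norm_nonneg _)))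
  have n2 : ‖(1 - P') * ((X - Y) * P) * Q‖ ≤ ‖(X - Y) * P‖ * a⁻¹ :=
    (norm_mul_le _ _).trans (mul_le_mul ((norm_mul_le _ _).trans
      (mul_le_of_le_one_left (norm_nonneg _) h2.proj.compl.norm_le)) h1.norm_inv (norm_nonneg _)
      (norm_nonneg _))
  have n3 : ‖(1 - P') * P‖ ≤ b' * ‖(1 - P') * P‖ * a⁻¹ + ‖(X - Y) * P‖ * a⁻¹ := by
    conv_lhs => rw [e]
    exact (norm_sub_le _ _).trans (add_le_add n1 n2)
  have n4 := mul_le_mul_of_nonneg_left n3 ha.le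
  have : a * (b' * ‖(1 - P') * P‖ * a⁻¹ + ‖(X - Y) * P‖ * a⁻¹)
      = b' * ‖(1 - P') * P‖ + ‖(X - Y) * P‖ := by
    field_simp
  rw [this] at n4
  linarith

/-- The `sin Θ` bound with zero perturbation places the range of `P` inside that of `P'`, and the
traces agree. -/
theorem proj_unique (h1 : TopSplit r Y P Q a b) (h2 : TopSplit r Y P' Q' a b) (ha : 0 < a)
    (hab : b < a) : P = P' := by
  have h := h1.norm_compl_mul_le ha h2
  rw [sub_self, zero_mul, norm_zero] at h
  have h0 : ‖(1 - P') * P‖ ≤ 0 := by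
    by_contra hc
    push Not at hc
    have : 0 < (a - b) * ‖(1 - P') * P‖ := mul_pos (by linarith) hc
    linarith
  have h3 : (1 - P') * P = 0 := norm_le_zero_iff.1 h0
  rw [sub_mul, one_mul, sub_eq_zero] at h3
  exact h1.proj.eq_of_trace h2.proj (by rw [h1.trace_eq, h2.trace_eq]) h3.symm

/-- Row bounds for the dominant eigenspace of a perturbed matrix. -/
theorem vnorm_row_le {σ : ℝ} (hX : TopSplit r X P Q σ 0) (hY : TopSplit r Y P' Q' a b)
    (i : Fin n) :
    vnorm (P' i) ≤ vnorm (P i) * (1 + ‖Y - X‖ * a⁻¹) + vnorm (((Y - X) * P') i) * a⁻¹ := by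
  have hX0 : (1 - P) * X = 0 := norm_le_zero_iff.1 hX.norm_tail
  -- Since `(1 - P) * X = 0`, the part `(1 - P) * P' = (1 - P) * Y * Q'` sees only the perturbation.
  -- The middle term keeps `(Y - X) * P'` together, because its rows are much smaller than `‖Y - X‖`
  -- suggests.
  have e : P' = P * P' + ((Y - X) * P') * Q' - P * ((Y - X) * Q') := by
    have e1 : (1 - P) * ((Y - X) * Q') = (1 - P) * P' := by
      rw [← Matrix.mul_assoc, mul_sub, hX0, sub_zero, Matrix.mul_assoc, hY.mul_inv]
    rw [Matrix.mul_assoc (Y - X), hY.proj_inv]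
    rw [sub_mul 1 P, sub_mul 1 P, one_mul, one_mul, sub_eq_sub_iff_add_eq_add] at e1
    rw [eq_sub_iff_add_eq, add_comm (P * P'), e1, add_comm]
  have r1 : vnorm ((P * P') i) ≤ vnorm (P i) :=
    (vnorm_mul_row_le P P' i).trans
      (mul_le_of_le_one_right (vnorm_nonneg _) hY.proj.norm_le)
  have r2 : vnorm ((((Y - X) * P') * Q') i) ≤ vnorm (((Y - X) * P') i) * a⁻¹ :=
    (vnorm_mul_row_le _ Q' i).trans (mul_le_mul_of_nonneg_left hY.norm_inv (vnorm_nonneg _))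
  have r3 : vnorm ((P * ((Y - X) * Q')) i) ≤ vnorm (P i) * (‖Y - X‖ * a⁻¹) :=
    (vnorm_mul_row_le _ _ i).trans (mul_le_mul_of_nonneg_left ((norm_mul_le _ _).trans
      (mul_le_mul_of_nonneg_left hY.norm_inv (norm_nonneg _))) (vnorm_nonneg _))
  have r4 : vnorm (P' i) ≤ vnorm ((P * P') i) + vnorm ((((Y - X) * P') * Q') i)
      + vnorm ((P * ((Y - X) * Q')) i) := by
    conv_lhs => rw [e]
    exact (vnorm_sub_le _ _).trans (add_le_add_left (vnorm_add_le _ _) _)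
  linarith

/-- A fixed-point identity: `(1 - P') * X` reappears on the right between the tail of `Y` and the
inverse of `X`, that is, with a factor `η / σ < 1`. Solving for it gives the constant `σ / (σ - η)`
in the next two bounds. -/
theorem compl_mul_eq {σ : ℝ} (hX : TopSplit r X P Q σ 0) (hY : TopSplit r Y P' Q' a b) :
    (1 - P') * X = (1 - P') * Y * ((1 - P') * X * Q) - (1 - P') * (Y - X) * P := by
  have hX0 : (1 - P) * X = 0 := norm_le_zero_iff.1 hX.norm_tail
  have e1 : (1 - P') * Y * ((1 - P') * X * Q) = (1 - P') * Y * P := by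
    rw [Matrix.mul_assoc (1 - P') X Q, hX.mul_inv, ← Matrix.mul_assoc, ← hY.tail_mul]
  have e2 : X * P = X := by
    rw [← hX.comm]
    rw [sub_mul, one_mul, sub_eq_zero] at hX0
    exact hX0.symm
  rw [e1, mul_sub (1 - P'), sub_mul _ _ P, sub_sub_cancel, Matrix.mul_assoc, e2]

/-- Pythagoras with respect to `P'` separates `P' * (Y - X)` from `(1 - P') * X * P`. Each contains
a projection of rank `r`, so an operator norm bound becomes a Frobenius bound at the cost of `√r`.
Keeping the squares apart gives the constant `√2` instead of `2`. -/
theorem frobNorm_sub_sq_le {σ η : ℝ} (hX : TopSplit r X P Q σ 0)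
    (hY : TopSplit r Y P' Q' a η) (hη : ‖Y - X‖ ≤ η) (hησ : η < σ) :
    frobNorm (P' * Y - X) ^ 2 ≤ r * η ^ 2 * (1 + (σ / (σ - η)) ^ 2) := by
  have hη0 : 0 ≤ η := (norm_nonneg _).trans hη
  have hσ : 0 < σ := by linarith
  have hX0 : (1 - P) * X = 0 := norm_le_zero_iff.1 hX.norm_tail
  have hXP : X = X * P := by
    rw [← hX.comm]
    rw [sub_mul, one_mul, sub_eq_zero] at hX0
    exact hX0
  rw [hY.proj.frobNorm_sq_add]
  have e1 : P' * (P' * Y - X) = P' * (P' * (Y - X)) := by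
    rw [mul_sub, mul_sub, mul_sub, ← Matrix.mul_assoc, ← Matrix.mul_assoc, hY.proj.idem]
  have e2 : (1 - P') * (P' * Y - X) = -((1 - P') * X * P) := by
    rw [mul_sub, ← Matrix.mul_assoc, hY.proj.compl_mul, zero_mul, zero_sub, Matrix.mul_assoc,
      ← hXP]
  have fP' : frobNorm P' = Real.sqrt r := by
    rw [← hY.trace_eq, ← hY.proj.frobNorm_sq_eq, Real.sqrt_sq (frobNorm_nonneg _)]
  have fP : frobNorm P = Real.sqrt r := by
    rw [← hX.trace_eq, ← hX.proj.frobNorm_sq_eq, Real.sqrt_sq (frobNorm_nonneg _)]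
  have n1 : frobNorm (P' * (P' * (Y - X))) ≤ Real.sqrt r * η := by
    refine (hY.proj.frobNorm_mul_le _).trans ((frobNorm_mul_le _ _).trans ?_)
    rw [fP']
    exact mul_le_mul_of_nonneg_left hη (Real.sqrt_nonneg _)
  have n2 : ‖(1 - P') * X‖ ≤ σ / (σ - η) * η := by
    have h1 : ‖(1 - P') * X‖ ≤ η * (‖(1 - P') * X‖ * σ⁻¹) + η := by
      conv_lhs => rw [compl_mul_eq hX hY]
      refine (norm_sub_le _ _).trans (add_le_add ?_ ?_)
      · exact (norm_mul_le _ _).trans (mul_le_mul hY.norm_tail ((norm_mul_le _ _).trans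
          (mul_le_mul_of_nonneg_left hX.norm_inv (norm_nonneg _))) (norm_nonneg _) hη0)
      · refine (norm_mul_le _ _).trans ((mul_le_of_le_one_right (norm_nonneg _)
          hX.proj.norm_le).trans ((norm_mul_le _ _).trans ?_))
        exact (mul_le_of_le_one_left (norm_nonneg _) hY.proj.compl.norm_le).trans hη
    have hpos : 0 < σ - η := by linarith
    rw [div_mul_eq_mul_div, le_div_iff₀ hpos]
    have h2 := mul_le_mul_of_nonneg_left h1 hσ.le
    have h3 : σ * (η * (‖(1 - P') * X‖ * σ⁻¹) + η) = η * ‖(1 - P') * X‖ + σ * η := by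
      field_simp
    rw [h3] at h2
    linarith
  have n3 : frobNorm ((1 - P') * X * P) ≤ σ / (σ - η) * η * Real.sqrt r := by
    refine (frobNorm_mul_le' _ _).trans ?_
    rw [fP]
    exact mul_le_mul_of_nonneg_right n2 (Real.sqrt_nonneg _)
  rw [e1, e2, frobNorm_neg]
  have m1 := pow_le_pow_left₀ (frobNorm_nonneg _) n1 2
  have m2 := pow_le_pow_left₀ (frobNorm_nonneg _) n3 2
  have hr : Real.sqrt r ^ 2 = r := Real.sq_sqrt (Nat.cast_nonneg r)
  rw [mul_pow, hr] at m1 m2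
  calc _ ≤ r * η ^ 2 + (σ / (σ - η) * η) ^ 2 * r := add_le_add m1 m2
    _ = _ := by ring

/-- The variant for a perturbation that is itself small in Frobenius norm; no factor `√r` is lost,
which is what makes the iteration contract. -/
theorem frobNorm_sub_le {σ η : ℝ} (hX : TopSplit r X P Q σ 0)
    (hY : TopSplit r Y P' Q' a η) (hη0 : 0 ≤ η) (hησ : η < σ) :
    frobNorm (P' * Y - X) ≤ frobNorm (Y - X) * (1 + σ / (σ - η)) := by
  have hσ : 0 < σ := by linarith
  have hpos : 0 < σ - η := by linarith
  have e : P' * Y - X = P' * (Y - X) - (1 - P') * X := by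
    rw [mul_sub, sub_mul, one_mul, sub_sub, add_sub_cancel]
  have n1 : frobNorm ((1 - P') * X) ≤ η * (frobNorm ((1 - P') * X) * σ⁻¹) + frobNorm (Y - X) := by
    conv_lhs => rw [compl_mul_eq hX hY]
    refine (_root_.frobNorm_sub_le _ _).trans (add_le_add ?_ ?_)
    · exact (frobNorm_mul_le' _ _).trans (mul_le_mul hY.norm_tail ((frobNorm_mul_le _ _).trans
        (mul_le_mul_of_nonneg_left hX.norm_inv (frobNorm_nonneg _))) (frobNorm_nonneg _) hη0)
    · exact (hX.proj.frobNorm_mul_le' _).trans (hY.proj.compl.frobNorm_mul_le _)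
  have n2 : frobNorm ((1 - P') * X) ≤ frobNorm (Y - X) * (σ / (σ - η)) := by
    rw [← mul_div_assoc, le_div_iff₀ hpos]
    have h2 := mul_le_mul_of_nonneg_left n1 hσ.le
    have h3 : σ * (η * (frobNorm ((1 - P') * X) * σ⁻¹) + frobNorm (Y - X))
        = η * frobNorm ((1 - P') * X) + σ * frobNorm (Y - X) := by
      field_simp
    rw [h3] at h2
    linarith
  rw [e]
  refine (_root_.frobNorm_sub_le _ _).trans ?_
  have := hY.proj.frobNorm_mul_le (Y - X)
  linarith

end TopSplit

end Perturbation

/-! ### Singular values of a symmetric matrix of rank `r` -/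

section SingularValues

variable {n r : ℕ}

theorem finrank_range_toEuclideanLin (X : Matrix (Fin n) (Fin n) ℝ) :
    Module.finrank ℝ (LinearMap.range (Matrix.toEuclideanLin X)) = X.rank := by
  rw [Matrix.toEuclideanLin, Matrix.toLpLin_eq_toLin, ← Matrix.rank_eq_finrank_range_toLin]

theorem IsThinEig.ne_zero {X : Matrix (Fin n) (Fin n) ℝ} {U : Matrix (Fin n) (Fin r) ℝ}
    {d : Fin r → ℝ} (h : IsThinEig X U d) (hrank : X.rank = r) (k : Fin r) : d k ≠ 0 := by
  intro hk
  have h1 : X.rank ≤ (Matrix.diagonal d).rank := by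
    rw [h.2]
    exact (Matrix.rank_mul_le_left _ _).trans (Matrix.rank_mul_le_right _ _)
  rw [hrank, Matrix.rank_diagonal] at h1
  have h2 : Fintype.card {i // d i ≠ 0} < Fintype.card (Fin r) :=
    Fintype.card_subtype_lt (x := k) (by simpa using hk)
  rw [Fintype.card_fin] at h2
  omega

theorem sigmaMin_pos {X : Matrix (Fin n) (Fin n) ℝ} (hr : 1 ≤ r) (hrank : X.rank = r) :
    0 < sigmaMin r X := by
  rw [sigmaMin, LinearMap.singularValues_pos_iff_lt_finrank_range, finrank_range_toEuclideanLin]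
  omega

/-- The `k`-th column of `U` is an eigenvector of `XᵀX` for `d k ^ 2`, so `|d k|` is a singular
value. It is positive, hence has index below the rank `r`, and the singular values decrease. -/
theorem IsThinEig.sigmaMin_le {X : Matrix (Fin n) (Fin n) ℝ} {U : Matrix (Fin n) (Fin r) ℝ}
    {d : Fin r → ℝ} (h : IsThinEig X U d) (hrank : X.rank = r) (k : Fin r) :
    sigmaMin r X ≤ |d k| := by
  have hd := h.ne_zero hrank
  obtain ⟨hU, hX⟩ := h
  have hXX : Xᵀ * X * U = U * Matrix.diagonal (fun k => d k ^ 2) := by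
    have hXt : Xᵀ = X := by rw [hX, conj_diagonal_transpose]
    rw [hXt, hX, conj_diagonal_mul hU, Matrix.mul_assoc, hU, Matrix.mul_one]
    simp only [pow_two]
  set T := Matrix.toEuclideanLin X with hT
  have hev : Module.End.HasEigenvalue (LinearMap.adjoint T ∘ₗ T) (d k ^ 2) := by
    refine Module.End.hasEigenvalue_of_hasEigenvector
      (x := (WithLp.toLp 2 (U *ᵥ Pi.single k 1) : EuclideanSpace ℝ (Fin n))) ⟨?_, ?_⟩
    · rw [Module.End.mem_eigenspace_iff, LinearMap.comp_apply, hT,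
        ← Matrix.toEuclideanLin_conjTranspose_eq_adjoint,
        Matrix.conjTranspose_eq_transpose_of_trivial, Matrix.toLpLin_toLp,
        Matrix.toLin'_apply, Matrix.toLpLin_toLp, Matrix.toLin'_apply,
        Matrix.mulVec_mulVec, Matrix.mulVec_mulVec, hXX,
        ← Matrix.mulVec_mulVec]
      ext i
      simp [Matrix.mulVec_single, Matrix.mulVec, dotProduct,
        Matrix.diagonal_apply, Pi.single_apply]
      ring
    · intro h0
      have h1 : vnorm (U *ᵥ Pi.single k 1) = 0 := by rw [vnorm, h0, norm_zero]
      rw [vnorm_mulVec_of_transpose_mul_self_eq_one hU, vnorm_single] at h1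
      exact one_ne_zero h1
  obtain ⟨i, hi⟩ := T.isSymmetric_adjoint_comp_self.exists_eigenvalues_eq
    (finrank_euclideanSpace_fin (𝕜 := ℝ) (n := n)) hev
  have hi' : T.isSymmetric_adjoint_comp_self.eigenvalues
      (finrank_euclideanSpace_fin (𝕜 := ℝ) (n := n)) i = d k ^ 2 := by simpa using hi
  have hs : T.singularValues i = |d k| := by
    rw [T.singularValues_fin (finrank_euclideanSpace_fin (𝕜 := ℝ) (n := n)) i, hi',
      Real.sqrt_sq_eq_abs]
  have hpos : 0 < T.singularValues i := by rw [hs]; exact abs_pos.2 (hd k)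
  rw [LinearMap.singularValues_pos_iff_lt_finrank_range, finrank_range_toEuclideanLin,
    hrank] at hpos
  rw [← hs, sigmaMin]
  exact T.singularValues_antitone (by omega)

end SingularValues

/-! ### Centering and squared distances -/

section Centering

variable {n : ℕ}

theorem sum_pairIdx {M : Type*} [AddCommMonoid M] (f : Fin n → Fin n → M) :
    ∑ α : PairIdx n, (f α.1.1 α.1.2 + f α.1.2 α.1.1)
      = ∑ i, ∑ j, if i = j then 0 else f i j := by
  have h1 : ∀ g : Fin n × Fin n → M, ∑ α : PairIdx n, g α.1
      = ∑ p : Fin n × Fin n, if p.1 < p.2 then g p else 0 := by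
    intro g
    rw [← Finset.sum_filter]
    exact (Finset.sum_subtype _ (by simp) g).symm
  rw [Finset.sum_add_distrib, h1 fun p => f p.1 p.2, h1 fun p => f p.2 p.1,
    Fintype.sum_prod_type, Fintype.sum_prod_type]
  conv_lhs => rw [Finset.sum_comm (f := fun i j => if i < j then f j i else 0)]
  rw [← Finset.sum_add_distrib]
  refine Finset.sum_congr rfl fun i _ => ?_
  rw [← Finset.sum_add_distrib]
  refine Finset.sum_congr rfl fun j _ => ?_
  rcases lt_trichotomy i j with h | h | h
  · simp [h, h.ne, h.not_gt]
  · simp [h]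
  · simp [h, h.ne', h.not_gt]

theorem card_pairIdx (n : ℕ) : (Fintype.card (PairIdx n) : ℝ) = numPairs n := by
  have h := sum_pairIdx (n := n) (M := ℝ) fun _ _ => 1
  have h2 : ∑ i : Fin n, ∑ j : Fin n, (if i = j then (0 : ℝ) else 1) = n * (n - 1) := by
    have : ∀ i : Fin n, ∑ j : Fin n, (if i = j then (0 : ℝ) else 1) = n - 1 := by
      intro i
      have e : ∀ j : Fin n, (if i = j then (0 : ℝ) else 1) = 1 - if i = j then 1 else 0 := by
        intro j; split_ifs <;> norm_num
      simp [e, Finset.sum_sub_distrib]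
    simp [this, mul_sub]
  rw [h2] at h
  simp only [Finset.sum_const, Finset.card_univ, nsmul_eq_mul] at h
  rw [numPairs]
  linarith

/-- The orthogonal projection onto the vectors with zero sum. -/
def centering (n : ℕ) : Matrix (Fin n) (Fin n) ℝ := Matrix.of fun i => centeredVec i

theorem centering_apply (i j : Fin n) :
    centering n i j = (if i = j then 1 else 0) - 1 / (n : ℝ) := by
  simp [centering, centeredVec, eq_comm]

theorem centering_eq (n : ℕ) :
    centering n = 1 - (1 / (n : ℝ)) • Matrix.vecMulVec (fun _ => 1) (fun _ => 1) := by
  ext i j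
  simp [centering_apply, Matrix.one_apply, Matrix.vecMulVec_apply]

theorem isOrthProj_centering (n : ℕ) : IsOrthProj (centering n) where
  symm := by
    ext i j
    simp [centering_apply, eq_comm]
  idem := by
    rcases Nat.eq_zero_or_pos n with rfl | hn
    · ext i; exact i.elim0
    have hn' : (n : ℝ) ≠ 0 := by positivity
    ext i j
    simp only [Matrix.mul_apply, centering_apply, sub_mul, mul_sub, Finset.sum_sub_distrib]
    simp [hn']

theorem mul_centering {X : Matrix (Fin n) (Fin n) ℝ} (h : X *ᵥ (fun _ => (1 : ℝ)) = 0) :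
    X * centering n = X := by
  rw [centering_eq, Matrix.mul_sub, Matrix.mul_one, Matrix.mul_smul, Matrix.mul_vecMulVec, h]
  simp

theorem centering_mul {X : Matrix (Fin n) (Fin n) ℝ} (hs : Xᵀ = X)
    (h : X *ᵥ (fun _ => (1 : ℝ)) = 0) : centering n * X = X := by
  have := congrArg Matrix.transpose (mul_centering h)
  rwa [Matrix.transpose_mul, hs, (isOrthProj_centering n).symm] at this

/-- Squared distances of a Gram matrix. -/
def edm (E : Matrix (Fin n) (Fin n) ℝ) : Matrix (Fin n) (Fin n) ℝ :=
  Matrix.of fun i j => E i i + E j j - E i j - E j i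

theorem edm_apply (E : Matrix (Fin n) (Fin n) ℝ) (i j : Fin n) :
    edm E i j = E i i + E j j - E i j - E j i := rfl

theorem edm_comm (E : Matrix (Fin n) (Fin n) ℝ) (i j : Fin n) : edm E i j = edm E j i := by
  simp only [edm_apply]; ring

theorem edm_self (E : Matrix (Fin n) (Fin n) ℝ) (i : Fin n) : edm E i i = 0 := by
  simp only [edm_apply]; ring

theorem edm_transpose (E : Matrix (Fin n) (Fin n) ℝ) : (edm E)ᵀ = edm E := by
  ext i j
  exact edm_comm E j i

theorem trInner_wBasis_eq_edm (E : Matrix (Fin n) (Fin n) ℝ) (α : PairIdx n) :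
    trInner E (wBasis α) = edm E α.1.1 α.1.2 := by
  rw [trInner_wBasis, edm_apply]

/-- Adjacency matrix of the edge `α`. -/
def edgeMat (α : PairIdx n) : Matrix (Fin n) (Fin n) ℝ :=
  Matrix.single α.1.1 α.1.2 1 + Matrix.single α.1.2 α.1.1 1

theorem edgeMat_transpose (α : PairIdx n) : (edgeMat α)ᵀ = edgeMat α := by
  rw [edgeMat, Matrix.transpose_add, Matrix.transpose_single, Matrix.transpose_single, add_comm]

theorem edgeMat_mulVec (α : PairIdx n) (x : Fin n → ℝ) :
    edgeMat α *ᵥ x = x α.1.2 • Pi.single α.1.1 1 + x α.1.1 • Pi.single α.1.2 1 := by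
  rw [edgeMat, Matrix.add_mulVec]
  ext i
  simp [Pi.single_apply, Matrix.mulVec, dotProduct, Matrix.single_apply, ite_and, eq_comm]

theorem sum_edm_smul_edgeMat (E : Matrix (Fin n) (Fin n) ℝ) :
    ∑ α : PairIdx n, edm E α.1.1 α.1.2 • edgeMat α = edm E := by
  have h := sum_pairIdx (fun i j => edm E i j • (Matrix.single i j (1 : ℝ)))
  have e1 : ∀ α : PairIdx n, edm E α.1.1 α.1.2 • edgeMat α
      = edm E α.1.1 α.1.2 • Matrix.single α.1.1 α.1.2 (1 : ℝ)
        + edm E α.1.2 α.1.1 • Matrix.single α.1.2 α.1.1 (1 : ℝ) := by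
    intro α
    rw [edgeMat, smul_add, edm_comm E α.1.2]
  rw [Finset.sum_congr rfl fun α _ => e1 α, h]
  conv_rhs => rw [Matrix.matrix_eq_sum_single (edm E)]
  refine Finset.sum_congr rfl fun i _ => Finset.sum_congr rfl fun j _ => ?_
  split_ifs with hij
  · rw [hij, edm_self]; simp
  · rw [Matrix.smul_single]; simp

/-- Pulling the centering out of the dual basis reduces the noise to sparse edge matrices. -/
theorem vBasis_eq (α : PairIdx n) :
    vBasis α = (-(1 / 2 : ℝ)) • (centering n * edgeMat α * centering n) := by
  have h : ∀ i j : Fin n, centering n * Matrix.single i j 1 * centering n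
      = Matrix.vecMulVec (centeredVec i) (centeredVec j) := by
    intro i j
    ext k l
    have := congrFun (congrFun (isOrthProj_centering n).symm k) i
    simp only [Matrix.transpose_apply] at this
    rw [Matrix.mul_assoc, Matrix.mul_apply, Finset.sum_eq_single i, Matrix.vecMulVec_apply]
    · rw [← this, Matrix.mul_apply, Finset.sum_eq_single j]
      · simp [centering]
      · intro b _ hb
        simp [hb.symm]
      · simp
    · intro b _ hb
      have : (Matrix.single i j (1 : ℝ) * centering n) b l = 0 := by
        rw [Matrix.mul_apply]
        exact Finset.sum_eq_zero fun c _ => by simp [hb.symm]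
      rw [this, mul_zero]
    · simp
  rw [vBasis, edgeMat, Matrix.mul_add, Matrix.add_mul, h, h]

theorem centering_mulVec_one (n : ℕ) : (centering n) *ᵥ (fun _ => (1 : ℝ)) = 0 := by
  ext i
  have hn' : (n : ℝ) ≠ 0 := by
    have := i.pos
    positivity
  simp [Matrix.mulVec, dotProduct, centering_apply, Finset.sum_sub_distrib, hn']

/-- The identity of classical multidimensional scaling: the diagonal of `E` enters the squared
distances only through rank-one terms containing the all-ones vector, which the centering kills. -/
theorem centering_edm_centering {E : Matrix (Fin n) (Fin n) ℝ} (hs : Eᵀ = E)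
    (h : E *ᵥ (fun _ => (1 : ℝ)) = 0) :
    centering n * edm E * centering n = (-2 : ℝ) • E := by
  have hJ1 := centering_mulVec_one n
  have h1J : (fun _ => (1 : ℝ)) ᵥ* (centering n) = 0 := by
    rw [← Matrix.mulVec_transpose, (isOrthProj_centering n).symm, hJ1]
  have e : edm E = Matrix.vecMulVec (fun i => E i i) (fun _ => 1)
      + Matrix.vecMulVec (fun _ => 1) (fun i => E i i) - (2 : ℝ) • E := by
    ext i j
    have hij : E j i = E i j := by
      conv_lhs => rw [← hs]
      rfl
    simp only [edm_apply, Matrix.sub_apply, Matrix.add_apply, Matrix.vecMulVec_apply,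
      Matrix.smul_apply, smul_eq_mul, hij]
    ring
  rw [e, Matrix.mul_sub, Matrix.mul_add, Matrix.sub_mul, Matrix.add_mul, Matrix.mul_vecMulVec,
    Matrix.vecMulVec_mul, h1J, Matrix.mul_vecMulVec, hJ1, Matrix.mul_smul, centering_mul hs h,
    Matrix.smul_mul, mul_centering h]
  simp

/-- One centred summand of the sampling noise. -/
def noiseTerm (m : ℕ) (E : Matrix (Fin n) (Fin n) ℝ) (α : PairIdx n) : Matrix (Fin n) (Fin n) ℝ :=
  (-(1 / 2 : ℝ)) • ((numPairs n / m) • (edm E α.1.1 α.1.2 • edgeMat α) - (1 / (m : ℝ)) • edm E)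

/-- Sampling noise in the squared distances. -/
def noise {m : ℕ} (ω : Fin m → PairIdx n) (E : Matrix (Fin n) (Fin n) ℝ) :
    Matrix (Fin n) (Fin n) ℝ :=
  ∑ k, noiseTerm m E (ω k)

theorem noiseTerm_transpose (m : ℕ) (E : Matrix (Fin n) (Fin n) ℝ) (α : PairIdx n) :
    (noiseTerm m E α)ᵀ = noiseTerm m E α := by
  simp only [noiseTerm, Matrix.transpose_smul, Matrix.transpose_sub, edgeMat_transpose,
    edm_transpose]

theorem noise_transpose {m : ℕ} (ω : Fin m → PairIdx n) (E : Matrix (Fin n) (Fin n) ℝ) :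
    (noise ω E)ᵀ = noise ω E := by
  rw [noise, Matrix.transpose_sum]
  exact Finset.sum_congr rfl fun k _ => noiseTerm_transpose _ _ _

theorem sum_noiseTerm (m : ℕ) (E : Matrix (Fin n) (Fin n) ℝ) : ∑ α, noiseTerm m E α = 0 := by
  simp only [noiseTerm]
  rw [← Finset.smul_sum, Finset.sum_sub_distrib, ← Finset.smul_sum, sum_edm_smul_edgeMat,
    Finset.sum_const, Finset.card_univ, ← Nat.cast_smul_eq_nsmul ℝ, card_pairIdx, smul_smul,
    mul_one_div, sub_self, smul_zero]

/-- Double centering turns the unbiased estimate of the squared distances into an unbiased estimate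
of `E` itself, so the whole error is the centred noise. -/
theorem sampleOp_sub_eq {m : ℕ} (hm : 0 < m) (ω : Fin m → PairIdx n)
    {E : Matrix (Fin n) (Fin n) ℝ} (hs : Eᵀ = E) (h : E *ᵥ (fun _ => (1 : ℝ)) = 0) :
    (numPairs n / m) • sampleOp ω E - E = centering n * noise ω E * centering n := by
  have hm' : (m : ℝ) ≠ 0 := by positivity
  have e1 : noise ω E = (-(1 / 2 : ℝ)) • ((numPairs n / m) •
      (∑ k, edm E (ω k).1.1 (ω k).1.2 • edgeMat (ω k)) - edm E) := by
    simp only [noise, noiseTerm]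
    rw [← Finset.smul_sum, Finset.sum_sub_distrib, ← Finset.smul_sum, Finset.sum_const,
      Finset.card_univ, Fintype.card_fin, ← Nat.cast_smul_eq_nsmul ℝ, smul_smul,
      mul_one_div_cancel hm', one_smul]
  have e2 : sampleOp ω E = (-(1 / 2 : ℝ)) • (centering n *
      (∑ k, edm E (ω k).1.1 (ω k).1.2 • edgeMat (ω k)) * centering n) := by
    rw [sampleOp, Matrix.mul_sum, Matrix.sum_mul, Finset.smul_sum]
    refine Finset.sum_congr rfl fun k _ => ?_
    rw [trInner_wBasis_eq_edm, vBasis_eq, Matrix.mul_smul, Matrix.smul_mul, smul_comm]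
  rw [e1, e2, Matrix.mul_smul, Matrix.smul_mul, Matrix.mul_sub, Matrix.sub_mul,
    centering_edm_centering hs h, Matrix.mul_smul, Matrix.smul_mul, smul_sub, smul_comm]
  congr 1
  rw [smul_smul]
  norm_num

end Centering

theorem abs_edm_le_of_entry_le {n : ℕ} {E : Matrix (Fin n) (Fin n) ℝ} {c : ℝ}
    (hE : ∀ i j, |E i j| ≤ c) (i j : Fin n) : |edm E i j| ≤ 4 * c := by
  have h1 := abs_le.1 (hE i i)
  have h2 := abs_le.1 (hE j j)
  have h3 := abs_le.1 (hE i j)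
  have h4 := abs_le.1 (hE j i)
  rw [edm_apply, abs_le]
  constructor <;> linarith [h1.1, h1.2, h2.1, h2.2, h3.1, h3.2, h4.1, h4.2]

/-! ### The sampling regime -/

/-- The standing assumptions: a centred symmetric matrix `X = U diag(d) Uᵀ` of rank `r` whose
nonzero eigenvalues are at least `σ` in absolute value, whose entries are at most `B`, and whose
eigenspace is incoherent, together with the sample size bounds. -/
structure SamplingRegime (n r m : ℕ) (X : Matrix (Fin n) (Fin n) ℝ) (U : Matrix (Fin n) (Fin r) ℝ)
    (d : Fin r → ℝ) (σ κ B τ l : ℝ) : Prop where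
  three_le : 3 ≤ n
  one_le_rank : 1 ≤ r
  symm : Xᵀ = X
  mulVec_one : X *ᵥ (fun _ => (1 : ℝ)) = 0
  eig : IsThinEig X U d
  sigma_pos : 0 < σ
  sigma_le : ∀ k, σ ≤ |d k|
  one_le_kappa : 1 ≤ κ
  norm_eq : ‖X‖ = κ * σ
  tau_nonneg : 0 ≤ τ
  rank_le : (r : ℝ) ≤ n * τ ^ 2
  row_le : ∀ i, vnorm ((U * Uᵀ) i) ≤ τ / 11
  entry_le : ∀ i j, |X i j| ≤ B
  kappa_sigma_le : κ * σ ≤ n * B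
  one_le_l : 1 ≤ l
  card_tau_le : 161000 * (n * τ ^ 2) ^ 2 * κ ^ 2 * n * l ≤ m
  card_entry_le : 777000 * κ ^ 4 * (n * B) ^ 2 * n * l * r ≤ m * σ ^ 2

namespace SamplingRegime

variable {n r m : ℕ} {X : Matrix (Fin n) (Fin n) ℝ} {U : Matrix (Fin n) (Fin r) ℝ}
    {d : Fin r → ℝ} {σ κ B τ l : ℝ}

theorem n_pos (h : SamplingRegime n r m X U d σ κ B τ l) : (0 : ℝ) < n := by
  have := h.three_le
  positivity

theorem three_le' (h : SamplingRegime n r m X U d σ κ B τ l) : (3 : ℝ) ≤ n := by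
  exact_mod_cast h.three_le

theorem one_le_r (h : SamplingRegime n r m X U d σ κ B τ l) : (1 : ℝ) ≤ r := by
  exact_mod_cast h.one_le_rank

theorem sigma_le_nB (h : SamplingRegime n r m X U d σ κ B τ l) : σ ≤ n * B :=
  (le_mul_of_one_le_left h.sigma_pos.le h.one_le_kappa).trans h.kappa_sigma_le

theorem B_pos (h : SamplingRegime n r m X U d σ κ B τ l) : 0 < B := by
  have h1 := h.sigma_le_nB
  have h2 := h.sigma_pos
  have h3 := h.n_pos
  by_contra hc
  push Not at hc
  nlinarith

theorem one_le_ntau (h : SamplingRegime n r m X U d σ κ B τ l) : 1 ≤ n * τ ^ 2 :=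
  h.one_le_r.trans h.rank_le

theorem tau_pos (h : SamplingRegime n r m X U d σ κ B τ l) : 0 < τ := by
  refine lt_of_le_of_ne h.tau_nonneg fun h0 => ?_
  have := h.one_le_ntau
  rw [← h0] at this
  norm_num at this

theorem m_pos (h : SamplingRegime n r m X U d σ κ B τ l) : (0 : ℝ) < m := by
  refine lt_of_lt_of_le ?_ h.card_tau_le
  have h1 := h.n_pos
  have h2 := h.tau_pos
  have h3 : 0 < κ := lt_of_lt_of_le one_pos h.one_le_kappa
  have h4 : 0 < l := lt_of_lt_of_le one_pos h.one_le_l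
  positivity

theorem inv_sqrt_le (h : SamplingRegime n r m X U d σ κ B τ l) : 1 / Real.sqrt n ≤ τ := by
  have h1 := h.one_le_ntau
  rw [div_le_iff₀ (Real.sqrt_pos.2 h.n_pos)]
  apply le_of_sq_le_sq _ (mul_nonneg h.tau_nonneg (Real.sqrt_nonneg _))
  rw [mul_pow, Real.sq_sqrt h.n_pos.le]
  linarith

theorem topSplit (h : SamplingRegime n r m X U d σ κ B τ l) :
    TopSplit r X (U * Uᵀ) (U * Matrix.diagonal (fun k : Fin r => (d k)⁻¹) * Uᵀ) σ 0 :=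
  topSplit_of_isThinEig h.eig h.sigma_pos h.sigma_le

theorem rank_le_card (h : SamplingRegime n r m X U d σ κ B τ l) : r ≤ n := by
  have h1 := Matrix.rank_mul_le_left Uᵀ U
  rw [h.eig.1, Matrix.rank_one, Fintype.card_fin, Matrix.rank_transpose] at h1
  simpa using h1.trans (Matrix.rank_le_card_height U)

theorem abs_edm_le (h : SamplingRegime n r m X U d σ κ B τ l) (i j : Fin n) :
    |edm X i j| ≤ 4 * B :=
  abs_edm_le_of_entry_le h.entry_le i j

end SamplingRegime

theorem numPairs_pos {n : ℕ} (hn : 3 ≤ n) : 0 < numPairs n := by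
  have : (3 : ℝ) ≤ n := by exact_mod_cast hn
  rw [numPairs]
  have : 0 < (n : ℝ) * ((n : ℝ) - 1) := mul_pos (by linarith) (by linarith)
  linarith

theorem numPairs_le (n : ℕ) : numPairs n ≤ (n : ℝ) ^ 2 / 2 := by
  rw [numPairs]
  have : (0 : ℝ) ≤ n := Nat.cast_nonneg n
  nlinarith

/-- A variance is at most the second moment; this removes the mean from all variance computations
below. -/
theorem sum_norm_sub_mean_sq_le {H A : Type*} [NormedAddCommGroup H] [InnerProductSpace ℝ H]
    [Fintype A] (f : A → H) (c : H) (hc : ∑ a, f a = (Fintype.card A : ℝ) • c) :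
    ∑ a, ‖f a - c‖ ^ 2 ≤ ∑ a, ‖f a‖ ^ 2 := by
  have h1 : ∀ a, ‖f a - c‖ ^ 2 = ‖f a‖ ^ 2 - 2 * inner ℝ (f a) c + ‖c‖ ^ 2 := fun a =>
    norm_sub_sq_real _ _
  simp only [h1, Finset.sum_add_distrib, Finset.sum_sub_distrib, ← Finset.mul_sum, ← sum_inner, hc,
    inner_smul_left, real_inner_self_eq_norm_sq, Finset.sum_const, Finset.card_univ, nsmul_eq_mul]
  have : (0 : ℝ) ≤ Fintype.card A * ‖c‖ ^ 2 := by positivity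
  simp only [conj_trivial]
  linarith

/-- The largest Euclidean norm of a row. -/
def rowMax {n : ℕ} (P : Matrix (Fin n) (Fin n) ℝ) : ℝ := ‖fun j => vnorm (P j)‖

theorem vnorm_row_le_rowMax {n : ℕ} (P : Matrix (Fin n) (Fin n) ℝ) (j : Fin n) :
    vnorm (P j) ≤ rowMax P :=
  (le_abs_self _).trans (norm_le_pi_norm (fun j => vnorm (P j)) j)

theorem rowMax_le {n : ℕ} {P : Matrix (Fin n) (Fin n) ℝ} {c : ℝ} (hc : 0 ≤ c)
    (h : ∀ j, vnorm (P j) ≤ c) : rowMax P ≤ c :=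
  (pi_norm_le_iff_of_nonneg hc).2 fun j => by
    rw [Real.norm_eq_abs, abs_of_nonneg (vnorm_nonneg _)]
    exact h j

theorem rowMax_nonneg {n : ℕ} (P : Matrix (Fin n) (Fin n) ℝ) : 0 ≤ rowMax P := norm_nonneg _

theorem norm_single_mul_le {n : ℕ} (A : Matrix (Fin n) (Fin n) ℝ) (i : Fin n) :
    ‖Matrix.single i i 1 * A‖ ≤ vnorm (A i) := by
  refine opNorm_le (vnorm_nonneg _) fun x => ?_
  have : (Matrix.single i i 1 * A) *ᵥ x = (A i ⬝ᵥ x) • Pi.single i (1 : ℝ) := by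
    rw [← Matrix.mulVec_mulVec]
    ext j
    by_cases hj : j = i
    · subst hj
      rw [Matrix.mulVec, dotProduct, Finset.sum_eq_single j]
      · simp [Matrix.mulVec]
      · intro b _ hb
        simp [hb.symm]
      · simp
    · simp [Matrix.mulVec, hj, dotProduct, Ne.symm hj]
  rw [this, vnorm_smul, vnorm_single, mul_one]
  exact abs_dotProduct_le _ _

/-- Centering subtracts the mean of the rows, which is `Aᵀ` applied to a vector of norm `1 / √n`. -/
theorem vnorm_centering_mul_row_le {n : ℕ} (hn : 0 < n) (A : Matrix (Fin n) (Fin n) ℝ)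
    (i : Fin n) : vnorm ((centering n * A) i) ≤ vnorm (A i) + ‖A‖ * (1 / Real.sqrt n) := by
  have hn' : (0 : ℝ) < n := by positivity
  have e : (centering n * A) i = A i - Aᵀ *ᵥ (fun _ => 1 / (n : ℝ)) := by
    ext j
    simp [centering_eq, Matrix.sub_mul, Matrix.vecMulVec_mul, Matrix.vecMulVec_apply,
      Matrix.vecMul, Matrix.mulVec, dotProduct, Finset.mul_sum, mul_comm]
  rw [e]
  refine (vnorm_sub_le _ _).trans (add_le_add_right ?_ _)
  refine (vnorm_mulVec_le _ _).trans (le_of_eq ?_)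
  rw [opNorm_transpose, vnorm_eq_sqrt]
  congr 1
  simp only [Finset.sum_const, Finset.card_univ, Fintype.card_fin, nsmul_eq_mul]
  rw [show (n : ℝ) * (1 / (n : ℝ)) ^ 2 = 1 / n by field_simp, Real.sqrt_div zero_le_one,
    Real.sqrt_one]

/-! ### Initialization: row bounds from leave-one-out estimates -/

/-- The coordinate projection that kills the `i`-th coordinate. -/
def dropCoord {n : ℕ} (i : Fin n) : Matrix (Fin n) (Fin n) ℝ := 1 - Matrix.single i i 1

theorem isOrthProj_dropCoord {n : ℕ} (i : Fin n) : IsOrthProj (dropCoord i) := by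
  refine IsOrthProj.compl ⟨?_, ?_⟩
  · rw [Matrix.transpose_single]
  · rw [Matrix.single_mul_single_same, mul_one]

theorem norm_dropCoord_conj_le {n : ℕ} (i : Fin n) (N : Matrix (Fin n) (Fin n) ℝ) :
    ‖dropCoord i * N * dropCoord i‖ ≤ ‖N‖ := by
  have h := (isOrthProj_dropCoord i).norm_le
  calc _ ≤ ‖dropCoord i‖ * ‖N‖ * ‖dropCoord i‖ :=
        (norm_mul_le _ _).trans (mul_le_mul_of_nonneg_right (norm_mul_le _ _) (norm_nonneg _))
    _ ≤ 1 * ‖N‖ * 1 := by gcongr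
    _ = ‖N‖ := by ring

theorem norm_centering_conj_le {n : ℕ} (N : Matrix (Fin n) (Fin n) ℝ) :
    ‖centering n * N * centering n‖ ≤ ‖N‖ := by
  have h := (isOrthProj_centering n).norm_le
  calc _ ≤ ‖centering n‖ * ‖N‖ * ‖centering n‖ :=
        (norm_mul_le _ _).trans (mul_le_mul_of_nonneg_right (norm_mul_le _ _) (norm_nonneg _))
    _ ≤ 1 * ‖N‖ * 1 := by gcongr
    _ = ‖N‖ := by ring

theorem vnorm_mul_proj_row {n : ℕ} {P : Matrix (Fin n) (Fin n) ℝ} (hP : IsOrthProj P)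
    (N : Matrix (Fin n) (Fin n) ℝ) (i : Fin n) : (N * P) i = P *ᵥ N i := by
  ext k
  have : ∀ j, P j k = P k j := fun j => by
    conv_lhs => rw [← hP.symm]
    rfl
  simp [Matrix.mul_apply, Matrix.mulVec, dotProduct, this, mul_comm]

/-- The removed part consists of row `i` of `N` and the rest of its column `i`. After multiplication
by `P` the row gives `P N_i`, while the column meets only row `i` of `P`, which is small by
incoherence. -/
theorem norm_sub_dropCoord_conj_mul_le {n : ℕ} {P : Matrix (Fin n) (Fin n) ℝ} (hP : IsOrthProj P)
    (N : Matrix (Fin n) (Fin n) ℝ) (i : Fin n) :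
    ‖(N - dropCoord i * N * dropCoord i) * P‖ ≤ vnorm (P *ᵥ N i) + ‖N‖ * vnorm (P i) := by
  have e : (N - dropCoord i * N * dropCoord i) * P
      = Matrix.single i i 1 * (N * P) + dropCoord i * N * (Matrix.single i i 1 * P) := by
    have h1 : Matrix.single i i (1 : ℝ) = 1 - dropCoord i := by rw [dropCoord, sub_sub_cancel]
    rw [h1]
    noncomm_ring
  rw [e, ← vnorm_mul_proj_row hP]
  refine (norm_add_le _ _).trans (add_le_add (norm_single_mul_le _ _) ?_)
  refine (norm_mul_le _ _).trans (mul_le_mul ?_ (norm_single_mul_le _ _) (norm_nonneg _)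
    (norm_nonneg _))
  exact (norm_mul_le _ _).trans
    (mul_le_of_le_one_left (norm_nonneg _) (isOrthProj_dropCoord i).norm_le)

theorem TopSplit.centering_mul_proj {n r : ℕ} {Y P Q : Matrix (Fin n) (Fin n) ℝ} {a b : ℝ}
    (h : TopSplit r Y P Q a b) (hY : centering n * Y = Y) : centering n * P = P := by
  rw [← h.mul_inv, ← Matrix.mul_assoc, hY]

/-- One leave-one-out step: a bound for the projected `i`-th row of the noise on the perturbed
eigenspace in terms of the eigenspace of the matrix without the noise in row and column `i`. -/
theorem leave_one_out_bound {n r : ℕ} {X N P P₁ Q Q₁ : Matrix (Fin n) (Fin n) ℝ} {σ τ : ℝ}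
    (hσ : 0 < σ) (hτ : 0 ≤ τ) (hX : centering n * X = X) (i : Fin n) (hN : ‖N‖ ≤ σ / 364)
    (h : TopSplit r (X + centering n * N * centering n) P Q (σ - σ / 364) (σ / 364))
    (h₁ : TopSplit r (X + centering n * (dropCoord i * N * dropCoord i) * centering n) P₁ Q₁
      (σ - σ / 364) (σ / 364))
    (hb : vnorm (P₁ *ᵥ N i) ≤ σ / 20 * (τ + rowMax P₁)) :
    vnorm (P *ᵥ N i) ≤ σ * (6 / 100 * τ + 6 / 100 * rowMax P) := by
  have hJ : ∀ M, centering n * (X + centering n * M * centering n)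
      = X + centering n * M * centering n := fun M => by
    rw [Matrix.mul_add, hX, ← Matrix.mul_assoc, ← Matrix.mul_assoc, (isOrthProj_centering n).idem]
  have hJP := h.centering_mul_proj (hJ _)
  have hJP₁ := h₁.centering_mul_proj (hJ _)
  have hpos : 0 < σ - σ / 364 := by linarith
  have hJn := (isOrthProj_centering n).norm_le
  set s := ‖(1 - P₁) * P‖ with hs
  set s₂ := ‖(1 - P) * P₁‖ with hs₂
  have hdiff : ∀ R : Matrix (Fin n) (Fin n) ℝ, centering n * R = R → IsOrthProj R →
      ‖(X + centering n * N * centering n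
        - (X + centering n * (dropCoord i * N * dropCoord i) * centering n)) * R‖
      ≤ vnorm (R *ᵥ N i) + σ / 364 * vnorm (R i) := by
    intro R hR hRp
    have e : (X + centering n * N * centering n
        - (X + centering n * (dropCoord i * N * dropCoord i) * centering n)) * R
        = centering n * ((N - dropCoord i * N * dropCoord i) * (centering n * R)) := by
      noncomm_ring
    rw [e, hR]
    refine (norm_mul_le _ _).trans ((mul_le_of_le_one_left (norm_nonneg _) hJn).trans
      ((norm_sub_dropCoord_conj_mul_le hRp N i).trans ?_))
    have := mul_le_mul_of_nonneg_right hN (vnorm_nonneg (R i))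
    linarith
  have k1 := h.norm_compl_mul_le hpos h₁
  have k2 := h₁.norm_compl_mul_le hpos h
  have d1 := hdiff P hJP h.proj
  have d2 := hdiff P₁ hJP₁ h₁.proj
  rw [← neg_sub (X + centering n * N * centering n), neg_mul, norm_neg] at k1
  have hrowP := vnorm_row_le_rowMax P i
  have hrowP₁ := vnorm_row_le_rowMax P₁ i
  have hs' : ‖P * (1 - P₁)‖ = s := by
    rw [hs, ← opNorm_transpose, Matrix.transpose_mul, h.proj.symm, h₁.proj.compl.symm]
  have hs₂' : ‖P₁ * (1 - P)‖ = s₂ := by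
    rw [hs₂, ← opNorm_transpose, Matrix.transpose_mul, h₁.proj.symm, h.proj.compl.symm]
  have hb' : vnorm (P *ᵥ N i) ≤ vnorm (P₁ *ᵥ N i) + s * (σ / 364) := by
    have e : P *ᵥ N i = P *ᵥ (P₁ *ᵥ N i) + (P * (1 - P₁)) *ᵥ N i := by
      rw [Matrix.mulVec_mulVec, ← Matrix.add_mulVec]
      congr 1
      rw [mul_sub, mul_one, add_sub_cancel]
    rw [e]
    refine (vnorm_add_le _ _).trans (add_le_add ?_ ?_)
    · exact (vnorm_mulVec_le _ _).trans (mul_le_of_le_one_left (vnorm_nonneg _) h.proj.norm_le)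
    · refine (vnorm_mulVec_le _ _).trans ?_
      rw [hs']
      exact mul_le_mul_of_nonneg_left ((_root_.vnorm_row_le N i).trans hN) (norm_nonneg _)
  have hrow : rowMax P₁ ≤ rowMax P + s + s₂ := by
    refine rowMax_le (add_nonneg (add_nonneg (rowMax_nonneg P)
      (norm_nonneg _)) (norm_nonneg _)) fun j => ?_
    have e : P₁ = P - (1 - P₁) * P + P₁ * (1 - P) := by
      rw [sub_mul, mul_sub, one_mul, mul_one]
      abel
    have e' : P₁ j = P j - ((1 - P₁) * P) j + (P₁ * (1 - P)) j := by
      conv_lhs => rw [e]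
      rfl
    rw [e']
    refine (vnorm_add_le _ _).trans (add_le_add ((vnorm_sub_le _ _).trans (add_le_add
      (vnorm_row_le_rowMax P j) (_root_.vnorm_row_le _ j))) ?_)
    rw [← hs₂']
    exact _root_.vnorm_row_le _ j
  set b := vnorm (P₁ *ᵥ N i)
  set b' := vnorm (P *ᵥ N i)
  have hbb : 0 ≤ b' := vnorm_nonneg _
  -- The `sin Θ` bounds in both directions, `hb'` and `hrow` form a closed system of linear
  -- inequalities in `b`, `b'`, `s`, `s₂` and `rowMax P₁`. As `σ / 364` is small compared with the
  -- gap, it can be solved for `b'`.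
  have f1 : (σ - σ / 364 - σ / 364) * s ≤ b' + σ / 364 * rowMax P :=
    k1.trans (d1.trans (by gcongr))
  have f2 : (σ - σ / 364 - σ / 364) * s₂ ≤ b + σ / 364 * rowMax P₁ :=
    k2.trans (d2.trans (by gcongr))
  have f3 := mul_le_mul_of_nonneg_left hrow hσ.le
  have f4 := mul_nonneg hσ.le (rowMax_nonneg P)
  have f5 := mul_nonneg hσ.le hτ
  linarith

theorem TopSplit.mono {n r : ℕ} {Y P Q : Matrix (Fin n) (Fin n) ℝ} {a b a' b' : ℝ}
    (h : TopSplit r Y P Q a b) (ha' : 0 < a') (ha : a' ≤ a) (hb : b ≤ b') :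
    TopSplit r Y P Q a' b' :=
  { h with
    norm_inv := h.norm_inv.trans (inv_anti₀ ha' ha)
    norm_tail := h.norm_tail.trans hb }

open scoped Classical in
/-- The projection onto the dominant eigenspace, if there is a spectral gap. -/
def topProj {n : ℕ} (r : ℕ) (Y : Matrix (Fin n) (Fin n) ℝ) (a b : ℝ) : Matrix (Fin n) (Fin n) ℝ :=
  if h : ∃ P Q, TopSplit r Y P Q a b then h.choose else 0

theorem exists_topSplit_topProj {n r : ℕ} {Y : Matrix (Fin n) (Fin n) ℝ} {a b : ℝ}
    (h : ∃ P Q, TopSplit r Y P Q a b) : ∃ Q, TopSplit r Y (topProj r Y a b) Q a b := by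
  rw [topProj, dif_pos h]
  exact h.choose_spec

/-- The default value `0` is also an orthogonal projection, so this needs no spectral gap and holds
for every sample. -/
theorem isOrthProj_topProj {n : ℕ} (r : ℕ) (Y : Matrix (Fin n) (Fin n) ℝ) (a b : ℝ) :
    IsOrthProj (topProj r Y a b) := by
  by_cases h : ∃ P Q, TopSplit r Y P Q a b
  · obtain ⟨Q, hQ⟩ := exists_topSplit_topProj h
    exact hQ.proj
  · rw [topProj, dif_neg h]
    exact ⟨by simp, by simp⟩

/-- `p` determines a unique object, and this object satisfies `q`. -/
structure DeterminesGood {S : Type*} (p q : S → Prop) : Prop where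
  exists_of : ∃ z, p z
  good : ∀ z, p z → q z
  unique : ∀ z z', p z → p z' → z = z'

/-- If `2 * η < σ`, the eigenvalue levels `σ - η` and `η` are separated, so the dominant projection
is unique and determines `H = P * Y`. -/
theorem hardThreshold_unique {n r : ℕ} {X Y H H' : Matrix (Fin n) (Fin n) ℝ}
    {U : Matrix (Fin n) (Fin r) ℝ} {d : Fin r → ℝ} (h : IsThinEig X U d) (hrn : r ≤ n) {σ η : ℝ}
    (hησ : 2 * η < σ) (hd : ∀ k, σ ≤ |d k|) (hη : ‖Y - X‖ ≤ η) (hH : IsHardThreshold r Y H)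
    (hH' : IsHardThreshold r Y H') : H = H' := by
  have hη0 : 0 ≤ η := (norm_nonneg _).trans hη
  obtain ⟨P, Q, _, _, h1, h2, _⟩ := hardThreshold_topSplit h hrn (by linarith) hd hH hη
  obtain ⟨P', Q', _, _, h1', h2', _⟩ := hardThreshold_topSplit h hrn (by linarith) hd hH' hη
  rw [h2, h2', h1.proj_unique h1' (by linarith) (by linarith)]

/-- An iterate of rank `r` near `X` with an incoherent column space. -/
structure GoodIterate {n : ℕ} (r : ℕ) (X : Matrix (Fin n) (Fin n) ℝ) (τ δ : ℝ)
    (Z : Matrix (Fin n) (Fin n) ℝ) : Prop where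
  symm : Zᵀ = Z
  mulVec_one : Z *ᵥ (fun _ => (1 : ℝ)) = 0
  exists_eig : ∃ (U : Matrix (Fin n) (Fin r) ℝ) (d : Fin r → ℝ) (Q : Matrix (Fin n) (Fin n) ℝ),
    IsThinEig Z U d ∧ Z * Q = U * Uᵀ ∧ ∀ i, vnorm ((U * Uᵀ) i) ≤ τ
  frob_le : frobNorm (Z - X) ≤ δ

theorem goodIterate_of_topSplit {n r : ℕ} {X Y H P Q Q' : Matrix (Fin n) (Fin n) ℝ}
    {U : Matrix (Fin n) (Fin r) ℝ} {d : Fin r → ℝ} {a b τ δ : ℝ}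
    (hs : Yᵀ = Y) (h1 : Y *ᵥ (fun _ => (1 : ℝ)) = 0) (h : TopSplit r Y P Q a b) (hH : H = P * Y)
    (hHQ : H * Q' = P) (hU : IsThinEig H U d) (hP : U * Uᵀ = P) (hrow : ∀ i, vnorm (P i) ≤ τ)
    (hfrob : frobNorm (P * Y - X) ≤ δ) : GoodIterate r X τ δ H where
  symm := by rw [hH, Matrix.transpose_mul, hs, h.proj.symm, h.comm]
  mulVec_one := by rw [hH, ← Matrix.mulVec_mulVec, h1, Matrix.mulVec_zero]
  exists_eig := ⟨U, d, Q', hU, hHQ.trans hP.symm, by rwa [hP]⟩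
  frob_le := by rwa [hH]

theorem centering_conj_transpose {n : ℕ} {N : Matrix (Fin n) (Fin n) ℝ} (hN : Nᵀ = N) :
    (centering n * N * centering n)ᵀ = centering n * N * centering n := by
  rw [Matrix.transpose_mul, Matrix.transpose_mul, hN, (isOrthProj_centering n).symm,
    Matrix.mul_assoc]

namespace SamplingRegime

variable {n r m : ℕ} {X : Matrix (Fin n) (Fin n) ℝ} {U : Matrix (Fin n) (Fin r) ℝ}
    {d : Fin r → ℝ} {σ κ B τ l : ℝ}

theorem centering_mul (h : SamplingRegime n r m X U d σ κ B τ l) : centering n * X = X :=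
  _root_.centering_mul h.symm h.mulVec_one

/-- `X` with the noise outside of row and column `i`. -/
def loo (X N : Matrix (Fin n) (Fin n) ℝ) (i : Fin n) : Matrix (Fin n) (Fin n) ℝ :=
  X + centering n * (dropCoord i * N * dropCoord i) * centering n

/-- The initialization is accurate and incoherent as soon as the noise is small and its rows are
small on the leave-one-out eigenspaces. -/
theorem goodIterate_init (h : SamplingRegime n r m X U d σ κ B τ l)
    {N H : Matrix (Fin n) (Fin n) ℝ} (hNs : Nᵀ = N)
    (hN : ‖N‖ ≤ σ / (364 * (κ ^ 2 * Real.sqrt r)))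
    (hloo : ∀ i, vnorm (topProj r (loo X N i) (σ - σ / 364) (σ / 364) *ᵥ N i)
      ≤ σ / 20 * (τ + rowMax (topProj r (loo X N i) (σ - σ / 364) (σ / 364))))
    (hH : IsHardThreshold r (X + centering n * N * centering n) H) :
    GoodIterate r X τ (σ / (256 * κ ^ 2)) H := by
  have hσ := h.sigma_pos
  have hκ := h.one_le_kappa
  have hτ := h.tau_nonneg
  set k := κ ^ 2 * Real.sqrt r with hk
  have hsr : 1 ≤ Real.sqrt r := Real.one_le_sqrt.2 h.one_le_r
  have hk1 : 1 ≤ k := one_le_mul_of_one_le_of_one_le (one_le_pow₀ hκ) hsr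
  have hη : σ / (364 * k) ≤ σ / 364 := by
    apply div_le_div_of_nonneg_left hσ.le (by norm_num)
    linarith
  have hJs := (isOrthProj_centering n).symm
  have hN' : ‖N‖ ≤ σ / 364 := hN.trans hη
  have hlt : σ / (364 * k) < σ := by linarith
  have hWn : ‖X + centering n * N * centering n - X‖ ≤ σ / (364 * k) := by
    rw [add_sub_cancel_left]
    exact (norm_centering_conj_le N).trans hN
  obtain ⟨P, Q, U', d', hsplit, hHP, hHQ, hU', hUP⟩ :=
    hardThreshold_topSplit h.eig h.rank_le_card hlt h.sigma_le hH hWn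
  have hsplit' := hsplit.mono (a' := σ - σ / 364) (by linarith) (by linarith) hη
  have hJP : centering n * P = P := hsplit.centering_mul_proj (by
    rw [Matrix.mul_add, h.centering_mul, ← Matrix.mul_assoc, ← Matrix.mul_assoc,
      (isOrthProj_centering n).idem])
  have hb : ∀ i, vnorm (P *ᵥ N i) ≤ σ * (6 / 100 * τ + 6 / 100 * rowMax P) := by
    intro i
    have hdN : (dropCoord i * N * dropCoord i)ᵀ = dropCoord i * N * dropCoord i := by
      rw [Matrix.transpose_mul, Matrix.transpose_mul, hNs, (isOrthProj_dropCoord i).symm,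
        Matrix.mul_assoc]
    obtain ⟨H₁, hH₁⟩ := exists_hardThreshold (Y := loo X N i) (by
      rw [loo, Matrix.transpose_add, h.symm, centering_conj_transpose hdN]) r
    obtain ⟨P₁, Q₁, _, _, hsp, _⟩ :=
      hardThreshold_topSplit h.eig h.rank_le_card (η := σ / 364) (by linarith) h.sigma_le hH₁ (by
        rw [loo, add_sub_cancel_left]
        exact (norm_centering_conj_le _).trans ((norm_dropCoord_conj_le i N).trans hN'))
    obtain ⟨Q₂, hQ₂⟩ := exists_topSplit_topProj ⟨P₁, Q₁, hsp⟩
    exact leave_one_out_bound hσ hτ h.centering_mul i hN' hsplit' hQ₂ (hloo i)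
  have hrow : rowMax P ≤ τ := by
    -- A self-bounding estimate: `rowMax P` reappears on the right with a factor below `1`.
    -- Incoherence contributes about `τ / 11`, the leave-one-out bound about `6 / 100 * (τ + rowMax
    -- P)`.
    have key : ∀ j, vnorm (P j) ≤ 17 / 100 * τ + 1 / 10 * rowMax P := by
      intro j
      have h1 := h.topSplit.vnorm_row_le hsplit' j
      have e : (X + centering n * N * centering n - X) * P = centering n * (N * P) := by
        rw [add_sub_cancel_left, Matrix.mul_assoc, hJP, Matrix.mul_assoc]
      have h2 : vnorm ((centering n * (N * P)) j) ≤ σ * (6 / 100 * τ + 6 / 100 * rowMax P)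
          + σ / 364 * τ := by
        refine (vnorm_centering_mul_row_le (by have := h.three_le; omega) _ j).trans
          (add_le_add ?_ ?_)
        · rw [vnorm_mul_proj_row hsplit.proj]
          exact hb j
        · refine mul_le_mul ?_ h.inv_sqrt_le (by positivity) (by positivity)
          exact (norm_mul_le _ _).trans ((mul_le_of_le_one_right (norm_nonneg _)
            hsplit.proj.norm_le).trans hN')
      rw [e] at h1
      have h3 : (σ - σ / 364)⁻¹ = 364 / 363 / σ := by field_simp; norm_num
      have h4 : ‖X + centering n * N * centering n - X‖ * (σ - σ / 364)⁻¹ ≤ 1 / 363 := by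
        rw [h3]
        refine (mul_le_mul_of_nonneg_right (hWn.trans hη) (by positivity)).trans (le_of_eq ?_)
        field_simp
      have h5 : vnorm ((centering n * (N * P)) j) * (σ - σ / 364)⁻¹
          ≤ 364 / 363 * (6 / 100 * τ + 6 / 100 * rowMax P + 1 / 364 * τ) := by
        rw [h3]
        refine (mul_le_mul_of_nonneg_right h2 (by positivity)).trans (le_of_eq ?_)
        field_simp
      have h6 : vnorm ((U * Uᵀ) j)
          * (1 + ‖X + centering n * N * centering n - X‖ * (σ - σ / 364)⁻¹)
          ≤ τ / 11 * (1 + 1 / 363) :=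
        mul_le_mul (h.row_le j) (by linarith) (by rw [h3]; positivity) (by positivity)
      have := rowMax_nonneg P
      linarith
    have := rowMax_le (by have := rowMax_nonneg P; positivity) key
    linarith
  refine goodIterate_of_topSplit ?_ ?_ hsplit hHP hHQ hU' hUP
    (fun i => (vnorm_row_le_rowMax P i).trans hrow) ?_
  · rw [Matrix.transpose_add, h.symm, centering_conj_transpose hNs]
  · rw [Matrix.add_mulVec, h.mulVec_one, ← Matrix.mulVec_mulVec, centering_mulVec_one,
      Matrix.mulVec_zero, add_zero]
  · have h1 := h.topSplit.frobNorm_sub_sq_le hsplit hWn hlt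
    have h2 : σ / (σ - σ / (364 * k)) ≤ 364 / 363 := by
      rw [div_le_iff₀ (by linarith)]
      linarith
    have h2' : 0 ≤ σ / (σ - σ / (364 * k)) := div_nonneg hσ.le (by linarith)
    refine le_of_sq_le_sq (h1.trans ?_) (by positivity)
    -- The factor `√r` in `k` cancels the rank. The number `364` is chosen slightly above `256 *
    -- √2`, so that `256² (1 + (364 / 363)²) ≤ 364²`.
    have h3 : (r : ℝ) * (σ / (364 * k)) ^ 2 = (σ / κ ^ 2) ^ 2 / 364 ^ 2 := by
      have : Real.sqrt r ^ 2 = r := Real.sq_sqrt (by positivity)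
      have hr0 : (r : ℝ) ≠ 0 := by have := h.one_le_r; positivity
      rw [hk, div_pow, mul_pow, mul_pow, this]
      field_simp
    have h4 : (σ / (256 * κ ^ 2)) ^ 2 = (σ / κ ^ 2) ^ 2 / 256 ^ 2 := by
      field_simp
    rw [h3, h4]
    have h5 : (σ / (σ - σ / (364 * k))) ^ 2 ≤ (364 / 363) ^ 2 := pow_le_pow_left₀ h2' h2 2
    have h6 : (0 : ℝ) ≤ (σ / κ ^ 2) ^ 2 := by positivity
    nlinarith

end SamplingRegime

/-! ### Initialization: operator norm of the noise -/

section Noise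

variable {n : ℕ}

theorem vnorm_edgeMat_mulVec_sq (α : PairIdx n) (x : Fin n → ℝ) :
    vnorm (edgeMat α *ᵥ x) ^ 2 = x α.1.1 ^ 2 + x α.1.2 ^ 2 := by
  have hne : α.1.1 ≠ α.1.2 := α.2.ne
  rw [edgeMat_mulVec, vnorm_sq_dotProduct]
  simp [hne, hne.symm]
  ring

theorem norm_edgeMat_le (α : PairIdx n) : ‖edgeMat α‖ ≤ 1 := by
  refine opNorm_le zero_le_one fun x => ?_
  rw [one_mul]
  refine le_of_sq_le_sq ?_ (vnorm_nonneg _)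
  rw [vnorm_edgeMat_mulVec_sq, vnorm_sq, ← Finset.sum_pair (f := fun i => x i ^ 2) α.2.ne]
  exact Finset.sum_le_sum_of_subset_of_nonneg (Finset.subset_univ _) fun i _ _ => sq_nonneg _

theorem norm_le_of_entry_le {E : Matrix (Fin n) (Fin n) ℝ} {c : ℝ} (hc : 0 ≤ c)
    (hE : ∀ i j, |E i j| ≤ c) : ‖E‖ ≤ n * c := by
  refine (norm_le_frobNorm E).trans (le_of_sq_le_sq ?_ (by positivity))
  rw [frobNorm_sq]
  calc ∑ i, vnorm (E i) ^ 2 ≤ ∑ _i : Fin n, ∑ _j : Fin n, c ^ 2 := by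
        refine Finset.sum_le_sum fun i _ => ?_
        rw [vnorm_sq]
        exact Finset.sum_le_sum fun j _ => sq_le_sq' (abs_le.1 (hE i j)).1 (abs_le.1 (hE i j)).2
    _ = (n * c) ^ 2 := by simp; ring

theorem norm_noiseTerm_le (hn : 3 ≤ n) {m : ℕ} {E : Matrix (Fin n) (Fin n) ℝ} {D : ℝ} (hD0 : 0 ≤ D)
    (hD : ∀ i j, |edm E i j| ≤ D) (α : PairIdx n) : ‖noiseTerm m E α‖ ≤ n ^ 2 * D / (2 * m) := by
  have hL := numPairs_pos hn
  have hn3 : (3 : ℝ) ≤ n := by exact_mod_cast hn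
  have h1 : ‖(numPairs n / m) • (edm E α.1.1 α.1.2 • edgeMat α)‖ ≤ numPairs n / m * D := by
    rw [norm_smul, norm_smul, Real.norm_of_nonneg (by positivity)]
    refine mul_le_mul_of_nonneg_left ?_ (by positivity)
    exact (mul_le_mul (hD _ _) (norm_edgeMat_le α) (norm_nonneg _) hD0).trans (by rw [mul_one])
  have h2 : ‖(1 / (m : ℝ)) • edm E‖ ≤ 1 / m * (n * D) := by
    rw [norm_smul, Real.norm_of_nonneg (by positivity)]
    exact mul_le_mul_of_nonneg_left (norm_le_of_entry_le hD0 hD) (by positivity)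
  rw [noiseTerm, norm_smul, Real.norm_eq_abs, abs_neg, abs_of_pos (by norm_num)]
  have h3 := (norm_sub_le _ _).trans (add_le_add h1 h2)
  refine (mul_le_mul_of_nonneg_left h3 (by norm_num)).trans ?_
  have e : (1 / 2 : ℝ) * (numPairs n / m * D + 1 / m * (n * D))
      = (numPairs n + n) * (D / (2 * m)) := by ring
  rw [e, mul_div_assoc]
  refine mul_le_mul_of_nonneg_right ?_ (by positivity)
  rw [numPairs]
  nlinarith

theorem sum_sq_endpoints (x : Fin n → ℝ) :
    ∑ α : PairIdx n, (x α.1.1 ^ 2 + x α.1.2 ^ 2) = (n - 1) * vnorm x ^ 2 := by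
  rw [sum_pairIdx (fun i _ => x i ^ 2), vnorm_sq, Finset.mul_sum]
  refine Finset.sum_congr rfl fun i _ => ?_
  have : ∀ j, (if i = j then 0 else x i ^ 2) = x i ^ 2 - if i = j then x i ^ 2 else 0 := by
    intro j; split_ifs <;> simp
  simp [this, Finset.sum_sub_distrib]
  ring

/-- The mean is dropped from the second moment. An edge matrix only swaps two coordinates and kills
the others, and each vertex lies on `n - 1` edges. -/
theorem sum_vnorm_noiseTerm_mulVec_sq_le {m : ℕ} {E : Matrix (Fin n) (Fin n) ℝ} {D : ℝ}
    (hD : ∀ i j, |edm E i j| ≤ D) (x : Fin n → ℝ) :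
    ∑ α, vnorm (noiseTerm m E α *ᵥ x) ^ 2
      ≤ (numPairs n / (2 * m)) ^ 2 * D ^ 2 * (n - 1) * vnorm x ^ 2 := by
  set F : Matrix (Fin n) (Fin n) ℝ → EuclideanSpace ℝ (Fin n) := fun M => WithLp.toLp 2 (M *ᵥ x)
    with hF
  set f : PairIdx n → EuclideanSpace ℝ (Fin n) := fun α =>
    F ((-(1 / 2 : ℝ)) • (numPairs n / m) • (edm E α.1.1 α.1.2 • edgeMat α)) with hf
  set c : EuclideanSpace ℝ (Fin n) := F ((-(1 / 2 : ℝ)) • (1 / (m : ℝ)) • edm E) with hc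
  have hsub : ∀ α, vnorm (noiseTerm m E α *ᵥ x) = ‖f α - c‖ := by
    intro α
    rw [vnorm, noiseTerm, smul_sub, Matrix.sub_mulVec]
    rfl
  have hsum : ∑ α, f α = (Fintype.card (PairIdx n) : ℝ) • c := by
    have h0 := sum_noiseTerm m E
    simp only [noiseTerm, smul_sub] at h0
    rw [Finset.sum_sub_distrib, sub_eq_zero, Finset.sum_const, Finset.card_univ,
      ← Nat.cast_smul_eq_nsmul ℝ] at h0
    simp only [hf, hF, hc]
    rw [← WithLp.toLp_sum, ← Matrix.sum_mulVec, h0, Matrix.smul_mulVec, WithLp.toLp_smul]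
  simp only [hsub]
  refine (sum_norm_sub_mean_sq_le f c hsum).trans ?_
  have hterm : ∀ α, ‖f α‖ ^ 2
      ≤ (numPairs n / (2 * m)) ^ 2 * D ^ 2 * (x α.1.1 ^ 2 + x α.1.2 ^ 2) := by
    intro α
    have : ‖f α‖ = vnorm (((-(1 / 2 : ℝ)) * (numPairs n / m) * edm E α.1.1 α.1.2)
        • (edgeMat α *ᵥ x)) := by
      simp only [hf, hF, vnorm, Matrix.smul_mulVec, smul_smul, mul_assoc]
    rw [this, vnorm_smul, mul_pow, sq_abs, vnorm_edgeMat_mulVec_sq]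
    have hDD : edm E α.1.1 α.1.2 ^ 2 ≤ D ^ 2 :=
      sq_le_sq' (abs_le.1 (hD _ _)).1 (abs_le.1 (hD _ _)).2
    refine mul_le_mul_of_nonneg_right ?_ (by positivity)
    have : ((-(1 / 2 : ℝ)) * (numPairs n / m) * edm E α.1.1 α.1.2) ^ 2
        = (numPairs n / (2 * m)) ^ 2 * edm E α.1.1 α.1.2 ^ 2 := by ring
    rw [this]
    exact mul_le_mul_of_nonneg_left hDD (sq_nonneg _)
  refine (Finset.sum_le_sum fun α _ => hterm α).trans (le_of_eq ?_)
  rw [← Finset.mul_sum, sum_sq_endpoints]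
  ring

end Noise

namespace SamplingRegime

variable {n r m : ℕ} {X : Matrix (Fin n) (Fin n) ℝ} {U : Matrix (Fin n) (Fin r) ℝ}
    {d : Fin r → ℝ} {σ κ B τ l : ℝ}

theorem card_norm_noise_ge_le (h : SamplingRegime n r m X U d σ κ B τ l) :
    ((Finset.univ.filter fun ω : Fin m → PairIdx n =>
      σ / (364 * (κ ^ 2 * Real.sqrt r)) ≤ ‖noise ω X‖).card : ℝ)
      ≤ 3 / 2 * n * Real.exp (-l) * Fintype.card (PairIdx n) ^ m := by
  have hσ := h.sigma_pos
  have hκ : 0 < κ := one_pos.trans_le h.one_le_kappa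
  have hl : 0 < l := one_pos.trans_le h.one_le_l
  have hB := h.B_pos
  have hn := h.n_pos
  have hn3 := h.three_le'
  have hm := h.m_pos
  have hL := numPairs_pos h.three_le
  have hr0 : (0 : ℝ) < r := one_pos.trans_le h.one_le_r
  have hsr : 0 < Real.sqrt r := Real.sqrt_pos.2 hr0
  have hsr2 : Real.sqrt r ^ 2 = r := Real.sq_sqrt hr0.le
  have hsr1 : 1 ≤ Real.sqrt r := Real.one_le_sqrt.2 h.one_le_r
  have hM := h.card_entry_le
  have : Nonempty (Fin n) := ⟨⟨0, by have := h.three_le; omega⟩⟩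
  set k := κ ^ 2 * Real.sqrt r with hk
  have hk0 : 0 < k := by positivity
  have hk1 : 1 ≤ k := one_le_mul_of_one_le_of_one_le (one_le_pow₀ h.one_le_kappa) hsr1
  have hM' : 777000 * k ^ 2 * (n * B) ^ 2 * n * l ≤ m * σ ^ 2 := by
    refine le_trans (le_of_eq ?_) hM
    rw [hk, mul_pow, hsr2]
    ring
  -- `θ` is close to the optimum. The exponent becomes about `(-2.93 + 1.47) * l ≤ -l - 0.46`; the
  -- spare `0.46` lowers the prefactor `2 * n` to `3 / 2 * n` and leaves room for the leave-one-out
  -- events.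
  have key := card_opNorm_sum_ge_le (noiseTerm m X) (noiseTerm_transpose m X) (sum_noiseTerm m X)
    (ρ := 1 / 300) (v := 2 * n ^ 3 * B ^ 2 / m ^ 2) (θ := 1067 * k * l / σ) (by norm_num)
    (by norm_num) (by positivity) ?_ ?_ m (σ / (364 * k))
  · refine key.trans ?_
    refine mul_le_mul_of_nonneg_right ?_ (by positivity)
    rw [Fintype.card_fin]
    have he : -(1067 * k * l / σ * (σ / (364 * k)))
        + m * ((1 + 1 / 300) / 2 * ((1067 * k * l / σ) ^ 2 * (2 * n ^ 3 * B ^ 2 / m ^ 2)))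
        ≤ -l - 46 / 100 := by
      have e1 : 1067 * k * l / σ * (σ / (364 * k)) = 1067 / 364 * l := by field_simp
      have e2 : m * ((1 + 1 / 300) / 2 * ((1067 * k * l / σ) ^ 2 * (2 * n ^ 3 * B ^ 2 / m ^ 2)))
          = (301 / 300 * 1067 ^ 2 / 777000) * l
            * ((777000 * k ^ 2 * (n * B) ^ 2 * n * l) / (m * σ ^ 2)) := by
        field_simp
        norm_num
      have e3 : (777000 * k ^ 2 * (n * B) ^ 2 * n * l) / (m * σ ^ 2) ≤ 1 :=
        div_le_one_of_le₀ hM' (by positivity)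
      have e4 := mul_le_mul_of_nonneg_left e3
        (show (0 : ℝ) ≤ (301 / 300 * 1067 ^ 2 / 777000) * l by positivity)
      rw [e1, e2]
      have := h.one_le_l
      linarith
    have h2 := Real.exp_le_exp.2 he
    rw [sub_eq_add_neg (-l), Real.exp_add (-l)] at h2
    have h3 : Real.exp (-(46 / 100)) ≤ 3 / 4 := by
      rw [Real.exp_neg]
      refine (inv_anti₀ (by norm_num) (Real.add_one_le_exp (46 / 100 : ℝ))).trans (by norm_num)
    have h4 := mul_le_mul_of_nonneg_left h3 (Real.exp_pos (-l)).le
    have h5 := mul_le_mul_of_nonneg_left (h2.trans h4) (show (0 : ℝ) ≤ 2 * n by positivity)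
    linarith
  · intro α
    have h1 := norm_noiseTerm_le h.three_le (m := m) (by positivity) h.abs_edm_le α
    refine (mul_le_mul_of_nonneg_left h1 (by positivity)).trans ?_
    have e : 1067 * k * l / σ * ((n : ℝ) ^ 2 * (4 * B) / (2 * m))
        = (2134 / 777000) * (σ / (k * (n * B)))
          * ((777000 * k ^ 2 * (n * B) ^ 2 * n * l) / (m * σ ^ 2)) := by
      field_simp
      ring
    rw [e]
    have e3 : (777000 * k ^ 2 * (n * B) ^ 2 * n * l) / (m * σ ^ 2) ≤ 1 :=
      div_le_one_of_le₀ hM' (by positivity)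
    have e4 : σ / (k * (n * B)) ≤ 1 := by
      refine div_le_one_of_le₀ ?_ (by positivity)
      exact h.sigma_le_nB.trans (le_mul_of_one_le_left (by positivity) hk1)
    calc _ ≤ (2134 / 777000 : ℝ) * 1 * 1 := by gcongr
      _ ≤ 1 / 300 := by norm_num
  · intro x
    refine (sum_vnorm_noiseTerm_mulVec_sq_le h.abs_edm_le x).trans ?_
    rw [card_pairIdx]
    refine mul_le_mul_of_nonneg_right ?_ (by positivity)
    have e : (numPairs n / (2 * m)) ^ 2 * (4 * B) ^ 2 * ((n : ℝ) - 1)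
        = numPairs n * (4 * B ^ 2 / m ^ 2 * (numPairs n * (n - 1))) := by ring
    rw [e]
    refine mul_le_mul_of_nonneg_left ?_ hL.le
    have : numPairs n * ((n : ℝ) - 1) ≤ n ^ 3 / 2 := by
      have h1 := numPairs_le n
      have h2 := mul_le_mul h1 (show (n : ℝ) - 1 ≤ n by linarith) (by linarith) (by positivity)
      linarith
    refine (mul_le_mul_of_nonneg_left this (by positivity)).trans (le_of_eq (by ring))

end SamplingRegime

/-! ### Resampling the entries that satisfy a predicate -/

section Resample

variable {A : Type*} (p : A → Prop) [DecidablePred p] {m : ℕ}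

/-- Replace the entries of `ω` that satisfy `p` by those of `t`. -/
def resample (ω : Fin m → A) (t : Fin m → {a // p a}) : Fin m → A :=
  fun k => if p (ω k) then (t k : A) else ω k

theorem resample_iff (ω : Fin m → A) (t : Fin m → {a // p a}) (k : Fin m) :
    p (resample p ω t k) ↔ p (ω k) := by
  rw [resample]
  split_ifs with h
  · exact iff_of_true (t k).2 h
  · rfl

/-- Exchange of the entries that satisfy `p`. -/
def resampleEquiv : ((Fin m → A) × (Fin m → {a // p a})) ≃ ((Fin m → A) × (Fin m → {a // p a})) :=
  Function.Involutive.toPerm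
    (fun x => (resample p x.1 x.2, fun k => if h : p (x.1 k) then ⟨x.1 k, h⟩ else x.2 k))
    fun x => by
      obtain ⟨ω, t⟩ := x
      refine Prod.ext (funext fun k => ?_) (funext fun k => ?_)
      · by_cases h : p (ω k)
        · simp [resample, h, (t k).2]
        · simp [resample, h]
      · by_cases h : p (ω k)
        · simp [resample, h, (t k).2]
        · simp [resample, h]

open scoped Classical in
/-- If `Q` is unlikely under resampling of the entries that satisfy `p`, then it is unlikely. -/
theorem card_filter_le_of_resample [Fintype A] (Q : (Fin m → A) → Prop) {q : ℝ}
    (hT : 0 < Fintype.card {a // p a})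
    (h : ∀ ω, ((Finset.univ.filter fun t => Q (resample p ω t)).card : ℝ)
      ≤ q * Fintype.card {a // p a} ^ m) :
    ((Finset.univ.filter Q).card : ℝ) ≤ q * Fintype.card A ^ m := by
  -- The exchange is a bijection of pairs, so the resampled sequence has the same distribution as
  -- `ω`.
  have h1 : (Finset.univ.filter fun x : (Fin m → A) × (Fin m → {a // p a}) => Q x.1).card
      = (Finset.univ.filter fun x : (Fin m → A) × (Fin m → {a // p a}) =>
        Q (resample p x.1 x.2)).card := by
    refine (Finset.card_bij (fun x _ => resampleEquiv p x) ?_ ?_ ?_).symm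
    · intro x hx
      rw [Finset.mem_filter] at hx ⊢
      exact ⟨Finset.mem_univ _, hx.2⟩
    · intro x _ y _ hxy
      exact (resampleEquiv p).injective hxy
    · intro y hy
      refine ⟨(resampleEquiv p).symm y, ?_, by simp⟩
      have : resample p ((resampleEquiv p).symm y).1 ((resampleEquiv p).symm y).2 = y.1 :=
        congrArg Prod.fst ((resampleEquiv p).apply_symm_apply y)
      simpa [this] using hy
  have h2 : (Finset.univ.filter fun x : (Fin m → A) × (Fin m → {a // p a}) => Q x.1).card
      = (Finset.univ.filter Q).card * Fintype.card {a // p a} ^ m := by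
    have : (Finset.univ.filter fun x : (Fin m → A) × (Fin m → {a // p a}) => Q x.1)
        = (Finset.univ.filter Q) ×ˢ Finset.univ := by
      ext x
      simp
    rw [this, Finset.card_product]
    simp
  have h3 : (Finset.univ.filter fun x : (Fin m → A) × (Fin m → {a // p a}) =>
      Q (resample p x.1 x.2)).card
      = ∑ ω : Fin m → A, (Finset.univ.filter fun t => Q (resample p ω t)).card := by
    simp only [Finset.card_filter]
    rw [Fintype.sum_prod_type]
  have h4 : ((Finset.univ.filter Q).card : ℝ) * Fintype.card {a // p a} ^ m
      ≤ q * Fintype.card A ^ m * Fintype.card {a // p a} ^ m := by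
    have e : ((Finset.univ.filter Q).card : ℝ) * Fintype.card {a // p a} ^ m
        = ∑ ω : Fin m → A, ((Finset.univ.filter fun t => Q (resample p ω t)).card : ℝ) := by
      rw [← Nat.cast_sum, ← h3, ← h1, h2]
      push_cast
      ring
    rw [e]
    refine (Finset.sum_le_sum fun ω _ => h ω).trans (le_of_eq ?_)
    simp
    ring
  have hpos : (0 : ℝ) < (Fintype.card {a // p a} : ℝ) ^ m := by positivity
  exact le_of_mul_le_mul_right h4 hpos

end Resample

/-! ### Edges at a vertex -/

section Touch

variable {n : ℕ}

/-- The edge `α` has the endpoint `i`. -/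
abbrev Touches (i : Fin n) (α : PairIdx n) : Prop := α.1.1 = i ∨ α.1.2 = i

theorem edgeMat_row (i : Fin n) (α : PairIdx n) :
    edgeMat α i = (if α.1.1 = i then Pi.single α.1.2 1 else 0)
      + if α.1.2 = i then Pi.single α.1.1 1 else 0 := by
  ext j
  simp only [edgeMat, Matrix.add_apply, Pi.add_apply, Matrix.single_apply]
  split_ifs <;> simp_all [Pi.single_apply, eq_comm]

theorem edgeMat_row_eq_zero {i : Fin n} {α : PairIdx n} (h : ¬ Touches i α) : edgeMat α i = 0 := by
  rw [Touches, not_or] at h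
  rw [edgeMat_row, if_neg h.1, if_neg h.2, add_zero]

theorem dropCoord_conj_edgeMat {i : Fin n} {α : PairIdx n} (h : Touches i α) :
    dropCoord i * edgeMat α * dropCoord i = 0 := by
  have h1 : dropCoord i * Matrix.single i i (1 : ℝ) = 0 := by
    rw [dropCoord, sub_mul, one_mul, Matrix.single_mul_single_same, mul_one, sub_self]
  have h2 : Matrix.single i i (1 : ℝ) * dropCoord i = 0 := by
    rw [dropCoord, mul_sub, mul_one, Matrix.single_mul_single_same, mul_one, sub_self]
  have key : ∀ j, dropCoord i * (Matrix.single i j (1 : ℝ) + Matrix.single j i 1) * dropCoord i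
      = 0 := by
    intro j
    have e1 : Matrix.single i j (1 : ℝ) = Matrix.single i i 1 * Matrix.single i j 1 := by
      rw [Matrix.single_mul_single_same, mul_one]
    have e2 : Matrix.single j i (1 : ℝ) = Matrix.single j i 1 * Matrix.single i i 1 := by
      rw [Matrix.single_mul_single_same, mul_one]
    rw [mul_add, add_mul, e1, e2, ← Matrix.mul_assoc, h1, Matrix.zero_mul, Matrix.zero_mul,
      Matrix.mul_assoc, Matrix.mul_assoc, h2, Matrix.mul_zero, Matrix.mul_zero, add_zero]
  rcases h with h | h
  · rw [edgeMat, h]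
    exact key _
  · rw [edgeMat, h, add_comm]
    exact key _

theorem sum_touches {M : Type*} [AddCommMonoid M] (i : Fin n) (f : PairIdx n → M)
    (hf : ∀ α, ¬ Touches i α → f α = 0) :
    ∑ t : {α // Touches i α}, f t = ∑ α, f α := by
  rw [← Finset.sum_subtype (Finset.univ.filter (Touches i)) (by simp) f]
  exact Finset.sum_filter_of_ne fun α _ h => by
    by_contra hc
    exact h (hf α hc)

theorem card_touches (i : Fin n) : (Fintype.card {α // Touches i α} : ℝ) = n - 1 := by
  have h := sum_pairIdx (n := n) (M := ℝ) fun a _ => if a = i then 1 else 0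
  have h1 := sum_touches (M := ℝ) i (fun α => if Touches i α then 1 else 0)
    fun α hα => by rw [if_neg hα]
  have h2 : ∀ α : PairIdx n, ((if α.1.1 = i then (1 : ℝ) else 0) + if α.1.2 = i then 1 else 0)
      = if Touches i α then 1 else 0 := by
    intro α
    have := α.2.ne
    by_cases h1 : α.1.1 = i
    · have h2 : ¬ α.1.2 = i := fun h2 => this (h1.trans h2.symm)
      simp [Touches, h1, h2]
    · simp [Touches, h1]
  have h3 : ∀ a b : Fin n, (if a = b then (0 : ℝ) else if a = i then 1 else 0)
      = (if a = i then 1 else 0) - if a = b then if a = i then 1 else 0 else 0 := by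
    intro a b
    split_ifs <;> simp
  have h4 : ∑ t : {α // Touches i α}, (if Touches i t.1 then (1 : ℝ) else 0)
      = Fintype.card {α // Touches i α} := by
    rw [Finset.sum_congr rfl fun t _ => if_pos t.2]
    simp
  rw [h4] at h1
  rw [h1, ← Finset.sum_congr rfl fun α _ => h2 α, h]
  simp only [h3, Finset.sum_sub_distrib]
  simp [Finset.sum_ite_eq]

theorem sum_touches_edm_smul (E : Matrix (Fin n) (Fin n) ℝ) (i : Fin n) :
    ∑ t : {α // Touches i α}, edm E t.1.1.1 t.1.1.2 • edgeMat t.1 i = edm E i := by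
  rw [sum_touches i (fun α => edm E α.1.1 α.1.2 • edgeMat α i)
    fun α hα => by rw [edgeMat_row_eq_zero hα, smul_zero]]
  conv_rhs => rw [← sum_edm_smul_edgeMat E]
  ext j
  simp [Matrix.sum_apply]

theorem IsOrthProj.vnorm_mulVec_single {P : Matrix (Fin n) (Fin n) ℝ} (hP : IsOrthProj P)
    (j : Fin n) : vnorm (P *ᵥ Pi.single j 1) = vnorm (P j) := by
  congr 1
  ext k
  rw [Matrix.mulVec_single_one]
  conv_rhs => rw [← hP.symm]
  rfl

theorem vnorm_mulVec_edgeMat_row_sq {P : Matrix (Fin n) (Fin n) ℝ} (hP : IsOrthProj P)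
    (i : Fin n) (α : PairIdx n) : vnorm (P *ᵥ edgeMat α i) ^ 2
      = (if α.1.1 = i then vnorm (P α.1.2) ^ 2 else 0)
        + if α.1.2 = i then vnorm (P α.1.1) ^ 2 else 0 := by
  have hne := α.2.ne
  rw [edgeMat_row]
  by_cases h1 : α.1.1 = i
  · have h2 : ¬ α.1.2 = i := fun h2 => hne (h1.trans h2.symm)
    rw [if_pos h1, if_pos h1, if_neg h2, if_neg h2, add_zero, add_zero, hP.vnorm_mulVec_single]
  · rw [if_neg h1, if_neg h1, zero_add, zero_add]
    split_ifs
    · rw [hP.vnorm_mulVec_single]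
    · simp

theorem vnorm_mulVec_edgeMat_row_le {P : Matrix (Fin n) (Fin n) ℝ} (hP : IsOrthProj P)
    (i : Fin n) (α : PairIdx n) : vnorm (P *ᵥ edgeMat α i) ≤ rowMax P := by
  have hne := α.2.ne
  rw [edgeMat_row]
  by_cases h1 : α.1.1 = i
  · have h2 : ¬ α.1.2 = i := fun h2 => hne (h1.trans h2.symm)
    rw [if_pos h1, if_neg h2, add_zero, hP.vnorm_mulVec_single]
    exact vnorm_row_le_rowMax P _
  · rw [if_neg h1, zero_add]
    split_ifs
    · rw [hP.vnorm_mulVec_single]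
      exact vnorm_row_le_rowMax P _
    · simpa using rowMax_nonneg P

/-- The `i`-th rows of the edges at `i` run through the unit vectors `e_j` with `j ≠ i`, and the
squared row norms of `P` sum to its trace. -/
theorem sum_vnorm_mulVec_edgeMat_row_sq_le {P : Matrix (Fin n) (Fin n) ℝ} (hP : IsOrthProj P)
    (i : Fin n) : ∑ α, vnorm (P *ᵥ edgeMat α i) ^ 2 ≤ P.trace := by
  rw [Finset.sum_congr rfl fun α _ => vnorm_mulVec_edgeMat_row_sq hP i α,
    sum_pairIdx (fun a b => if a = i then vnorm (P b) ^ 2 else 0), ← hP.frobNorm_sq_eq,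
    frobNorm_sq, Finset.sum_eq_single i]
  · refine Finset.sum_le_sum fun j _ => ?_
    split_ifs <;> first | positivity | exact le_rfl
  · intro b _ hb
    simp [hb]
  · simp

theorem noise_row {m : ℕ} (hm : 0 < m) (ω : Fin m → PairIdx n) (E : Matrix (Fin n) (Fin n) ℝ)
    (i : Fin n) : noise ω E i = (-(1 / 2 : ℝ)) •
      ((numPairs n / m) • (∑ k, edm E (ω k).1.1 (ω k).1.2 • edgeMat (ω k) i) - edm E i) := by
  have hm' : (m : ℝ) ≠ 0 := by positivity
  ext j
  simp only [noise, noiseTerm, Matrix.sum_apply, Matrix.smul_apply, Matrix.sub_apply, Pi.smul_apply,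
    Pi.sub_apply, Finset.sum_apply, smul_eq_mul]
  rw [← Finset.mul_sum, Finset.sum_sub_distrib, ← Finset.mul_sum]
  simp
  field_simp

/-- The independence behind leave-one-out: outside row and column `i` every edge at `i` contributes
the same deterministic mean term, so resampling these edges changes nothing there. -/
theorem dropCoord_conj_noise_resample {m : ℕ} (ω : Fin m → PairIdx n) (i : Fin n)
    (t : Fin m → {α // Touches i α}) (E : Matrix (Fin n) (Fin n) ℝ) :
    dropCoord i * noise (resample (Touches i) ω t) E * dropCoord i
      = dropCoord i * noise ω E * dropCoord i := by
  have key : ∀ α, Touches i α → dropCoord i * noiseTerm m E α * dropCoord i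
      = (1 / 2 : ℝ) • ((1 / (m : ℝ)) • (dropCoord i * edm E * dropCoord i)) := by
    intro α hα
    have h := dropCoord_conj_edgeMat hα
    rw [noiseTerm, Matrix.mul_smul, Matrix.smul_mul, mul_sub, sub_mul, Matrix.mul_smul,
      Matrix.mul_smul, Matrix.smul_mul, Matrix.smul_mul, h, smul_zero, smul_zero, zero_sub,
      Matrix.mul_smul, Matrix.smul_mul, smul_neg, neg_smul, neg_neg]
  simp only [noise, Matrix.mul_sum, Matrix.sum_mul]
  refine Finset.sum_congr rfl fun k _ => ?_
  by_cases h : Touches i (ω k)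
  · rw [key _ h, key _ ((resample_iff _ ω t k).2 h)]
  · rw [resample, if_neg h]

end Touch

/-! ### Initialization: leave-one-out estimates -/

/-- The number of edges at the vertex `i`. -/
def touchCount {n m : ℕ} (i : Fin n) (ω : Fin m → PairIdx n) : ℝ :=
  ∑ k, if Touches i (ω k) then (1 : ℝ) else 0

theorem touchCount_resample {n m : ℕ} (i : Fin n) (ω : Fin m → PairIdx n)
    (t : Fin m → {α // Touches i α}) :
    touchCount i (resample (Touches i) ω t) = touchCount i ω := by
  simp only [touchCount, resample_iff]

/-- `P *ᵥ x`, scaled, as a linear map. -/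
def scaledMulVec {n : ℕ} (c : ℝ) (P : Matrix (Fin n) (Fin n) ℝ) :
    (Fin n → ℝ) →ₗ[ℝ] EuclideanSpace ℝ (Fin n) :=
  (WithLp.linearEquiv 2 ℝ (Fin n → ℝ)).symm.toLinearMap ∘ₗ (c • P.mulVecLin)

theorem norm_scaledMulVec {n : ℕ} (c : ℝ) (P : Matrix (Fin n) (Fin n) ℝ) (x : Fin n → ℝ) :
    ‖scaledMulVec c P x‖ = |c| * vnorm (P *ᵥ x) := by
  rw [← vnorm_smul]
  rfl

/-- The centred contribution of one edge at `i` to the `i`-th row of the noise, projected. -/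
def looTerm {n : ℕ} (m : ℕ) (E P : Matrix (Fin n) (Fin n) ℝ) (i : Fin n)
    (t : {α // Touches i α}) : EuclideanSpace ℝ (Fin n) :=
  scaledMulVec (-(1 / 2) * (numPairs n / m)) P (edm E t.1.1.1 t.1.1.2 • edgeMat t.1 i)
    - scaledMulVec (-(1 / 2) * (numPairs n / m)) P ((1 / ((n : ℝ) - 1)) • edm E i)

section LooTerm

variable {n m : ℕ}

theorem sum_scaledMulVec_eq (hn : 3 ≤ n) (E P : Matrix (Fin n) (Fin n) ℝ) (i : Fin n) (c : ℝ) :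
    ∑ t : {α // Touches i α}, scaledMulVec c P (edm E t.1.1.1 t.1.1.2 • edgeMat t.1 i)
      = (Fintype.card {α // Touches i α} : ℝ) •
        scaledMulVec c P ((1 / ((n : ℝ) - 1)) • edm E i) := by
  have hn1 : (n : ℝ) - 1 ≠ 0 := by
    have : (3 : ℝ) ≤ n := by exact_mod_cast hn
    linarith
  rw [← map_sum, sum_touches_edm_smul, map_smul, card_touches, smul_smul,
    mul_one_div_cancel hn1, one_smul]

theorem sum_looTerm (hn : 3 ≤ n) (E P : Matrix (Fin n) (Fin n) ℝ) (i : Fin n) :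
    ∑ t, looTerm m E P i t = 0 := by
  simp only [looTerm]
  rw [Finset.sum_sub_distrib, sum_scaledMulVec_eq hn, Finset.sum_const, Finset.card_univ,
    ← Nat.cast_smul_eq_nsmul ℝ, sub_self]

theorem norm_scaledMulVec_edge_le {E P : Matrix (Fin n) (Fin n) ℝ} (hP : IsOrthProj P) {D c : ℝ}
    (hD0 : 0 ≤ D) (hD : ∀ i j, |edm E i j| ≤ D) (i : Fin n) (α : PairIdx n) :
    ‖scaledMulVec c P (edm E α.1.1 α.1.2 • edgeMat α i)‖ ≤ |c| * (D * rowMax P) := by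
  rw [norm_scaledMulVec, Matrix.mulVec_smul, vnorm_smul]
  exact mul_le_mul_of_nonneg_left (mul_le_mul (hD _ _) (vnorm_mulVec_edgeMat_row_le hP i α)
    (vnorm_nonneg _) hD0) (abs_nonneg _)

theorem norm_looTerm_le (hn : 3 ≤ n) {E P : Matrix (Fin n) (Fin n) ℝ} (hP : IsOrthProj P) {D : ℝ}
    (hD0 : 0 ≤ D) (hD : ∀ i j, |edm E i j| ≤ D) (i : Fin n) (t : {α // Touches i α}) :
    ‖looTerm m E P i t‖ ≤ numPairs n / m * (D * rowMax P) := by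
  have hL := numPairs_pos hn
  set c : ℝ := -(1 / 2) * (numPairs n / m) with hc
  have habs : |c| = numPairs n / m / 2 := by
    rw [hc, abs_mul, abs_neg, abs_of_pos (by norm_num), abs_of_nonneg (by positivity)]
    ring
  have hmean : ‖scaledMulVec c P ((1 / ((n : ℝ) - 1)) • edm E i)‖ ≤ |c| * (D * rowMax P) := by
    have hpos : (0 : ℝ) < Fintype.card {α // Touches i α} := by
      rw [card_touches]
      have : (3 : ℝ) ≤ n := by exact_mod_cast hn
      linarith
    have h1 : ‖(Fintype.card {α // Touches i α} : ℝ) •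
        scaledMulVec c P ((1 / ((n : ℝ) - 1)) • edm E i)‖
        ≤ Fintype.card {α // Touches i α} * (|c| * (D * rowMax P)) := by
      rw [← sum_scaledMulVec_eq hn]
      refine (norm_sum_le _ _).trans ((Finset.sum_le_sum fun t _ =>
        norm_scaledMulVec_edge_le hP hD0 hD i t.1).trans ?_)
      simp
    rw [norm_smul, Real.norm_of_nonneg hpos.le] at h1
    exact le_of_mul_le_mul_left h1 hpos
  refine (norm_sub_le _ _).trans ((add_le_add (norm_scaledMulVec_edge_le hP hD0 hD i t.1)
    hmean).trans (le_of_eq ?_))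
  rw [habs]
  ring

theorem sum_norm_looTerm_sq_le (hn : 3 ≤ n) {E P : Matrix (Fin n) (Fin n) ℝ} (hP : IsOrthProj P)
    {D : ℝ} (hD : ∀ i j, |edm E i j| ≤ D) (i : Fin n) :
    ∑ t, ‖looTerm m E P i t‖ ^ 2 ≤ (numPairs n / (2 * m)) ^ 2 * D ^ 2 * P.trace := by
  refine (sum_norm_sub_mean_sq_le _ _ (sum_scaledMulVec_eq hn E P i _)).trans ?_
  have h1 : ∀ t : {α // Touches i α},
      ‖scaledMulVec (-(1 / 2) * (numPairs n / m)) P (edm E t.1.1.1 t.1.1.2 • edgeMat t.1 i)‖ ^ 2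
      ≤ (numPairs n / (2 * m)) ^ 2 * D ^ 2 * vnorm (P *ᵥ edgeMat t.1 i) ^ 2 := by
    intro t
    rw [norm_scaledMulVec, Matrix.mulVec_smul, vnorm_smul, mul_pow, mul_pow, sq_abs, sq_abs,
      ← mul_assoc]
    refine mul_le_mul_of_nonneg_right ?_ (sq_nonneg _)
    have e : (-(1 / 2) * (numPairs n / m)) ^ 2 = (numPairs n / (2 * m)) ^ 2 := by ring
    rw [e]
    exact mul_le_mul_of_nonneg_left (sq_le_sq' (abs_le.1 (hD _ _)).1 (abs_le.1 (hD _ _)).2)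
      (sq_nonneg _)
  refine (Finset.sum_le_sum fun t _ => h1 t).trans ?_
  rw [← Finset.mul_sum, sum_touches i (fun α => vnorm (P *ᵥ edgeMat α i) ^ 2)
    fun α hα => by rw [edgeMat_row_eq_zero hα]; simp]
  exact mul_le_mul_of_nonneg_left (sum_vnorm_mulVec_edgeMat_row_sq_le hP i) (by positivity)

/-- Given which draws hit `i`, the row has two sources of randomness: the other endpoints, which
give a centred sum, and the number of hits, whose deviation from `2 * m / n` multiplies the
deterministic row of squared distances. -/
theorem vnorm_mulVec_noise_row_le (hn : 3 ≤ n) (hm : 0 < m) (E P : Matrix (Fin n) (Fin n) ℝ)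
    (i : Fin n) (ω : Fin m → PairIdx n) (t : Fin m → {α // Touches i α}) :
    vnorm (P *ᵥ noise (resample (Touches i) ω t) E i)
      ≤ ‖∑ k, if Touches i (ω k) then looTerm m E P i (t k) else 0‖
        + n / (4 * m) * |touchCount i ω - 2 * m / n| * vnorm (P *ᵥ edm E i) := by
  have hn3 : (3 : ℝ) ≤ n := by exact_mod_cast hn
  have hm' : (0 : ℝ) < m := by exact_mod_cast hm
  have hn1 : (n : ℝ) - 1 ≠ 0 := by linarith
  set c : ℝ := -(1 / 2) * (numPairs n / m) with hc
  have e1 : (∑ k, if Touches i (ω k) then looTerm m E P i (t k) else 0)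
      = scaledMulVec c P (∑ k, edm E (resample (Touches i) ω t k).1.1
          (resample (Touches i) ω t k).1.2 • edgeMat (resample (Touches i) ω t k) i)
        - touchCount i ω • scaledMulVec c P ((1 / ((n : ℝ) - 1)) • edm E i) := by
    rw [map_sum, touchCount, Finset.sum_smul, ← Finset.sum_sub_distrib]
    refine Finset.sum_congr rfl fun k _ => ?_
    by_cases hk : Touches i (ω k)
    · rw [if_pos hk, if_pos hk, one_smul, resample, if_pos hk, looTerm]
    · rw [if_neg hk, if_neg hk, zero_smul, resample, if_neg hk, edgeMat_row_eq_zero hk, smul_zero,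
        map_zero, sub_zero]
  have e2 : (WithLp.toLp 2 (P *ᵥ noise (resample (Touches i) ω t) E i) : EuclideanSpace ℝ (Fin n))
      = (∑ k, if Touches i (ω k) then looTerm m E P i (t k) else 0)
        + scaledMulVec (-(n / (4 * m)) * (touchCount i ω - 2 * m / n)) P (edm E i) := by
    rw [e1, noise_row hm]
    set S := ∑ k, edm E (resample (Touches i) ω t k).1.1
          (resample (Touches i) ω t k).1.2 • edgeMat (resample (Touches i) ω t k) i
    have f : ∀ (a : ℝ) (x : Fin n → ℝ), scaledMulVec a P x = WithLp.toLp 2 (a • P *ᵥ x) :=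
      fun _ _ => rfl
    simp only [f, Matrix.mulVec_smul, Matrix.mulVec_sub]
    rw [← WithLp.toLp_smul, ← WithLp.toLp_sub, ← WithLp.toLp_add]
    congr 1
    ext j
    simp only [Pi.smul_apply, Pi.sub_apply, Pi.add_apply, smul_eq_mul, hc, numPairs]
    field_simp
    ring
  rw [vnorm, e2]
  refine (norm_add_le _ _).trans (add_le_add le_rfl (le_of_eq ?_))
  rw [norm_scaledMulVec, abs_mul, abs_neg, abs_of_nonneg (by positivity)]

end LooTerm

namespace SamplingRegime

variable {n r m : ℕ} {X : Matrix (Fin n) (Fin n) ℝ} {U : Matrix (Fin n) (Fin r) ℝ}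
    {d : Fin r → ℝ} {σ κ B τ l : ℝ}

theorem card_entry_le' (h : SamplingRegime n r m X U d σ κ B τ l) :
    777000 * (n * B) ^ 2 * n * l * r ≤ m * σ ^ 2 := by
  refine le_trans ?_ h.card_entry_le
  have h1 : (1 : ℝ) ≤ κ ^ 4 := one_le_pow₀ h.one_le_kappa
  have h2 : 0 ≤ (n * B) ^ 2 * n * l * r := by
    have := h.n_pos
    have := h.one_le_l
    positivity
  nlinarith

open scoped Classical in
-- Scalar Bernstein for a relative deviation `φ = σ / (80 * (n * B))` of a count with mean `2 * m /
-- n`. The choice `θ = φ / 2` gives the exponent `-φ² m / (2n)`, and `777000 / 12800 > 60`.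
theorem card_touchCount_le (h : SamplingRegime n r m X U d σ κ B τ l) (i : Fin n) :
    ((Finset.univ.filter fun ω : Fin m → PairIdx n =>
      σ / (80 * (n * B)) * (2 * m / n) ≤ |touchCount i ω - 2 * m / n|).card : ℝ)
      ≤ 2 * Real.exp (-(60 * l)) * Fintype.card (PairIdx n) ^ m := by
  have hσ := h.sigma_pos
  have hl : 0 < l := one_pos.trans_le h.one_le_l
  have hB := h.B_pos
  have hn := h.n_pos
  have hn3 := h.three_le'
  have hm := h.m_pos
  have hL := numPairs_pos h.three_le
  have hM := h.card_entry_le'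
  have hLn : numPairs n * (2 / n) = n - 1 := by
    rw [numPairs]
    field_simp
  have hsum : ∑ α : PairIdx n, (if Touches i α then (1 : ℝ) else 0) = n - 1 := by
    rw [← card_touches i, ← sum_touches i (fun α => if Touches i α then (1 : ℝ) else 0)
      fun α hα => by rw [if_neg hα], Finset.sum_congr rfl fun t _ => if_pos t.2]
    simp
  have hmean : ∑ α : PairIdx n, (if Touches i α then (1 : ℝ) else 0)
      = (Fintype.card (PairIdx n) : ℝ) • (2 / n : ℝ) := by
    rw [hsum, card_pairIdx, smul_eq_mul, hLn]
  set φ := σ / (80 * (n * B)) with hφ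
  have hφ1 : φ ≤ 1 := by
    refine div_le_one_of_le₀ ?_ (by positivity)
    have := h.sigma_le_nB
    nlinarith
  have hφ0 : 0 < φ := by positivity
  have key := card_norm_sum_ge_le (m := m)
    (fun _ (α : PairIdx n) => (if Touches i α then (1 : ℝ) else 0) - 2 / n)
    (fun _ => by
      rw [Finset.sum_sub_distrib, hmean, Finset.sum_const, Finset.card_univ, nsmul_eq_mul,
        smul_eq_mul, sub_self])
    (θ := φ / 2) (by positivity)
    (fun _ α => by
      have h1 : (2 : ℝ) / n ≤ 1 := by rw [div_le_one hn]; linarith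
      have h2 : 0 < (2 : ℝ) / n := by positivity
      have h3 : ‖(if Touches i α then (1 : ℝ) else 0) - 2 / n‖ ≤ 1 := by
        rw [Real.norm_eq_abs, abs_le]
        split_ifs <;> constructor <;> linarith
      have := mul_le_mul (show φ / 2 ≤ 1 by linarith) h3 (norm_nonneg _) zero_le_one
      linarith)
    (fun _ => 2 / n)
    (fun _ => by
      refine (sum_norm_sub_mean_sq_le _ _ hmean).trans ?_
      rw [card_pairIdx, hLn, ← hsum]
      refine Finset.sum_le_sum fun α _ => ?_
      split_ifs <;> simp)
    (φ * (2 * m / n))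
  have e : ∀ ω : Fin m → PairIdx n,
      ‖∑ k, ((if Touches i (ω k) then (1 : ℝ) else 0) - 2 / n)‖
        = |touchCount i ω - 2 * m / n| := by
    intro ω
    rw [Finset.sum_sub_distrib, Real.norm_eq_abs, touchCount]
    simp
    ring_nf
  simp only [e] at key
  refine key.trans ?_
  refine mul_le_mul_of_nonneg_right ?_ (by positivity)
  refine mul_le_mul_of_nonneg_left (Real.exp_le_exp.2 ?_) (by norm_num)
  have e1 : -(φ / 2 * (φ * (2 * m / n))) + (φ / 2) ^ 2 * ∑ _k : Fin m, (2 / n : ℝ)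
      = -(1 / 12800 * ((m * σ ^ 2) / ((n * B) ^ 2 * n))) := by
    rw [hφ]
    simp only [Finset.sum_const, Finset.card_univ, Fintype.card_fin, nsmul_eq_mul]
    field_simp
    ring
  rw [e1, neg_le_neg_iff]
  have e2 : 777000 * l ≤ (m * σ ^ 2) / ((n * B) ^ 2 * n) := by
    rw [le_div_iff₀ (by positivity)]
    refine le_trans ?_ hM
    have h1 : 0 ≤ 777000 * l * ((n * B) ^ 2 * n) := by positivity
    have h2 := mul_le_mul_of_nonneg_left h.one_le_r h1
    linarith
  linarith

theorem vnorm_row_le_of_entry_le {D : ℝ} {M : Matrix (Fin n) (Fin n) ℝ} (hD0 : 0 ≤ D)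
    (hM : ∀ i j, |M i j| ≤ D) (i : Fin n) : vnorm (M i) ≤ D * Real.sqrt n := by
  refine le_of_sq_le_sq ?_ (by positivity)
  rw [vnorm_sq, mul_pow, Real.sq_sqrt (Nat.cast_nonneg n)]
  refine (Finset.sum_le_sum fun j _ =>
    sq_le_sq' (abs_le.1 (hM i j)).1 (abs_le.1 (hM i j)).2).trans (le_of_eq ?_)
  simp
  ring

open scoped Classical in
-- Vector Bernstein over the resampled edges, with `P` fixed. Including `rowMax P` in the threshold
-- makes the uniform bound on the summands harmless without prior control of the rows of `P`. The
-- choice of `θ` gains `10 * l`, and the variance costs less than `l`.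
theorem card_looTerm_le (h : SamplingRegime n r m X U d σ κ B τ l) (i : Fin n)
    {P : Matrix (Fin n) (Fin n) ℝ} (hP : IsOrthProj P) (hPtr : P.trace ≤ r)
    (ω : Fin m → PairIdx n) (hcount : touchCount i ω ≤ 4 * m / n) :
    ((Finset.univ.filter fun t : Fin m → {α // Touches i α} => σ / 40 * (τ + rowMax P)
      ≤ ‖∑ k, if Touches i (ω k) then looTerm m X P i (t k) else 0‖).card : ℝ)
      ≤ 2 * Real.exp (-(9 * l)) * Fintype.card {α // Touches i α} ^ m := by
  have hσ := h.sigma_pos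
  have hl : 0 < l := one_pos.trans_le h.one_le_l
  have hB := h.B_pos
  have hn := h.n_pos
  have hn3 := h.three_le'
  have hm := h.m_pos
  have hτ := h.tau_pos
  have hL := numPairs_pos h.three_le
  have hM := h.card_entry_le'
  have hr0 : (0 : ℝ) < r := one_pos.trans_le h.one_le_r
  have hn1 : (0 : ℝ) < n - 1 := by linarith
  have hρ0 := rowMax_nonneg P
  generalize hρ : rowMax P = ρ at *
  have hs : 0 < τ + ρ := by linarith
  have key := card_norm_sum_ge_le (m := m)
    (fun k (t : {α // Touches i α}) => if Touches i (ω k) then looTerm m X P i t else 0)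
    (fun k => by
      split_ifs
      · exact sum_looTerm h.three_le X P i
      · simp)
    (θ := 400 * l / (σ * (τ + ρ))) (by positivity)
    (fun k t => by
      have h1 : ‖if Touches i (ω k) then looTerm m X P i t else 0‖ ≤ 2 * n ^ 2 * B * ρ / m := by
        split_ifs
        · refine (norm_looTerm_le h.three_le hP (by positivity) h.abs_edm_le i t).trans ?_
          rw [hρ, div_mul_eq_mul_div]
          refine div_le_div_of_nonneg_right ?_ hm.le
          have := mul_le_mul_of_nonneg_right (numPairs_le n)
            (show (0 : ℝ) ≤ 4 * B * ρ by positivity)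
          linarith
        · rw [norm_zero]
          positivity
      refine (mul_le_mul_of_nonneg_left h1 (by positivity)).trans ?_
      have e : 400 * l / (σ * (τ + ρ)) * (2 * n ^ 2 * B * ρ / m)
          = 800 / 777000 * (ρ / (τ + ρ)) * (σ / (n * B)) * ((777000 * (n * B) ^ 2 * n * l)
            / (m * σ ^ 2)) := by
        field_simp
        ring
      have f1 : ρ / (τ + ρ) ≤ 1 := div_le_one_of_le₀ (by linarith) (by positivity)
      have f2 : σ / (n * B) ≤ 1 := div_le_one_of_le₀ h.sigma_le_nB (by positivity)
      have f3 : (777000 * (n * B) ^ 2 * n * l) / (m * σ ^ 2) ≤ 1 := by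
        refine div_le_one_of_le₀ (le_trans ?_ hM) (by positivity)
        exact le_mul_of_one_le_right (by positivity) h.one_le_r
      rw [e]
      calc _ ≤ (800 / 777000 : ℝ) * 1 * 1 * 1 := by gcongr
        _ ≤ 1 := by norm_num)
    (fun k => (if Touches i (ω k) then 1 else 0)
      * (4 * numPairs n ^ 2 * B ^ 2 * r / (m ^ 2 * ((n : ℝ) - 1))))
    (fun k => by
      split_ifs
      · refine (sum_norm_looTerm_sq_le h.three_le hP h.abs_edm_le i).trans ?_
        rw [card_touches]
        refine (mul_le_mul_of_nonneg_left hPtr (by positivity)).trans (le_of_eq ?_)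
        field_simp
        norm_num
      · simp)
    (σ / 40 * (τ + ρ))
  refine key.trans (mul_le_mul_of_nonneg_right ?_ (by positivity))
  refine mul_le_mul_of_nonneg_left (Real.exp_le_exp.2 ?_) (by norm_num)
  rw [← Finset.sum_mul]
  have e1 : 400 * l / (σ * (τ + ρ)) * (σ / 40 * (τ + ρ)) = 10 * l := by
    field_simp
    norm_num
  have e2 : (400 * l / (σ * (τ + ρ))) ^ 2 * (touchCount i ω *
      (4 * numPairs n ^ 2 * B ^ 2 * r / (m ^ 2 * ((n : ℝ) - 1))))
      ≤ l * (4 * 400 ^ 2 / 777000) := by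
    have c1 : (400 * l / (σ * (τ + ρ))) ^ 2 * (touchCount i ω *
        (4 * numPairs n ^ 2 * B ^ 2 * r / (m ^ 2 * ((n : ℝ) - 1))))
        ≤ (400 * l / (σ * (τ + ρ))) ^ 2 * (4 * m / n *
        (4 * numPairs n ^ 2 * B ^ 2 * r / (m ^ 2 * ((n : ℝ) - 1)))) := by
      refine mul_le_mul_of_nonneg_left ?_ (by positivity)
      exact mul_le_mul_of_nonneg_right hcount (by positivity)
    have c2 : (400 * l / (σ * (τ + ρ))) ^ 2 * (4 * m / n *
        (4 * numPairs n ^ 2 * B ^ 2 * r / (m ^ 2 * ((n : ℝ) - 1))))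
        = l * (4 * 400 ^ 2 / 777000) * ((777000 * (n * B) ^ 2 * n * l * r) / (m * σ ^ 2))
          * (1 / (n * (τ + ρ) ^ 2)) * ((n - 1) / n) := by
      rw [numPairs]
      field_simp
      norm_num
    have f1 : (777000 * (n * B) ^ 2 * n * l * r) / (m * σ ^ 2) ≤ 1 :=
      div_le_one_of_le₀ hM (by positivity)
    have f2 : 1 / (n * (τ + ρ) ^ 2) ≤ 1 := by
      refine div_le_one_of_le₀ (h.one_le_ntau.trans ?_) (by positivity)
      gcongr
      linarith
    have f3 : ((n : ℝ) - 1) / n ≤ 1 := div_le_one_of_le₀ (by linarith) hn.le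
    have f3' : 0 ≤ ((n : ℝ) - 1) / n := by positivity
    refine c1.trans ?_
    rw [c2]
    calc _ ≤ l * (4 * 400 ^ 2 / 777000) * 1 * 1 * 1 := by gcongr
      _ = _ := by ring
  have e3 : ∑ k, (if Touches i (ω k) then (1 : ℝ) else 0) = touchCount i ω := rfl
  rw [e1, e3]
  linarith

/-- The number of edges at `i` is typical, but the `i`-th row of the noise is large on the
leave-one-out eigenspace. -/
def LooFails (r : ℕ) (X : Matrix (Fin n) (Fin n) ℝ) (σ B τ : ℝ) (i : Fin n)
    (ω : Fin m → PairIdx n) : Prop :=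
  |touchCount i ω - 2 * m / n| < σ / (80 * (n * B)) * (2 * m / n) ∧
    σ / 20 * (τ + rowMax (topProj r (loo X (noise ω X) i) (σ - σ / 364) (σ / 364)))
      < vnorm (topProj r (loo X (noise ω X) i) (σ - σ / 364) (σ / 364) *ᵥ noise ω X i)

open scoped Classical in
theorem card_loo_le (h : SamplingRegime n r m X U d σ κ B τ l) (i : Fin n) :
    ((Finset.univ.filter fun ω : Fin m → PairIdx n => LooFails r X σ B τ i ω).card : ℝ)
      ≤ 2 * Real.exp (-(9 * l)) * Fintype.card (PairIdx n) ^ m := by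
  have hσ := h.sigma_pos
  have hB := h.B_pos
  have hn := h.n_pos
  have hn3 := h.three_le'
  have hm := h.m_pos
  have hτ := h.tau_pos
  have hTc := card_touches i
  refine card_filter_le_of_resample (Touches i) _ ?_ fun ω => ?_
  · have : (0 : ℝ) < Fintype.card {α // Touches i α} := by rw [hTc]; linarith
    exact_mod_cast this
  -- Resampling preserves the count at `i`; if it is atypical, the event is empty for all `t`.
  by_cases hcount : |touchCount i ω - 2 * m / n| < σ / (80 * (n * B)) * (2 * m / n)
  swap
  · rw [Finset.filter_false_of_mem fun t _ hc => by
      have := hc.1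
      rw [touchCount_resample] at this
      exact hcount this]
    rw [Finset.card_empty, Nat.cast_zero]
    positivity
  have hloo : ∀ t : Fin m → {α // Touches i α},
      loo X (noise (resample (Touches i) ω t) X) i = loo X (noise ω X) i := fun t => by
    rw [loo, dropCoord_conj_noise_resample, loo]
  simp only [LooFails, hloo]
  have hPp := isOrthProj_topProj r (loo X (noise ω X) i) (σ - σ / 364) (σ / 364)
  have hPtr : (topProj r (loo X (noise ω X) i) (σ - σ / 364) (σ / 364)).trace ≤ r := by
    by_cases hex : ∃ P Q, TopSplit r (loo X (noise ω X) i) P Q (σ - σ / 364) (σ / 364)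
    · obtain ⟨Q, hQ⟩ := exists_topSplit_topProj hex
      exact hQ.trace_eq.le
    · rw [topProj, dif_neg hex]
      simp
  generalize topProj r (loo X (noise ω X) i) (σ - σ / 364) (σ / 364) = P at hPp hPtr ⊢
  have hρ0 := rowMax_nonneg P
  have hcount' : touchCount i ω ≤ 4 * m / n := by
    have h1 := (abs_lt.1 hcount).2
    have h2 : σ / (80 * (n * B)) * (2 * m / n) ≤ 1 * (2 * m / n) := by
      refine mul_le_mul_of_nonneg_right ?_ (by positivity)
      refine div_le_one_of_le₀ ?_ (by positivity)
      have := h.sigma_le_nB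
      nlinarith
    have e : 4 * (m : ℝ) / n = 2 * m / n + 2 * m / n := by ring
    linarith
  refine le_trans (Nat.cast_le.2 (Finset.card_le_card fun t ht => ?_))
    (h.card_looTerm_le i hPp hPtr ω hcount')
  rw [Finset.mem_filter] at ht ⊢
  refine ⟨Finset.mem_univ _, ?_⟩
  have h1 := vnorm_mulVec_noise_row_le h.three_le (by exact_mod_cast hm) X P i ω t
  have h2 : vnorm (P *ᵥ edm X i) ≤ 4 * B * Real.sqrt n :=
    (vnorm_mulVec_le _ _).trans ((mul_le_of_le_one_left (vnorm_nonneg _) hPp.norm_le).trans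
      (vnorm_row_le_of_entry_le (by positivity) h.abs_edm_le i))
  have h3 : n / (4 * m) * |touchCount i ω - 2 * m / n| * vnorm (P *ᵥ edm X i)
      ≤ n / (4 * m) * (σ / (80 * (n * B)) * (2 * m / n)) * (4 * B * Real.sqrt n) := by
    gcongr
    exact vnorm_nonneg _
  -- The tolerance for the count is chosen so that its fluctuation costs `σ / (40 * √n)`, at most
  -- half of the allowed `σ * τ / 20`.
  have h4 : n / (4 * m) * (σ / (80 * (n * B)) * (2 * m / n)) * (4 * B * Real.sqrt n)
      = σ / 40 * (1 / Real.sqrt n) := by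
    have hs : Real.sqrt n ≠ 0 := (Real.sqrt_pos.2 hn).ne'
    have hs2 : Real.sqrt n ^ 2 = n := Real.sq_sqrt hn.le
    field_simp
    rw [hs2]
    ring
  have h5 := mul_le_mul_of_nonneg_left h.inv_sqrt_le (show 0 ≤ σ / 40 by positivity)
  have h6 := ht.2.2
  have h7 : 0 ≤ σ * rowMax P := by positivity
  linarith

end SamplingRegime

/-! ### Success probability of the initialization -/

namespace SamplingRegime

variable {n r m : ℕ} {X : Matrix (Fin n) (Fin n) ℝ} {U : Matrix (Fin n) (Fin r) ℝ}
    {d : Fin r → ℝ} {σ κ B τ l : ℝ}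

/-- The spectral initialization has a unique value, which is a good iterate. -/
def InitGood (r : ℕ) (X : Matrix (Fin n) (Fin n) ℝ) (τ δ : ℝ) (ω : Fin m → PairIdx n) : Prop :=
  DeterminesGood (IsHardThreshold r ((numPairs n / m) • sampleOp ω X)) (GoodIterate r X τ δ)

open scoped Classical in
-- Union bound: `3 / 2 * n` for the operator norm, and for each of the `n` vertices `1 / 4` for the
-- edge count and `1 / 4` for the leave-one-out row, all in units of `exp (-l)`.
theorem card_not_initGood_le (h : SamplingRegime n r m X U d σ κ B τ l) :
    ((Finset.univ.filter fun ω : Fin m → PairIdx n =>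
      ¬ InitGood r X τ (σ / (256 * κ ^ 2)) ω).card : ℝ)
      ≤ 2 * n * Real.exp (-l) * Fintype.card (PairIdx n) ^ m := by
  have hm : 0 < m := by exact_mod_cast h.m_pos
  set b₁ := Finset.univ.filter fun ω : Fin m → PairIdx n =>
    σ / (364 * (κ ^ 2 * Real.sqrt r)) ≤ ‖noise ω X‖ with hb₁
  set b₂ : Fin n → Finset (Fin m → PairIdx n) := fun i => Finset.univ.filter fun ω =>
    σ / (80 * (n * B)) * (2 * m / n) ≤ |touchCount i ω - 2 * m / n| with hb₂
  set b₃ : Fin n → Finset (Fin m → PairIdx n) := fun i => Finset.univ.filter fun ω =>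
    LooFails r X σ B τ i ω with hb₃
  have hsub : (Finset.univ.filter fun ω : Fin m → PairIdx n =>
      ¬ InitGood r X τ (σ / (256 * κ ^ 2)) ω) ⊆ b₁ ∪ Finset.univ.biUnion fun i => b₂ i ∪ b₃ i := by
    intro ω hω
    by_contra hc
    simp only [hb₁, hb₂, hb₃, Finset.mem_union, Finset.mem_biUnion, Finset.mem_filter,
      Finset.mem_univ, true_and, not_or, not_exists, not_le] at hc
    rw [Finset.mem_filter] at hω
    have e : (numPairs n / m) • sampleOp ω X = X + centering n * noise ω X * centering n := by
      rw [← sampleOp_sub_eq hm ω h.symm h.mulVec_one, add_sub_cancel]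
    refine hω.2 ?_
    rw [InitGood, e]
    refine ⟨exists_hardThreshold ?_ r, fun H hH => ?_, fun H H' hH hH' => ?_⟩
    · rw [Matrix.transpose_add, h.symm, centering_conj_transpose (noise_transpose ω X)]
    · refine h.goodIterate_init (noise_transpose ω X) hc.1.le (fun i => ?_) hH
      by_contra hi
      exact (hc.2 i).2 ⟨(hc.2 i).1, not_le.1 hi⟩
    · refine hardThreshold_unique h.eig h.rank_le_card ?_ h.sigma_le ?_ hH hH'
        (η := σ / (364 * (κ ^ 2 * Real.sqrt r)))
      · have h1 : 1 ≤ κ ^ 2 * Real.sqrt r := one_le_mul_of_one_le_of_one_le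
          (one_le_pow₀ h.one_le_kappa) (Real.one_le_sqrt.2 h.one_le_r)
        have h2 : σ / (364 * (κ ^ 2 * Real.sqrt r)) ≤ σ / 364 :=
          div_le_div_of_nonneg_left h.sigma_pos.le (by norm_num) (by linarith)
        have := h.sigma_pos
        linarith
      · rw [add_sub_cancel_left]
        exact (norm_centering_conj_le _).trans hc.1.le
  have h1 : (b₁.card : ℝ) ≤ _ := h.card_norm_noise_ge_le
  have h2 : ∀ i, ((b₂ i).card : ℝ) ≤ _ := h.card_touchCount_le
  have h3 : ∀ i, ((b₃ i).card : ℝ) ≤ _ := h.card_loo_le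
  have h4 : ((Finset.univ.filter fun ω : Fin m → PairIdx n =>
      ¬ InitGood r X τ (σ / (256 * κ ^ 2)) ω).card : ℝ)
      ≤ b₁.card + ∑ i, (((b₂ i).card : ℝ) + (b₃ i).card) := by
    have := (Finset.card_le_card hsub).trans ((Finset.card_union_le _ _).trans
      (add_le_add le_rfl (Finset.card_biUnion_le.trans
        (Finset.sum_le_sum fun i _ => Finset.card_union_le _ _))))
    exact_mod_cast this
  have hexp : ∀ c : ℝ, 9 ≤ c → 2 * Real.exp (-(c * l)) ≤ 1 / 4 * Real.exp (-l) := by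
    intro c hc
    have hl := h.one_le_l
    have e1 : Real.exp (-(c * l)) ≤ Real.exp (-8 + -l) := Real.exp_le_exp.2 (by nlinarith)
    have e2 : Real.exp (-8) ≤ 1 / 8 := by
      rw [Real.exp_neg]
      refine (inv_anti₀ (by norm_num) (Real.add_one_le_exp (8 : ℝ))).trans (by norm_num)
    rw [Real.exp_add] at e1
    have e3 := mul_le_mul_of_nonneg_right e2 (Real.exp_pos (-l)).le
    linarith
  have hA : (0 : ℝ) ≤ (Fintype.card (PairIdx n) : ℝ) ^ m := by positivity
  have h5 : ∀ i, ((b₂ i).card : ℝ) + (b₃ i).card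
      ≤ 1 / 2 * Real.exp (-l) * Fintype.card (PairIdx n) ^ m := by
    intro i
    have k2 := (h2 i).trans (mul_le_mul_of_nonneg_right (hexp 60 (by norm_num)) hA)
    have k3 := (h3 i).trans (mul_le_mul_of_nonneg_right (hexp 9 le_rfl) hA)
    linarith
  have h6 := Finset.sum_le_sum fun i (_ : i ∈ Finset.univ) => h5 i
  rw [Finset.sum_const, Finset.card_univ, Fintype.card_fin, nsmul_eq_mul] at h6
  linarith

end SamplingRegime

/-! ### One step of the iteration: deterministic part -/

/-- The tangent space projection, in terms of the projection onto the column space. -/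
def tangent {n : ℕ} (P M : Matrix (Fin n) (Fin n) ℝ) : Matrix (Fin n) (Fin n) ℝ :=
  P * M + M * P - P * M * P

theorem projT_eq_tangent {n r : ℕ} (U : Matrix (Fin n) (Fin r) ℝ) (M : Matrix (Fin n) (Fin n) ℝ) :
    projT U M = tangent (U * Uᵀ) M := rfl

/-- `P` is the projection onto the column space of an incoherent iterate `Z` near `X`. -/
structure IterateProj {n : ℕ} (r : ℕ) (X : Matrix (Fin n) (Fin n) ℝ) (τ δ : ℝ)
    (Z P : Matrix (Fin n) (Fin n) ℝ) : Prop where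
  symm : Zᵀ = Z
  mulVec_one : Z *ᵥ (fun _ => (1 : ℝ)) = 0
  proj : IsOrthProj P
  trace_eq : P.trace = r
  proj_mul : P * Z = Z
  exists_inv : ∃ Q, Z * Q = P
  row_le : ∀ i, vnorm (P i) ≤ τ
  frob_le : frobNorm (X - Z) ≤ δ

theorem IsThinEig.proj_mul {n r : ℕ} {Z : Matrix (Fin n) (Fin n) ℝ} {U : Matrix (Fin n) (Fin r) ℝ}
    {d : Fin r → ℝ} (h : IsThinEig Z U d) : U * Uᵀ * Z = Z := by
  obtain ⟨hU, rfl⟩ := h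
  calc U * Uᵀ * (U * Matrix.diagonal d * Uᵀ) = U * (Uᵀ * U) * Matrix.diagonal d * Uᵀ := by
        simp only [Matrix.mul_assoc]
    _ = U * Matrix.diagonal d * Uᵀ := by rw [hU, Matrix.mul_one]

theorem IsThinEig.trace_proj {n r : ℕ} {Z : Matrix (Fin n) (Fin n) ℝ}
    {U : Matrix (Fin n) (Fin r) ℝ} {d : Fin r → ℝ} (h : IsThinEig Z U d) : (U * Uᵀ).trace = r := by
  rw [Matrix.trace_mul_comm, h.1, Matrix.trace_one, Fintype.card_fin]

theorem GoodIterate.exists_iterateProj {n r : ℕ} {X Z : Matrix (Fin n) (Fin n) ℝ} {τ δ : ℝ}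
    (h : GoodIterate r X τ δ Z) : ∃ P, IterateProj r X τ δ Z P := by
  obtain ⟨U, d, Q, hU, hQ, hrow⟩ := h.exists_eig
  refine ⟨U * Uᵀ, h.symm, h.mulVec_one, isOrthProj_mul_transpose hU.1, hU.trace_proj, hU.proj_mul,
    ⟨Q, hQ⟩, hrow, ?_⟩
  rw [← frobNorm_neg, neg_sub]
  exact h.frob_le

theorem rowNorm_eq {n r : ℕ} {U : Matrix (Fin n) (Fin r) ℝ} (hU : Uᵀ * U = 1) (i : Fin n) :
    rowNorm U i = vnorm ((U * Uᵀ) i) := by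
  have h0 : 0 ≤ rowNorm U i := Real.sqrt_nonneg _
  rw [← sq_eq_sq₀ h0 (vnorm_nonneg _), (isOrthProj_mul_transpose hU).row_sq,
    rowNorm, Real.sq_sqrt (Finset.sum_nonneg fun k _ => sq_nonneg _)]
  simp [Matrix.mul_apply, pow_two]

theorem trimRows_eq_self {n r : ℕ} {ν : ℝ} {U : Matrix (Fin n) (Fin r) ℝ}
    (h : ∀ i, rowNorm U i ≤ Real.sqrt (ν * r / n)) : trimRows ν U = U := by
  ext i k
  simp only [trimRows, Matrix.of_apply]
  rw [min_eq_left (h i)]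
  by_cases h0 : rowNorm U i = 0
  · have h1 : ∑ k, U i k ^ 2 = 0 := by
      rwa [rowNorm, Real.sqrt_eq_zero (Finset.sum_nonneg fun k _ => sq_nonneg _)] at h0
    have h2 := (Finset.sum_eq_zero_iff_of_nonneg fun k _ => sq_nonneg (U i k)).1 h1 k
      (Finset.mem_univ k)
    rw [h0, mul_zero, pow_eq_zero_iff two_ne_zero |>.1 h2]
  · rw [div_mul_cancel₀ _ h0]

namespace IterateProj

variable {n r : ℕ} {X Z P : Matrix (Fin n) (Fin n) ℝ} {τ δ : ℝ}

/-- The relation `Z * Q = P` puts the range of `P` inside that of any `U * Uᵀ`, and the traces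
agree. Hence the choice of thin decomposition is irrelevant. -/
theorem eq_proj (h : IterateProj r X τ δ Z P) {U : Matrix (Fin n) (Fin r) ℝ} {d : Fin r → ℝ}
    (hU : IsThinEig Z U d) : U * Uᵀ = P := by
  obtain ⟨Q, hQ⟩ := h.exists_inv
  refine (h.proj.eq_of_trace (isOrthProj_mul_transpose hU.1) ?_ ?_).symm
  · rw [h.trace_eq, hU.trace_proj]
  · rw [← hQ, ← Matrix.mul_assoc, hU.proj_mul]

/-- The row bound kept along the iteration is exactly the trimming threshold, so trimming is
inactive. -/
theorem trim_eq {ν : ℝ} (h : IterateProj r X (Real.sqrt (ν * r / n)) δ Z P)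
    {Zhat : Matrix (Fin n) (Fin n) ℝ} (hZ : IsTrim r ν Z Zhat) : Zhat = Z := by
  obtain ⟨U, d, hU, rfl⟩ := hZ
  rw [trimRows_eq_self fun i => ?_, ← hU.2]
  rw [rowNorm_eq hU.1, h.eq_proj hU]
  exact h.row_le i

theorem centering_mul_proj (h : IterateProj r X τ δ Z P) : centering n * P = P := by
  obtain ⟨Q, hQ⟩ := h.exists_inv
  rw [← hQ, ← Matrix.mul_assoc, centering_mul h.symm h.mulVec_one]

theorem mul_proj (h : IterateProj r X τ δ Z P) : Z * P = Z := by
  have := congrArg Matrix.transpose h.proj_mul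
  rwa [Matrix.transpose_mul, h.symm, h.proj.symm] at this

end IterateProj

/-! ### Algebra of the tangent space projection -/

section Tangent

variable {n : ℕ} {P M : Matrix (Fin n) (Fin n) ℝ}

theorem proj_mul_tangent (hP : IsOrthProj P) : P * tangent P M = P * M := by
  rw [tangent, mul_sub, mul_add, ← Matrix.mul_assoc, ← Matrix.mul_assoc, ← Matrix.mul_assoc,
    ← Matrix.mul_assoc, hP.idem, add_sub_cancel_right]

theorem compl_mul_tangent (hP : IsOrthProj P) : (1 - P) * tangent P M = (1 - P) * M * P := by
  rw [sub_mul, proj_mul_tangent hP, one_mul, tangent, sub_mul, sub_mul, one_mul]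
  abel

/-- The projection is the orthogonal sum of `P * M` and `(1 - P) * M * P`; by symmetry of `M`
neither exceeds `P * M` in Frobenius norm. -/
theorem frobNorm_tangent_le (hP : IsOrthProj P) (hM : Mᵀ = M) {c : ℝ}
    (h : frobNorm (P * M) ^ 2 ≤ c) : frobNorm (tangent P M) ^ 2 ≤ 2 * c := by
  have h1 : frobNorm (M * P) = frobNorm (P * M) := by
    rw [← frobNorm_transpose, Matrix.transpose_mul, hM, hP.symm]
  have h2 : frobNorm ((1 - P) * M * P) ≤ frobNorm (P * M) := by
    rw [Matrix.mul_assoc, ← h1]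
    exact hP.compl.frobNorm_mul_le _
  rw [hP.frobNorm_sq_add, proj_mul_tangent hP, compl_mul_tangent hP]
  have := pow_le_pow_left₀ (frobNorm_nonneg _) h2 2
  linarith

theorem tangent_transpose (hP : IsOrthProj P) (hM : Mᵀ = M) : (tangent P M)ᵀ = tangent P M := by
  simp only [tangent, Matrix.transpose_sub, Matrix.transpose_add, Matrix.transpose_mul, hP.symm, hM,
    Matrix.mul_assoc]
  rw [add_comm]

theorem tangent_eq_sub : tangent P M = M - (1 - P) * M * (1 - P) := by
  rw [tangent]
  noncomm_ring

end Tangent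

theorem tangent_add {n : ℕ} (P M N : Matrix (Fin n) (Fin n) ℝ) :
    tangent P (M + N) = tangent P M + tangent P N := by
  simp only [tangent, mul_add, add_mul]
  abel

namespace SamplingRegime

variable {n r m : ℕ} {X : Matrix (Fin n) (Fin n) ℝ} {U : Matrix (Fin n) (Fin r) ℝ}
    {d : Fin r → ℝ} {σ κ B τ l δ : ℝ} {Z P : Matrix (Fin n) (Fin n) ℝ}

theorem proj_mul (h : SamplingRegime n r m X U d σ κ B τ l) : U * Uᵀ * X = X := h.eig.proj_mul

/-- The curvature term is quadratic: in `X = X * Q * X`, with `Q` the inverse of `X` on its range,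
each outer `X` becomes `X - Z` next to `1 - P`. -/
theorem mul_compl_mul_compl_le (h : SamplingRegime n r m X U d σ κ B τ l)
    (hP : IterateProj r X τ δ Z P) (hδ0 : 0 ≤ δ) :
    frobNorm ((1 - P) * X * (1 - P)) ≤ δ * (δ / σ) := by
  have h1 : (1 - P) * X = (1 - P) * (X - Z) := by
    rw [mul_sub (1 - P) X Z, sub_mul 1 P Z, hP.proj_mul, one_mul, sub_self, sub_zero]
  have h2 : X * (1 - P) = (X - Z) * (1 - P) := by
    rw [sub_mul X Z, mul_sub Z 1 P, hP.mul_proj, mul_one, sub_self, sub_zero]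
  set Q := U * Matrix.diagonal (fun k : Fin r => (d k)⁻¹) * Uᵀ with hQ
  have hT := h.topSplit
  have hXQX : X = X * Q * X := by rw [hT.mul_inv, h.proj_mul]
  have e : (1 - P) * X * (1 - P) = (1 - P) * ((X - Z) * (Q * ((X - Z) * (1 - P)))) := by
    rw [← h2, ← Matrix.mul_assoc (1 - P), ← h1]
    conv_lhs => rw [hXQX]
    simp only [Matrix.mul_assoc]
  rw [e]
  have hE := hP.frob_le
  refine (hP.proj.compl.frobNorm_mul_le _).trans ((frobNorm_mul_le _ _).trans ?_)
  refine mul_le_mul hE ?_ (norm_nonneg _) hδ0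
  calc _ ≤ ‖Q‖ * ‖(X - Z) * (1 - P)‖ := norm_mul_le _ _
    _ ≤ σ⁻¹ * δ := by
        refine mul_le_mul hT.norm_inv ?_ (norm_nonneg _) (inv_nonneg.2 h.sigma_pos.le)
        refine (norm_mul_le _ _).trans ((mul_le_of_le_one_right (norm_nonneg _)
          hP.proj.compl.norm_le).trans ((norm_le_frobNorm _).trans hE))
    _ = δ / σ := by rw [div_eq_inv_mul]

/-- The tangent projection recovers `X - Z` up to its normal component, which equals that of `X`
because `Z` lies in its own tangent space. -/
theorem _root_.IterateProj.step_sub_eq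
    (hP : IterateProj r X τ δ Z P) (G : Matrix (Fin n) (Fin n) ℝ) :
    Z + tangent P (X - Z + G) - X = tangent P G - (1 - P) * X * (1 - P) := by
  have hZc : (1 - P) * (X - Z) * (1 - P) = (1 - P) * X * (1 - P) := by
    rw [mul_sub (1 - P) X Z, sub_mul 1 P Z, hP.proj_mul, one_mul, sub_self, sub_zero]
  rw [tangent_add, tangent_eq_sub (M := X - Z), hZc]
  abel

theorem frobNorm_step_sub_le (h : SamplingRegime n r m X U d σ κ B τ l)
    (hP : IterateProj r X τ δ Z P) (hδ0 : 0 ≤ δ) (hδ : δ ≤ σ / 256) {G : Matrix (Fin n) (Fin n) ℝ}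
    (hT : frobNorm (tangent P G) ≤ δ / 4) :
    frobNorm (Z + tangent P (X - Z + G) - X) ≤ 65 / 256 * δ := by
  have hσ := h.sigma_pos
  have hsecond : frobNorm ((1 - P) * X * (1 - P)) ≤ δ / 256 := by
    refine (h.mul_compl_mul_compl_le hP hδ0).trans ?_
    rw [div_eq_mul_one_div δ 256]
    refine mul_le_mul_of_nonneg_left ?_ hδ0
    rw [div_le_iff₀ hσ]
    linarith
  rw [hP.step_sub_eq]
  have := (frobNorm_sub_le _ _).trans (add_le_add hT hsecond)
  linarith

/-- One step of the iteration contracts the error and preserves incoherence as soon as the noise is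
small on the tangent space. -/
theorem goodIterate_step (h : SamplingRegime n r m X U d σ κ B τ l)
    (hP : IterateProj r X τ δ Z P) (hδ0 : 0 ≤ δ) (hδ : δ ≤ σ / 256)
    {G H : Matrix (Fin n) (Fin n) ℝ} (hG : Gᵀ = G) (hG1 : G *ᵥ (fun _ => (1 : ℝ)) = 0)
    (hT : frobNorm (tangent P G) ≤ δ / 4) (hrow : ∀ k, vnorm (P *ᵥ G k) ≤ σ * τ / 10)
    (hH : IsHardThreshold r (Z + tangent P (X - Z + G)) H) : GoodIterate r X τ (5 / 6 * δ) H := by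
  have hσ := h.sigma_pos
  have hτ := h.tau_nonneg
  have hJP := hP.centering_mul_proj
  have hEs : (X - Z)ᵀ = X - Z := by rw [Matrix.transpose_sub, h.symm, hP.symm]
  have hP1 : P *ᵥ (fun _ => (1 : ℝ)) = 0 := by
    have : P * centering n = P := by
      have := congrArg Matrix.transpose hJP
      rwa [Matrix.transpose_mul, hP.proj.symm, (isOrthProj_centering n).symm] at this
    rw [← this, ← Matrix.mulVec_mulVec, centering_mulVec_one, Matrix.mulVec_zero]
  set Y := Z + tangent P (X - Z + G) with hY
  have hYs : Yᵀ = Y := by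
    rw [hY, Matrix.transpose_add, hP.symm, tangent_transpose hP.proj]
    rw [Matrix.transpose_add, hEs, hG]
  have hY1 : Y *ᵥ (fun _ => (1 : ℝ)) = 0 := by
    rw [hY, tangent, Matrix.add_mulVec, Matrix.sub_mulVec, Matrix.add_mulVec, hP.mulVec_one,
      ← Matrix.mulVec_mulVec, ← Matrix.mulVec_mulVec, ← Matrix.mulVec_mulVec, hP1,
      Matrix.add_mulVec, Matrix.sub_mulVec, h.mulVec_one, hP.mulVec_one, hG1]
    simp
  have hErr := hP.step_sub_eq G
  have hfrob := h.frobNorm_step_sub_le hP hδ0 hδ hT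
  have hη0 : 0 ≤ 65 / 256 * δ := by positivity
  have hnorm : ‖Y - X‖ ≤ 65 / 256 * δ := (norm_le_frobNorm _).trans hfrob
  have hlt : 65 / 256 * δ < σ := by linarith
  obtain ⟨P', Q', U', d', hsplit, hHP, hHQ, hU', hUP⟩ :=
    hardThreshold_topSplit h.eig h.rank_le_card hlt h.sigma_le hH hnorm
  have hpos : 0 < σ - 65 / 256 * δ := by linarith
  have hratio : σ / (σ - 65 / 256 * δ) ≤ 11 / 10 := by
    rw [div_le_iff₀ hpos]
    linarith
  refine goodIterate_of_topSplit hYs hY1 hsplit hHP hHQ hU' hUP (fun i => ?_) ?_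
  · have k1 := h.topSplit.vnorm_row_le hsplit i
    have hEδ := hP.frob_le
    have hEn : ‖X - Z‖ ≤ δ := (norm_le_frobNorm _).trans hEδ
    have hPc := hP.proj.compl.norm_le
    have hP'n := hsplit.proj.norm_le
    -- The error is regrouped so that every term has controllable rows: a left factor `P` or,
    -- through `f2`, `U * Uᵀ` is incoherent, and the rows of `G * P` are bounded by `hrow`.
    have e : Y - X = P * (tangent P G * (1 - P)) + G * P - X * (1 - P)
        + P * ((X - Z) * (1 - P)) := by
      have f1 : P * ((X - Z) * (1 - P)) = P * X * (1 - P) := by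
        rw [sub_mul, mul_sub Z, hP.mul_proj, mul_one, sub_self, sub_zero, Matrix.mul_assoc]
      rw [hErr, f1, ← Matrix.mul_assoc, proj_mul_tangent hP.proj, tangent]
      noncomm_ring
    have f2 : X * (1 - P) = U * Uᵀ * ((X - Z) * (1 - P)) := by
      rw [sub_mul, mul_sub Z, hP.mul_proj, mul_one, sub_self, sub_zero, ← Matrix.mul_assoc,
        h.proj_mul]
    have g1 : ‖(X - Z) * (1 - P)‖ ≤ δ :=
      (norm_mul_le _ _).trans ((mul_le_of_le_one_right (norm_nonneg _) hPc).trans hEn)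
    have g2 : ‖tangent P G * (1 - P)‖ ≤ δ / 4 :=
      (norm_mul_le _ _).trans ((mul_le_of_le_one_right (norm_nonneg _) hPc).trans
        ((norm_le_frobNorm _).trans hT))
    have r1 : vnorm ((P * (tangent P G * (1 - P))) i) ≤ τ * (δ / 4) :=
      (vnorm_mul_row_le _ _ i).trans (mul_le_mul (hP.row_le i) g2 (norm_nonneg _) hτ)
    have r2 : vnorm ((G * P) i) ≤ σ * τ / 10 := by
      rw [vnorm_mul_proj_row hP.proj]
      exact hrow i
    have r3 : vnorm ((X * (1 - P)) i) ≤ τ / 11 * δ := by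
      rw [f2]
      exact (vnorm_mul_row_le _ _ i).trans
        (mul_le_mul (h.row_le i) g1 (norm_nonneg _) (by positivity))
    have r4 : vnorm ((P * ((X - Z) * (1 - P))) i) ≤ τ * δ :=
      (vnorm_mul_row_le _ _ i).trans (mul_le_mul (hP.row_le i) g1 (norm_nonneg _) hτ)
    have r5 : vnorm ((Y - X) i) ≤ τ * (δ / 4) + σ * τ / 10 + τ / 11 * δ + τ * δ := by
      rw [e]
      exact (vnorm_add_le _ _).trans (add_le_add ((vnorm_sub_le _ _).trans
        (add_le_add ((vnorm_add_le _ _).trans (add_le_add r1 r2)) r3)) r4)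
    have r6 : vnorm (((Y - X) * P') i) ≤ 12 / 100 * (τ * σ) := by
      refine (vnorm_mul_row_le _ _ i).trans ((mul_le_of_le_one_right (vnorm_nonneg _) hP'n).trans
        (r5.trans ?_))
      have := mul_le_mul_of_nonneg_left hδ hτ
      have := mul_nonneg hτ hσ.le
      linarith
    have hinv : (σ - 65 / 256 * δ)⁻¹ ≤ 11 / 10 / σ := by
      rw [le_div_iff₀ hσ, mul_comm, ← div_eq_mul_inv]
      exact hratio
    have r7 : vnorm (((Y - X) * P') i) * (σ - 65 / 256 * δ)⁻¹ ≤ 12 / 100 * (τ * σ) *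
        (11 / 10 / σ) :=
      mul_le_mul r6 hinv (inv_nonneg.2 hpos.le) (by positivity)
    have r8 : 12 / 100 * (τ * σ) * (11 / 10 / σ) = 132 / 1000 * τ := by
      field_simp
      ring
    have r9 : ‖Y - X‖ * (σ - 65 / 256 * δ)⁻¹ ≤ 1 := by
      rw [← div_eq_mul_inv]
      refine div_le_one_of_le₀ (hnorm.trans ?_) hpos.le
      linarith
    have r10 : vnorm ((U * Uᵀ) i) * (1 + ‖Y - X‖ * (σ - 65 / 256 * δ)⁻¹) ≤ τ / 11 * (1 + 1) :=
      mul_le_mul (h.row_le i) (by linarith)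
        (by have := inv_nonneg.2 hpos.le; positivity) (by positivity)
    linarith
  · refine (h.topSplit.frobNorm_sub_le hsplit hη0 hlt).trans ?_
    -- `65 / 256 * (21 / 10)` is about `0.53`, below the claimed rate `5 / 6`.
    have : frobNorm (Y - X) * (1 + σ / (σ - 65 / 256 * δ)) ≤ 65 / 256 * δ * (1 + 11 / 10) :=
      mul_le_mul hfrob (by linarith) (by positivity) hη0
    linarith

end SamplingRegime

/-! ### One step of the iteration: concentration -/

/-- Vector Bernstein for any linear image of the noise, reduced to data of single edges. It serves
both the tangent component and the rows of the noise. -/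
theorem card_map_noise_ge_le {n : ℕ} (hn : 3 ≤ n) {H : Type*} [NormedAddCommGroup H]
    [InnerProductSpace ℝ H] (T : Matrix (Fin n) (Fin n) ℝ →ₗ[ℝ] H) {m : ℕ} (hm : 0 < m)
    (E : Matrix (Fin n) (Fin n) ℝ) {θ R W : ℝ} (hθ : 0 ≤ θ)
    (hR : ∀ α : PairIdx n, ‖T (edm E α.1.1 α.1.2 • edgeMat α)‖ ≤ R)
    (hθR : θ * (numPairs n / m * R) ≤ 1)
    (hW : ∑ α : PairIdx n, ‖T (edm E α.1.1 α.1.2 • edgeMat α)‖ ^ 2 ≤ W) (t : ℝ) :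
    ((Finset.univ.filter fun ω : Fin m → PairIdx n => t ≤ ‖T (noise ω E)‖).card : ℝ)
      ≤ 2 * Real.exp (-(θ * t) + θ ^ 2 * (numPairs n * W / (4 * m)))
        * Fintype.card (PairIdx n) ^ m := by
  have hL := numPairs_pos hn
  have hm' : (0 : ℝ) < m := by exact_mod_cast hm
  set c : ℝ := -(1 / 2) * (numPairs n / m) with hc
  have habs : |c| = numPairs n / (2 * m) := by
    rw [hc, abs_mul, abs_neg, abs_of_pos (by norm_num), abs_of_nonneg (by positivity)]
    ring
  set f : PairIdx n → H := fun α => c • T (edm E α.1.1 α.1.2 • edgeMat α) with hf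
  set b : H := T ((-(1 / 2 : ℝ)) • (1 / (m : ℝ)) • edm E) with hb
  have hterm : ∀ α, T (noiseTerm m E α) = f α - b := by
    intro α
    simp only [noiseTerm, hf, hb, hc, ← map_smul, ← map_sub, smul_sub, smul_smul, mul_assoc]
  have hzero : ∑ α, T (noiseTerm m E α) = 0 := by rw [← map_sum, sum_noiseTerm, map_zero]
  have hcard : (0 : ℝ) < Fintype.card (PairIdx n) := by rwa [card_pairIdx]
  have hsum : ∑ α, f α = (Fintype.card (PairIdx n) : ℝ) • b := by
    simp only [hterm] at hzero
    rw [Finset.sum_sub_distrib, sub_eq_zero, Finset.sum_const, Finset.card_univ,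
      ← Nat.cast_smul_eq_nsmul ℝ] at hzero
    exact hzero
  have hfR : ∀ α, ‖f α‖ ≤ numPairs n / (2 * m) * R := by
    intro α
    rw [hf, norm_smul, Real.norm_eq_abs, habs]
    exact mul_le_mul_of_nonneg_left (hR α) (by positivity)
  have hbR : ‖b‖ ≤ numPairs n / (2 * m) * R := by
    have h1 : ‖(Fintype.card (PairIdx n) : ℝ) • b‖
        ≤ Fintype.card (PairIdx n) * (numPairs n / (2 * m) * R) := by
      rw [← hsum]
      refine (norm_sum_le _ _).trans ((Finset.sum_le_sum fun α _ => hfR α).trans ?_)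
      simp
    rw [norm_smul, Real.norm_of_nonneg hcard.le] at h1
    exact le_of_mul_le_mul_left h1 hcard
  have key := card_norm_sum_ge_le (m := m) (fun _ α => T (noiseTerm m E α)) (fun _ => hzero) hθ
    (fun _ α => by
      refine (mul_le_mul_of_nonneg_left ?_ hθ).trans hθR
      rw [hterm]
      refine (norm_sub_le _ _).trans ((add_le_add (hfR α) hbR).trans (le_of_eq ?_))
      ring)
    (fun _ => numPairs n * W / (4 * m ^ 2))
    (fun _ => by
      simp only [hterm]
      refine (sum_norm_sub_mean_sq_le f b hsum).trans ?_
      simp only [hf, norm_smul, mul_pow, Real.norm_eq_abs, habs]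
      rw [← Finset.mul_sum, card_pairIdx]
      refine (mul_le_mul_of_nonneg_left hW (by positivity)).trans (le_of_eq ?_)
      ring)
    t
  have e : ∑ _k : Fin m, numPairs n * W / (4 * (m : ℝ) ^ 2) = numPairs n * W / (4 * m) := by
    rw [Finset.sum_const, Finset.card_univ, Fintype.card_fin, nsmul_eq_mul]
    field_simp
  rw [e] at key
  simp only [noise, map_sum]
  exact key

/-- Cauchy–Schwarz gives `(E_ii + E_jj - 2 E_ij)² ≤ 3 E_ii² + 3 E_jj² + 12 E_ij²`, halved because
ordered pairs are summed. Only the diagonal picks up the factor `n`. -/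
theorem sum_edm_sq_le {n : ℕ} {E : Matrix (Fin n) (Fin n) ℝ} (hE : Eᵀ = E) :
    ∑ α : PairIdx n, edm E α.1.1 α.1.2 ^ 2
      ≤ 3 * n * ∑ i, E i i ^ 2 + 6 * frobNorm E ^ 2 := by
  have h1 := sum_pairIdx (fun i j => edm E i j ^ 2 / 2)
  have h2 : ∀ α : PairIdx n, edm E α.1.1 α.1.2 ^ 2 / 2 + edm E α.1.2 α.1.1 ^ 2 / 2
      = edm E α.1.1 α.1.2 ^ 2 := by
    intro α
    rw [edm_comm E α.1.2]
    ring
  rw [Finset.sum_congr rfl fun α _ => h2 α] at h1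
  rw [h1]
  have h3 : ∀ i j, (if i = j then 0 else edm E i j ^ 2 / 2)
      ≤ 3 / 2 * E i i ^ 2 + 3 / 2 * E j j ^ 2 + 6 * E i j ^ 2 := by
    intro i j
    have hij : E j i = E i j := by
      conv_lhs => rw [← hE]
      rfl
    split_ifs
    · positivity
    · rw [edm_apply, hij]
      nlinarith [sq_nonneg (E i i - E j j), sq_nonneg (E i i + 2 * E i j),
        sq_nonneg (E j j + 2 * E i j)]
  refine (Finset.sum_le_sum fun i _ => Finset.sum_le_sum fun j _ => h3 i j).trans (le_of_eq ?_)
  simp only [Finset.sum_add_distrib, ← Finset.mul_sum, frobNorm_sq, vnorm_sq, Finset.sum_const,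
    Finset.card_univ, Fintype.card_fin, nsmul_eq_mul]
  ring

theorem abs_mul_apply_le {n : ℕ} (A B : Matrix (Fin n) (Fin n) ℝ) (i j : Fin n) :
    |(A * B) i j| ≤ vnorm (A i) * vnorm (Bᵀ j) := by
  rw [Matrix.mul_apply]
  exact abs_dotProduct_le (A i) (Bᵀ j)

theorem abs_mul_mul_apply_le {n : ℕ} {R : Matrix (Fin n) (Fin n) ℝ} (hR : IsOrthProj R)
    (P M : Matrix (Fin n) (Fin n) ℝ) (i j : Fin n) :
    |(P * M * R) i j| ≤ vnorm (P i) * ‖M‖ * vnorm (R j) := by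
  refine (abs_mul_apply_le _ _ i j).trans ?_
  rw [hR.symm]
  exact mul_le_mul_of_nonneg_right (vnorm_mul_row_le P M i) (vnorm_nonneg _)

/-- The tangent space projection of the centred matrix, as a Euclidean vector. -/
def tangentLin {n : ℕ} (P : Matrix (Fin n) (Fin n) ℝ) :
    Matrix (Fin n) (Fin n) ℝ →ₗ[ℝ] EuclideanSpace ℝ (Fin n × Fin n) :=
  vecLin n ∘ₗ
    { toFun := fun M => tangent P (centering n * M * centering n)
      map_add' := fun M N => by rw [mul_add, add_mul, tangent_add]
      map_smul' := fun c M => by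
        simp only [tangent, Matrix.mul_smul, Matrix.smul_mul, smul_add, smul_sub,
          RingHom.id_apply] }

theorem norm_tangentLin {n : ℕ} (P M : Matrix (Fin n) (Fin n) ℝ) :
    ‖tangentLin P M‖ = frobNorm (tangent P (centering n * M * centering n)) := norm_vecLin _

/-- `P *ᵥ (M *ᵥ x)` as a linear function of `M`. -/
def mulVecLin₂ {n : ℕ} (P : Matrix (Fin n) (Fin n) ℝ) (x : Fin n → ℝ) :
    Matrix (Fin n) (Fin n) ℝ →ₗ[ℝ] EuclideanSpace ℝ (Fin n) where
  toFun M := WithLp.toLp 2 (P *ᵥ (M *ᵥ x))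
  map_add' M N := by rw [Matrix.add_mulVec, Matrix.mulVec_add, WithLp.toLp_add]
  map_smul' c M := by
    rw [Matrix.smul_mulVec, Matrix.mulVec_smul, WithLp.toLp_smul, RingHom.id_apply]

theorem norm_mulVecLin₂ {n : ℕ} (P M : Matrix (Fin n) (Fin n) ℝ) (x : Fin n → ℝ) :
    ‖mulVecLin₂ P x M‖ = vnorm (P *ᵥ (M *ᵥ x)) := rfl

theorem mulVec_centering_conj_row {n : ℕ} {P N : Matrix (Fin n) (Fin n) ℝ} (hP : IsOrthProj P)
    (hJP : centering n * P = P) (hN : Nᵀ = N) (k : Fin n) :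
    P *ᵥ (centering n * N * centering n) k = P *ᵥ (N *ᵥ centering n k) := by
  have hPJ : P * centering n = P := by
    have := congrArg Matrix.transpose hJP
    rwa [Matrix.transpose_mul, hP.symm, (isOrthProj_centering n).symm] at this
  have h2 : (centering n * N) k = N *ᵥ centering n k := by
    ext j
    have : ∀ i, N i j = N j i := fun i => by
      conv_lhs => rw [← hN]
      rfl
    simp [Matrix.mul_apply, Matrix.mulVec, dotProduct, this, mul_comm]
  rw [vnorm_mul_proj_row (isOrthProj_centering n), h2, Matrix.mulVec_mulVec, hPJ]

/-! ### Edge matrices seen from an incoherent subspace -/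

section EdgeBounds

variable {n : ℕ} {P : Matrix (Fin n) (Fin n) ℝ} {τ : ℝ}

theorem frobNorm_mul_edgeMat_sq_le (hP : IsOrthProj P) (hτ : ∀ i, vnorm (P i) ≤ τ)
    (α : PairIdx n) : frobNorm (P * edgeMat α) ^ 2 ≤ 2 * τ ^ 2 := by
  have h1 : frobNorm (P * edgeMat α) = frobNorm (edgeMat α * P) := by
    rw [← frobNorm_transpose, Matrix.transpose_mul, hP.symm, edgeMat_transpose]
  have hsq : ∀ i, vnorm (P i) ^ 2 ≤ τ ^ 2 := fun i =>
    pow_le_pow_left₀ (vnorm_nonneg _) (hτ i) 2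
  rw [h1, frobNorm_sq]
  simp only [vnorm_mul_proj_row hP, vnorm_mulVec_edgeMat_row_sq hP]
  rw [Finset.sum_add_distrib, Finset.sum_ite_eq, Finset.sum_ite_eq]
  simp only [Finset.mem_univ, if_true]
  linarith [hsq α.1.1, hsq α.1.2]

theorem frobNorm_tangent_edgeMat_le (hP : IsOrthProj P) (hJP : centering n * P = P) (hτ0 : 0 ≤ τ)
    (hτ : ∀ i, vnorm (P i) ≤ τ) (α : PairIdx n) :
    frobNorm (tangent P (centering n * edgeMat α * centering n)) ≤ 2 * τ := by
  have hPJ : P * centering n = P := by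
    have := congrArg Matrix.transpose hJP
    rwa [Matrix.transpose_mul, hP.symm, (isOrthProj_centering n).symm] at this
  refine le_of_sq_le_sq ?_ (by positivity)
  refine (frobNorm_tangent_le hP (centering_conj_transpose (edgeMat_transpose α))
    (c := 2 * τ ^ 2) ?_).trans (le_of_eq (by ring))
  refine le_trans (pow_le_pow_left₀ (frobNorm_nonneg _) ?_ 2) (frobNorm_mul_edgeMat_sq_le hP hτ α)
  rw [← Matrix.mul_assoc, ← Matrix.mul_assoc, hPJ]
  exact (isOrthProj_centering n).frobNorm_mul_le' _

theorem norm_tangentLin_edge_le (hP : IsOrthProj P) (hJP : centering n * P = P) (hτ0 : 0 ≤ τ)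
    (hτ : ∀ i, vnorm (P i) ≤ τ) (c : ℝ) (α : PairIdx n) :
    ‖tangentLin P (c • edgeMat α)‖ ≤ |c| * (2 * τ) := by
  rw [map_smul, norm_smul, norm_tangentLin, Real.norm_eq_abs]
  exact mul_le_mul_of_nonneg_left (frobNorm_tangent_edgeMat_le hP hJP hτ0 hτ α) (abs_nonneg _)

theorem norm_mulVecLin₂_edge_le (hP : IsOrthProj P) (hτ : ∀ i, vnorm (P i) ≤ τ) (c : ℝ)
    (α : PairIdx n) (x : Fin n → ℝ) :
    ‖mulVecLin₂ P x (c • edgeMat α)‖ ≤ |c| * (τ * (|x α.1.1| + |x α.1.2|)) := by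
  rw [map_smul, norm_smul, norm_mulVecLin₂, Real.norm_eq_abs, edgeMat_mulVec, Matrix.mulVec_add,
    Matrix.mulVec_smul, Matrix.mulVec_smul]
  refine mul_le_mul_of_nonneg_left ((vnorm_add_le _ _).trans ?_) (abs_nonneg _)
  rw [vnorm_smul, vnorm_smul, hP.vnorm_mulVec_single, hP.vnorm_mulVec_single]
  have h1 := mul_le_mul_of_nonneg_left (hτ α.1.1) (abs_nonneg (x α.1.2))
  have h2 := mul_le_mul_of_nonneg_left (hτ α.1.2) (abs_nonneg (x α.1.1))
  linarith

end EdgeBounds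

/-! ### Entries and squared distances of the error -/

namespace SamplingRegime

variable {n r m : ℕ} {X : Matrix (Fin n) (Fin n) ℝ} {U : Matrix (Fin n) (Fin r) ℝ}
    {d : Fin r → ℝ} {σ κ B τ l δ : ℝ} {Z P : Matrix (Fin n) (Fin n) ℝ}

/-- The columns of `X` lie in the range of `U` and the rows of `Z` in that of `P`. Each summand thus
has an incoherent projection on one side, which makes the entries of the error small. -/
theorem sub_eq_add (h : SamplingRegime n r m X U d σ κ B τ l) (hP : IterateProj r X τ δ Z P) :
    X - Z = U * Uᵀ * (X - Z) + (1 - U * Uᵀ) * (X - Z) * P := by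
  have h1 : (1 - U * Uᵀ) * (X - Z) * P = (1 - U * Uᵀ) * (X - Z) := by
    have : (1 - U * Uᵀ) * (X - Z) = -((1 - U * Uᵀ) * Z) := by
      rw [mul_sub (1 - U * Uᵀ), sub_mul 1 _ X, h.proj_mul, one_mul, sub_self, zero_sub]
    rw [this, neg_mul, Matrix.mul_assoc, hP.mul_proj]
  rw [h1, ← add_mul, add_sub_cancel, one_mul]

theorem abs_sub_apply_le (h : SamplingRegime n r m X U d σ κ B τ l)
    (hP : IterateProj r X τ δ Z P) (i j : Fin n) : |(X - Z) i j| ≤ 6 / 5 * τ * δ := by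
  obtain ⟨R, hR⟩ : ∃ R, R = U * Uᵀ := ⟨_, rfl⟩
  have hRrow : ∀ i, vnorm (R i) ≤ τ / 11 := hR ▸ h.row_le
  have hRproj : IsOrthProj R := hR ▸ h.topSplit.proj
  have hdec : X - Z = R * (X - Z) + (1 - R) * (X - Z) * P := hR ▸ h.sub_eq_add hP
  have hτ := h.tau_nonneg
  have hEn : ‖X - Z‖ ≤ δ := (norm_le_frobNorm _).trans hP.frob_le
  have hδ0 : 0 ≤ δ := (norm_nonneg _).trans hEn
  have h1 : |(R * (X - Z)) i j| ≤ τ / 11 * δ :=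
    (abs_apply_le_vnorm _ j).trans ((vnorm_mul_row_le _ _ i).trans
      (mul_le_mul (hRrow i) hEn (norm_nonneg _) (by positivity)))
  have h2 : |((1 - R) * (X - Z) * P) i j| ≤ δ * τ := by
    refine (abs_mul_apply_le _ _ i j).trans ?_
    rw [hP.proj.symm]
    refine mul_le_mul ?_ (hP.row_le j) (vnorm_nonneg _) hδ0
    exact (_root_.vnorm_row_le _ i).trans ((norm_mul_le _ _).trans
      ((mul_le_of_le_one_left (norm_nonneg _) hRproj.compl.norm_le).trans hEn))
  have h3 : (X - Z) i j = (R * (X - Z)) i j + ((1 - R) * (X - Z) * P) i j := by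
    conv_lhs => rw [hdec]
    rfl
  rw [h3]
  have := abs_add_le ((R * (X - Z)) i j) (((1 - R) * (X - Z) * P) i j)
  have := mul_nonneg hτ hδ0
  linarith

/-- Here both `X` and `Z` are squeezed between incoherent projections, giving `τ ^ 2` instead of `τ
* δ`. This is the bound suited to the row estimate, whose threshold `σ * τ / 10` does not shrink
with `δ`. -/
theorem abs_sub_apply_le' (h : SamplingRegime n r m X U d σ κ B τ l)
    (hP : IterateProj r X τ δ Z P) (hδ : δ ≤ σ / 256) (i j : Fin n) :
    |(X - Z) i j| ≤ 6 / 5 * (κ * σ * τ ^ 2) := by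
  have hτ := h.tau_nonneg
  have hσ := h.sigma_pos
  have hκ := h.one_le_kappa
  have hκσ : σ ≤ κ * σ := le_mul_of_one_le_left hσ.le hκ
  have hXn : ‖X‖ ≤ κ * σ := h.norm_eq.le
  have hZn : ‖Z‖ ≤ κ * σ + κ * σ / 256 := by
    have h1 : ‖Z‖ ≤ ‖X‖ + ‖X - Z‖ := by
      have := norm_sub_le X (X - Z)
      rwa [sub_sub_cancel] at this
    have h2 : ‖X - Z‖ ≤ δ := (norm_le_frobNorm _).trans hP.frob_le
    linarith
  have hT := h.topSplit
  have hXe : X = U * Uᵀ * X * (U * Uᵀ) := by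
    rw [h.proj_mul, ← hT.comm, h.proj_mul]
  have hZe : Z = P * Z * P := by rw [hP.proj_mul, hP.mul_proj]
  have h1 : |X i j| ≤ τ / 11 * (κ * σ) * (τ / 11) := by
    rw [hXe]
    refine (abs_mul_mul_apply_le hT.proj _ _ i j).trans ?_
    exact mul_le_mul (mul_le_mul (h.row_le i) hXn (norm_nonneg _) (by positivity)) (h.row_le j)
      (vnorm_nonneg _) (by positivity)
  have h2 : |Z i j| ≤ τ * (κ * σ + κ * σ / 256) * τ := by
    rw [hZe]
    refine (abs_mul_mul_apply_le hP.proj _ _ i j).trans ?_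
    exact mul_le_mul (mul_le_mul (hP.row_le i) hZn (norm_nonneg _) hτ) (hP.row_le j)
      (vnorm_nonneg _) (by positivity)
  have h3 := abs_sub (X i j) (Z i j)
  have h4 : 0 ≤ κ * σ * τ ^ 2 := by positivity
  rw [Matrix.sub_apply]
  nlinarith

/-- Incoherence makes the squared diagonal of the error sum to `3 * τ ^ 2 * δ ^ 2`, which offsets
the factor `n` that the diagonal carries; `9 + 6 = 15`, using `1 ≤ n * τ ^ 2`. -/
theorem sum_edm_sub_sq_le (h : SamplingRegime n r m X U d σ κ B τ l)
    (hP : IterateProj r X τ δ Z P) :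
    ∑ α : PairIdx n, edm (X - Z) α.1.1 α.1.2 ^ 2 ≤ 15 * (n * τ ^ 2) * δ ^ 2 := by
  obtain ⟨R, hR⟩ : ∃ R, R = U * Uᵀ := ⟨_, rfl⟩
  have hRrow : ∀ i, vnorm (R i) ≤ τ / 11 := hR ▸ h.row_le
  have hRproj : IsOrthProj R := hR ▸ h.topSplit.proj
  have hdec : X - Z = R * (X - Z) + (1 - R) * (X - Z) * P := hR ▸ h.sub_eq_add hP
  have hτ := h.tau_nonneg
  have hn := h.n_pos
  have hEs : (X - Z)ᵀ = X - Z := by rw [Matrix.transpose_sub, h.symm, hP.symm]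
  have hf : frobNorm (X - Z) ^ 2 ≤ δ ^ 2 := pow_le_pow_left₀ (frobNorm_nonneg _) hP.frob_le 2
  have hf' : frobNorm ((1 - R) * (X - Z)) ^ 2 ≤ δ ^ 2 :=
    pow_le_pow_left₀ (frobNorm_nonneg _)
      ((hRproj.compl.frobNorm_mul_le _).trans hP.frob_le) 2
  have hdiag : ∀ i, (X - Z) i i ^ 2 ≤ 3 / 2 * τ ^ 2 * (vnorm ((X - Z) i) ^ 2
      + vnorm (((1 - R) * (X - Z)) i) ^ 2) := by
    intro i
    have h3 : (X - Z) i i = (R * (X - Z)) i i + ((1 - R) * (X - Z) * P) i i := by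
      conv_lhs => rw [hdec]
      rfl
    have h1 : |(R * (X - Z)) i i| ≤ τ / 11 * vnorm ((X - Z) i) := by
      refine (abs_mul_apply_le _ _ i i).trans ?_
      rw [hEs]
      exact mul_le_mul_of_nonneg_right (hRrow i) (vnorm_nonneg _)
    have h2 : |((1 - R) * (X - Z) * P) i i|
        ≤ vnorm (((1 - R) * (X - Z)) i) * τ := by
      refine (abs_mul_apply_le _ _ i i).trans ?_
      rw [hP.proj.symm]
      exact mul_le_mul_of_nonneg_left (hP.row_le i) (vnorm_nonneg _)
    have h4 : |(X - Z) i i| ≤ τ * (vnorm ((X - Z) i) / 11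
        + vnorm (((1 - R) * (X - Z)) i)) := by
      rw [h3]
      refine (abs_add_le _ _).trans ?_
      linarith
    rw [← sq_abs]
    refine (pow_le_pow_left₀ (abs_nonneg _) h4 2).trans ?_
    rw [mul_pow, mul_comm (3 / 2 : ℝ), mul_assoc]
    refine mul_le_mul_of_nonneg_left ?_ (sq_nonneg _)
    nlinarith [sq_nonneg (vnorm ((X - Z) i) - vnorm (((1 - R) * (X - Z)) i))]
  have hsum : ∑ i, (X - Z) i i ^ 2 ≤ 3 / 2 * τ ^ 2 * (δ ^ 2 + δ ^ 2) := by
    refine (Finset.sum_le_sum fun i _ => hdiag i).trans ?_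
    rw [← Finset.mul_sum, Finset.sum_add_distrib, ← frobNorm_sq, ← frobNorm_sq]
    exact mul_le_mul_of_nonneg_left (add_le_add hf hf') (by positivity)
  refine (sum_edm_sq_le hEs).trans ?_
  have h1 := mul_le_mul_of_nonneg_left hsum (show (0 : ℝ) ≤ 3 * n by positivity)
  have h2 := mul_le_mul_of_nonneg_right h.one_le_ntau (sq_nonneg δ)
  linarith

end SamplingRegime

/-- One step of the resampling algorithm. -/
def IsStep {n m : ℕ} (r : ℕ) (ν : ℝ) (X Z : Matrix (Fin n) (Fin n) ℝ) (ω : Fin m → PairIdx n)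
    (Z' : Matrix (Fin n) (Fin n) ℝ) : Prop :=
  ∃ (Zhat : Matrix (Fin n) (Fin n) ℝ) (Uhat : Matrix (Fin n) (Fin r) ℝ) (dhat : Fin r → ℝ),
    IsTrim r ν Z Zhat ∧ IsThinEig Zhat Uhat dhat ∧
    IsHardThreshold r
      (Zhat + (numPairs n / m) • projT Uhat (sampleOp ω (X - Zhat))) Z'

namespace SamplingRegime

variable {n r m : ℕ} {X : Matrix (Fin n) (Fin n) ℝ} {U : Matrix (Fin n) (Fin r) ℝ}
    {d : Fin r → ℝ} {σ κ B τ l δ : ℝ} {Z P : Matrix (Fin n) (Fin n) ℝ}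

theorem ratio_le (h : SamplingRegime n r m X U d σ κ B τ l) :
    (161000 * (n * τ ^ 2) ^ 2 * κ ^ 2 * n * l) / m ≤ 1 :=
  div_le_one_of_le₀ h.card_tau_le h.m_pos.le

/-- An edge has tangent component at most `2 * τ`, which with the bounds on the squared distances
yields `R` and `W`. Both scale with `δ`, so the same sample size serves every step. The exponent
gains `10 * l` and loses less than `l`. -/
theorem card_tangent_ge_le (h : SamplingRegime n r m X U d σ κ B τ l)
    (hP : IterateProj r X τ δ Z P) (hδ0 : 0 < δ) :
    ((Finset.univ.filter fun ω : Fin m → PairIdx n =>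
      δ / 4 ≤ ‖tangentLin P (noise ω (X - Z))‖).card : ℝ)
      ≤ 2 * Real.exp (-(9 * l)) * Fintype.card (PairIdx n) ^ m := by
  have hκ := h.one_le_kappa
  have hκ0 : 0 < κ := one_pos.trans_le hκ
  have hl := h.one_le_l
  have hn := h.n_pos
  have hm := h.m_pos
  have hτ := h.tau_pos
  have hL := numPairs_pos h.three_le
  have hL' := numPairs_le n
  have hq := h.ratio_le
  have hnt := h.one_le_ntau
  have hq0 : 0 ≤ (161000 * (n * τ ^ 2) ^ 2 * κ ^ 2 * n * l) / m := by positivity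
  have hkinv : 1 / κ ^ 2 ≤ 1 := div_le_one_of_le₀ (one_le_pow₀ hκ) (by positivity)
  have key := card_map_noise_ge_le h.three_le (tangentLin P) (by exact_mod_cast hm) (X - Z)
    (θ := 40 * l / δ) (R := 48 / 5 * τ ^ 2 * δ) (W := 60 * n * τ ^ 4 * δ ^ 2) (by positivity)
    (fun α => by
      refine (norm_tangentLin_edge_le hP.proj hP.centering_mul_proj hτ.le hP.row_le _ α).trans ?_
      refine (mul_le_mul_of_nonneg_right (abs_edm_le_of_entry_le (h.abs_sub_apply_le hP) _ _)
        (by positivity)).trans (le_of_eq ?_)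
      ring)
    (by
      have e : 40 * l / δ * ((n : ℝ) ^ 2 / 2 / m * (48 / 5 * τ ^ 2 * δ))
          = 192 / 161000 * ((161000 * (n * τ ^ 2) ^ 2 * κ ^ 2 * n * l) / m) * (1 / (n * τ ^ 2))
            * (1 / κ ^ 2) := by
        field_simp
        ring
      have f1 : 1 / (n * τ ^ 2) ≤ 1 := div_le_one_of_le₀ hnt (by positivity)
      calc _ ≤ 40 * l / δ * ((n : ℝ) ^ 2 / 2 / m * (48 / 5 * τ ^ 2 * δ)) := by gcongr
        _ ≤ (192 / 161000 : ℝ) * 1 * 1 * 1 := by rw [e]; gcongr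
        _ ≤ 1 := by norm_num)
    (by
      have h1 : ∀ α : PairIdx n,
          ‖tangentLin P (edm (X - Z) α.1.1 α.1.2 • edgeMat α)‖ ^ 2
          ≤ 4 * τ ^ 2 * edm (X - Z) α.1.1 α.1.2 ^ 2 := by
        intro α
        refine (pow_le_pow_left₀ (norm_nonneg _) (norm_tangentLin_edge_le hP.proj
          hP.centering_mul_proj hτ.le hP.row_le _ α) 2).trans (le_of_eq ?_)
        rw [mul_pow, sq_abs]
        ring
      refine (Finset.sum_le_sum fun α _ => h1 α).trans ?_
      rw [← Finset.mul_sum]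
      refine (mul_le_mul_of_nonneg_left (h.sum_edm_sub_sq_le hP) (by positivity)).trans
        (le_of_eq ?_)
      ring)
    (δ / 4)
  refine key.trans (mul_le_mul_of_nonneg_right ?_ (by positivity))
  refine mul_le_mul_of_nonneg_left (Real.exp_le_exp.2 ?_) (by norm_num)
  have e1 : 40 * l / δ * (δ / 4) = 10 * l := by field_simp; norm_num
  have e2 : (40 * l / δ) ^ 2 * ((n : ℝ) ^ 2 / 2 * (60 * n * τ ^ 4 * δ ^ 2) / (4 * m))
      = 12000 / 161000 * l * ((161000 * (n * τ ^ 2) ^ 2 * κ ^ 2 * n * l) / m) * (1 / κ ^ 2) := by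
    field_simp
    ring
  have e3 : (40 * l / δ) ^ 2 * (numPairs n * (60 * n * τ ^ 4 * δ ^ 2) / (4 * m))
      ≤ 12000 / 161000 * l * 1 * 1 := by
    calc _ ≤ (40 * l / δ) ^ 2 * ((n : ℝ) ^ 2 / 2 * (60 * n * τ ^ 4 * δ ^ 2) / (4 * m)) := by gcongr
      _ ≤ _ := by rw [e2]; gcongr
  rw [e1]
  linarith

theorem vnorm_centering_row_le (k : Fin n) : vnorm (centering n k) ≤ 1 :=
  (_root_.vnorm_row_le _ k).trans (isOrthProj_centering n).norm_le

/-- Row `k` of the centred noise is `N` applied to row `k` of the centering, a vector `x` of norm at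
most `1`. An edge acts on `x` through two coordinates only, so the second moment carries the factor
`‖x‖² ≤ 1`. -/
theorem card_row_ge_le (h : SamplingRegime n r m X U d σ κ B τ l)
    (hP : IterateProj r X τ δ Z P) (hδ : δ ≤ σ / 256) (k : Fin n) :
    ((Finset.univ.filter fun ω : Fin m → PairIdx n =>
      σ * τ / 10 ≤ ‖mulVecLin₂ P (centering n k) (noise ω (X - Z))‖).card : ℝ)
      ≤ 2 * Real.exp (-(9 * l)) * Fintype.card (PairIdx n) ^ m := by
  have hσ := h.sigma_pos
  have hκ := h.one_le_kappa
  have hκ0 : 0 < κ := one_pos.trans_le hκ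
  have hl := h.one_le_l
  have hn := h.n_pos
  have hn3 := h.three_le'
  have hm := h.m_pos
  have hτ := h.tau_pos
  have hL := numPairs_pos h.three_le
  have hL' := numPairs_le n
  have hq := h.ratio_le
  have hnt := h.one_le_ntau
  have hx := vnorm_centering_row_le k
  have hq0 : 0 ≤ (161000 * (n * τ ^ 2) ^ 2 * κ ^ 2 * n * l) / m := by positivity
  generalize centering n k = x at hx ⊢
  have hxi : ∀ i, |x i| ≤ 1 := fun i => (abs_apply_le_vnorm x i).trans hx
  have hD := abs_edm_le_of_entry_le (h.abs_sub_apply_le' hP hδ)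
  have hedge := fun α : PairIdx n => (norm_mulVecLin₂_edge_le hP.proj hP.row_le
    (edm (X - Z) α.1.1 α.1.2) α x).trans (mul_le_mul_of_nonneg_right (hD _ _) (by positivity))
  have key := card_map_noise_ge_le h.three_le (mulVecLin₂ P x) (by exact_mod_cast hm) (X - Z)
    (θ := 100 * l / (σ * τ)) (R := 48 / 5 * (κ * σ * τ ^ 3))
    (W := 2 * (24 / 5 * (κ * σ * τ ^ 2)) ^ 2 * τ ^ 2 * n) (by positivity)
    (fun α => by
      refine (hedge α).trans ?_
      have h1 : |x α.1.1| + |x α.1.2| ≤ 2 := by linarith [hxi α.1.1, hxi α.1.2]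
      calc _ ≤ 4 * (6 / 5 * (κ * σ * τ ^ 2)) * (τ * 2) := by gcongr
        _ = _ := by ring)
    (by
      have e : 100 * l / (σ * τ) * ((n : ℝ) ^ 2 / 2 / m * (48 / 5 * (κ * σ * τ ^ 3)))
          = 480 / 161000 * ((161000 * (n * τ ^ 2) ^ 2 * κ ^ 2 * n * l) / m) * (1 / (n * τ ^ 2))
            * (1 / κ) := by
        field_simp
        ring
      have f1 : 1 / (n * τ ^ 2) ≤ 1 := div_le_one_of_le₀ hnt (by positivity)
      have f2 : 1 / κ ≤ 1 := div_le_one_of_le₀ hκ (by positivity)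
      calc _ ≤ 100 * l / (σ * τ) * ((n : ℝ) ^ 2 / 2 / m * (48 / 5 * (κ * σ * τ ^ 3))) := by gcongr
        _ ≤ (480 / 161000 : ℝ) * 1 * 1 * 1 := by rw [e]; gcongr
        _ ≤ 1 := by norm_num)
    (by
      have h1 : ∀ α : PairIdx n, ‖mulVecLin₂ P x (edm (X - Z) α.1.1 α.1.2 • edgeMat α)‖ ^ 2
          ≤ 2 * (24 / 5 * (κ * σ * τ ^ 2)) ^ 2 * τ ^ 2 * (x α.1.1 ^ 2 + x α.1.2 ^ 2) := by
        intro α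
        refine (pow_le_pow_left₀ (norm_nonneg _) (hedge α) 2).trans ?_
        have h2 : (|x α.1.1| + |x α.1.2|) ^ 2 ≤ 2 * (x α.1.1 ^ 2 + x α.1.2 ^ 2) := by
          rw [← sq_abs (x α.1.1), ← sq_abs (x α.1.2)]
          nlinarith [sq_nonneg (|x α.1.1| - |x α.1.2|)]
        calc _ = (24 / 5 * (κ * σ * τ ^ 2)) ^ 2 * τ ^ 2 * (|x α.1.1| + |x α.1.2|) ^ 2 := by ring
          _ ≤ (24 / 5 * (κ * σ * τ ^ 2)) ^ 2 * τ ^ 2 * (2 * (x α.1.1 ^ 2 + x α.1.2 ^ 2)) := by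
              gcongr
          _ = _ := by ring
      refine (Finset.sum_le_sum fun α _ => h1 α).trans ?_
      rw [← Finset.mul_sum, sum_sq_endpoints]
      refine mul_le_mul_of_nonneg_left ?_ (by positivity)
      have h2 : vnorm x ^ 2 ≤ 1 := pow_le_one₀ (vnorm_nonneg _) hx
      have := mul_le_mul (show (n : ℝ) - 1 ≤ n by linarith) h2 (sq_nonneg _) hn.le
      linarith)
    (σ * τ / 10)
  refine key.trans (mul_le_mul_of_nonneg_right ?_ (by positivity))
  refine mul_le_mul_of_nonneg_left (Real.exp_le_exp.2 ?_) (by norm_num)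
  have e1 : 100 * l / (σ * τ) * (σ * τ / 10) = 10 * l := by field_simp; norm_num
  have e2 : (100 * l / (σ * τ)) ^ 2 * ((n : ℝ) ^ 2 / 2
      * (2 * (24 / 5 * (κ * σ * τ ^ 2)) ^ 2 * τ ^ 2 * n) / (4 * m))
      = 57600 / 161000 * l * ((161000 * (n * τ ^ 2) ^ 2 * κ ^ 2 * n * l) / m) := by
    field_simp
    ring
  have e3 : (100 * l / (σ * τ)) ^ 2 * (numPairs n
      * (2 * (24 / 5 * (κ * σ * τ ^ 2)) ^ 2 * τ ^ 2 * n) / (4 * m)) ≤ 57600 / 161000 * l * 1 := by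
    calc _ ≤ (100 * l / (σ * τ)) ^ 2 * ((n : ℝ) ^ 2 / 2
          * (2 * (24 / 5 * (κ * σ * τ ^ 2)) ^ 2 * τ ^ 2 * n) / (4 * m)) := by gcongr
      _ ≤ _ := by rw [e2]; gcongr
  rw [e1]
  linarith

/-- A step from a good iterate has a unique result, which is a better iterate. -/
def StepGood (r : ℕ) (ν : ℝ) (X : Matrix (Fin n) (Fin n) ℝ) (δ : ℝ)
    (Z : Matrix (Fin n) (Fin n) ℝ) (ω : Fin m → PairIdx n) : Prop :=
  DeterminesGood (IsStep r ν X Z ω) (GoodIterate r X (Real.sqrt (ν * r / n)) (5 / 6 * δ))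

/-- Trimming is inactive and the projection does not depend on the decomposition, so every
admissible step thresholds the same matrix. It lies within `65 / 256 * δ < σ / 2` of `X`, whence
uniqueness. -/
theorem stepGood_of_small_noise {ν : ℝ}
    (h : SamplingRegime n r m X U d σ κ B (Real.sqrt (ν * r / n)) l)
    (hZ : GoodIterate r X (Real.sqrt (ν * r / n)) δ Z)
    (hP : IterateProj r X (Real.sqrt (ν * r / n)) δ Z P) (hδ0 : 0 ≤ δ) (hδ : δ ≤ σ / 256)
    {ω : Fin m → PairIdx n} (hT : ‖tangentLin P (noise ω (X - Z))‖ ≤ δ / 4)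
    (hrow : ∀ k, ‖mulVecLin₂ P (centering n k) (noise ω (X - Z))‖
      ≤ σ * Real.sqrt (ν * r / n) / 10) :
    StepGood r ν X δ Z ω := by
  set G := centering n * noise ω (X - Z) * centering n with hG
  have hm : 0 < m := by exact_mod_cast h.m_pos
  have hEs : (X - Z)ᵀ = X - Z := by rw [Matrix.transpose_sub, h.symm, hP.symm]
  have hE1 : (X - Z) *ᵥ (fun _ => (1 : ℝ)) = 0 := by
    rw [Matrix.sub_mulVec, h.mulVec_one, hP.mulVec_one, sub_zero]
  have hGs : Gᵀ = G := centering_conj_transpose (noise_transpose _ _)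
  have hG1 : G *ᵥ (fun _ => (1 : ℝ)) = 0 := by
    rw [hG, ← Matrix.mulVec_mulVec, centering_mulVec_one, Matrix.mulVec_zero]
  have hT' : frobNorm (tangent P G) ≤ δ / 4 := by
    rwa [norm_tangentLin] at hT
  have hrow' : ∀ k, vnorm (P *ᵥ G k) ≤ σ * Real.sqrt (ν * r / n) / 10 := by
    intro k
    have := hrow k
    rwa [norm_mulVecLin₂, ← mulVec_centering_conj_row hP.proj hP.centering_mul_proj
      (noise_transpose _ _)] at this
  have hY : ∀ (U' : Matrix (Fin n) (Fin r) ℝ) (d' : Fin r → ℝ), IsThinEig Z U' d' →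
      Z + (numPairs n / m) • projT U' (sampleOp ω (X - Z)) = Z + tangent P (X - Z + G) := by
    intro U' d' hU'
    have h1 : X - Z + G = (numPairs n / m) • sampleOp ω (X - Z) := by
      rw [hG, ← sampleOp_sub_eq hm ω hEs hE1, add_sub_cancel]
    rw [h1, projT_eq_tangent, hP.eq_proj hU']
    simp only [tangent, Matrix.mul_smul, Matrix.smul_mul, smul_add, smul_sub]
  have hstep : ∀ Z', IsStep r ν X Z ω Z' → IsHardThreshold r (Z + tangent P (X - Z + G)) Z' := by
    rintro Z' ⟨Zhat, U', d', h1, h2, h3⟩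
    obtain rfl := hP.trim_eq h1
    rwa [hY U' d' h2] at h3
  refine ⟨?_, fun Z' hZ' => h.goodIterate_step hP hδ0 hδ hGs hG1 hT' hrow' (hstep Z' hZ'),
    fun Z' Z'' h1 h2 => ?_⟩
  · obtain ⟨U', d', Q', hU', -, -⟩ := hZ.exists_eig
    have htrim : IsTrim r ν Z (trimRows ν U' * Matrix.diagonal d' * (trimRows ν U')ᵀ) :=
      ⟨U', d', hU', rfl⟩
    rw [hP.trim_eq htrim] at htrim
    obtain ⟨H, hH⟩ := exists_hardThreshold (Y := Z + tangent P (X - Z + G)) (by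
      rw [Matrix.transpose_add, hP.symm, tangent_transpose hP.proj]
      rw [Matrix.transpose_add, hEs, hGs]) r
    exact ⟨H, Z, U', d', htrim, hU', by rwa [hY U' d' hU']⟩
  · refine hardThreshold_unique h.eig h.rank_le_card (η := 65 / 256 * δ) ?_ h.sigma_le
      ((norm_le_frobNorm _).trans (h.frobNorm_step_sub_le hP hδ0 hδ hT')) (hstep _ h1) (hstep _ h2)
    have := h.sigma_pos
    linarith

open scoped Classical in
theorem card_not_stepGood_le {ν : ℝ}
    (h : SamplingRegime n r m X U d σ κ B (Real.sqrt (ν * r / n)) l)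
    (hZ : GoodIterate r X (Real.sqrt (ν * r / n)) δ Z) (hδ0 : 0 < δ) (hδ : δ ≤ σ / 256) :
    ((Finset.univ.filter fun ω : Fin m → PairIdx n => ¬ StepGood r ν X δ Z ω).card : ℝ)
      ≤ 4 * n * Real.exp (-l) * Fintype.card (PairIdx n) ^ m := by
  obtain ⟨P, hP⟩ := hZ.exists_iterateProj
  have h1 := h.card_tangent_ge_le hP hδ0
  have h2 := h.card_row_ge_le hP hδ
  set b₁ := Finset.univ.filter fun ω : Fin m → PairIdx n =>
    δ / 4 ≤ ‖tangentLin P (noise ω (X - Z))‖ with hb₁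
  set b₂ : Fin n → Finset (Fin m → PairIdx n) := fun k => Finset.univ.filter fun ω =>
    σ * Real.sqrt (ν * r / n) / 10 ≤ ‖mulVecLin₂ P (centering n k) (noise ω (X - Z))‖ with hb₂
  have hsub : (Finset.univ.filter fun ω : Fin m → PairIdx n => ¬ StepGood r ν X δ Z ω)
      ⊆ b₁ ∪ Finset.univ.biUnion b₂ := by
    intro ω hω
    by_contra hc
    simp only [hb₁, hb₂, Finset.mem_union, Finset.mem_biUnion, Finset.mem_filter,
      Finset.mem_univ, true_and, not_or, not_exists, not_le] at hc
    rw [Finset.mem_filter] at hω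
    exact hω.2 (h.stepGood_of_small_noise hZ hP hδ0.le hδ hc.1.le fun k => (hc.2 k).le)
  have h3 : ((Finset.univ.filter fun ω : Fin m → PairIdx n => ¬ StepGood r ν X δ Z ω).card : ℝ)
      ≤ b₁.card + ∑ k, ((b₂ k).card : ℝ) := by
    have := (Finset.card_le_card hsub).trans ((Finset.card_union_le _ _).trans
      (add_le_add le_rfl Finset.card_biUnion_le))
    exact_mod_cast this
  have hA : (0 : ℝ) ≤ (Fintype.card (PairIdx n) : ℝ) ^ m := by positivity
  have hn3 := h.three_le'
  have h4 : ∑ k, ((b₂ k).card : ℝ)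
      ≤ n * (2 * Real.exp (-(9 * l)) * Fintype.card (PairIdx n) ^ m) := by
    refine (Finset.sum_le_sum fun k _ => h2 k).trans (le_of_eq ?_)
    simp
  have hexp : Real.exp (-(9 * l)) ≤ Real.exp (-l) :=
    Real.exp_le_exp.2 (by have := h.one_le_l; linarith)
  have h5 := mul_le_mul_of_nonneg_right hexp hA
  have h6 : 0 ≤ Real.exp (-l) * (Fintype.card (PairIdx n) : ℝ) ^ m :=
    mul_nonneg (Real.exp_pos _).le hA
  have h7 := mul_le_mul_of_nonneg_left h5 (show (0 : ℝ) ≤ n by linarith)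
  nlinarith

end SamplingRegime

/-! ### Runs of a randomized iteration -/

section Chain

variable {A St : Type*}

open scoped Classical in
-- Conditioning on the first batch, in counting form: either it is bad, or the remaining batches
-- fail for that fixed good value.
theorem card_not_le_of_cons [Fintype A] {S : ℕ} (G : (Fin (S + 1) → A) → Prop) (D : A → Prop)
    {q₀ q₁ : ℝ} (hq₁ : 0 ≤ q₁)
    (h₀ : ((Finset.univ.filter fun a => ¬ D a).card : ℝ) ≤ q₀ * Fintype.card A)
    (h₁ : ∀ a, D a → ((Finset.univ.filter fun ω : Fin S → A => ¬ G (Fin.cons a ω)).card : ℝ)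
      ≤ q₁ * Fintype.card A ^ S) :
    ((Finset.univ.filter fun ω => ¬ G ω).card : ℝ) ≤ (q₀ + q₁) * Fintype.card A ^ (S + 1) := by
  have e : ((Finset.univ.filter fun ω => ¬ G ω).card : ℝ)
      = ∑ a, ((Finset.univ.filter fun ω : Fin S → A => ¬ G (Fin.cons a ω)).card : ℝ) := by
    have h := (Fin.consEquiv fun _ : Fin (S + 1) => A).sum_comp
      fun ω => if ¬ G ω then (1 : ℝ) else 0
    rw [Fintype.sum_prod_type] at h
    simp only [Finset.card_filter, Nat.cast_sum, Nat.cast_ite, Nat.cast_one, Nat.cast_zero]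
    rw [← h]
    rfl
  have hterm : ∀ a, ((Finset.univ.filter fun ω : Fin S → A => ¬ G (Fin.cons a ω)).card : ℝ)
      ≤ ((if ¬ D a then 1 else 0) + q₁) * Fintype.card A ^ S := by
    intro a
    by_cases ha : D a
    · rw [if_neg (not_not.2 ha), zero_add]
      exact h₁ a ha
    · rw [if_pos ha]
      have h1 : ((Finset.univ.filter fun ω : Fin S → A => ¬ G (Fin.cons a ω)).card : ℝ)
          ≤ Fintype.card A ^ S := by
        have := Finset.card_le_univ (Finset.univ.filter fun ω : Fin S → A => ¬ G (Fin.cons a ω))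
        rw [Fintype.card_fun, Fintype.card_fin] at this
        exact_mod_cast this
      have h2 : (0 : ℝ) ≤ q₁ * Fintype.card A ^ S := by positivity
      linarith
  rw [e]
  refine (Finset.sum_le_sum fun a _ => hterm a).trans ?_
  rw [← Finset.sum_mul, Finset.sum_add_distrib, pow_succ', ← mul_assoc, add_mul q₀]
  refine mul_le_mul_of_nonneg_right (add_le_add (le_of_eq_of_le ?_ h₀) (le_of_eq ?_))
    (by positivity)
  · simp [Finset.card_filter]
  · simp [mul_comm]

/-- `Z` is a run of the relation `step`, started at `z` and driven by `ω`. -/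
def IsRun (step : St → A → St → Prop) {S : ℕ} (z : St) (ω : Fin S → A) (Z : Fin (S + 1) → St) :
    Prop :=
  Z 0 = z ∧ ∀ k : Fin S, step (Z k.castSucc) (ω k) (Z k.succ)

theorem isRun_cons {step : St → A → St → Prop} {S : ℕ} {z z' : St} {a : A} {ω : Fin S → A}
    {Z : Fin (S + 1) → St} (h : step z a z') (hZ : IsRun step z' ω Z) :
    IsRun step z (Fin.cons a ω : Fin (S + 1) → A) (Fin.cons z Z : Fin (S + 2) → St) := by
  refine ⟨rfl, fun k => ?_⟩
  refine Fin.cases ?_ (fun j => ?_) k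
  · have : (Fin.cons z Z : Fin (S + 2) → St) (Fin.succ 0) = z' := by
      rw [Fin.cons_succ, hZ.1]
    rw [this]
    exact h
  · rw [Fin.cons_succ, Fin.cons_succ, ← Fin.succ_castSucc, Fin.cons_succ]
    exact hZ.2 j

theorem IsRun.tail {step : St → A → St → Prop} {S : ℕ} {z : St} {a : A} {ω : Fin S → A}
    {Z : Fin (S + 2) → St} (hZ : IsRun step z (Fin.cons a ω : Fin (S + 1) → A) Z) :
    step z a (Z 1) ∧ IsRun step (Z 1) ω (Fin.tail Z) := by
  refine ⟨?_, rfl, fun k => ?_⟩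
  · have := hZ.2 0
    rw [Fin.cons_zero, Fin.castSucc_zero, hZ.1] at this
    exact this
  · have := hZ.2 k.succ
    rw [Fin.cons_succ] at this
    exact this

/-- There is a run in `R`, and all runs in `R` end in a state that satisfies `q`. -/
def RunsGood {S : ℕ} (R : (Fin (S + 1) → St) → Prop) (q : St → Prop) : Prop :=
  (∃ Z, R Z) ∧ ∀ Z, R Z → q (Z (Fin.last S))

open scoped Classical in
/-- If every step from a good state has a unique, good result with high probability, then so has
every run. -/
theorem card_not_run_good_le [Fintype A] (step : St → A → St → Prop) (good : ℕ → St → Prop)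
    {q : ℝ} (hq : 0 ≤ q)
    (h : ∀ l z, good l z → ((Finset.univ.filter fun a =>
      ¬ DeterminesGood (step z a) (good (l + 1))).card : ℝ) ≤ q * Fintype.card A) (S : ℕ) :
    ∀ l z, good l z → ((Finset.univ.filter fun ω : Fin S → A =>
      ¬ RunsGood (IsRun step z ω) (good (l + S))).card : ℝ)
      ≤ S * q * Fintype.card A ^ S := by
  induction S with
  | zero =>
    intro l z hz
    rw [Finset.filter_false_of_mem]
    · simp
    · intro ω _ hc
      refine hc ⟨⟨fun _ => z, rfl, fun k => k.elim0⟩, fun Z hZ => ?_⟩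
      have : Z (Fin.last 0) = z := hZ.1
      rw [this]
      exact hz
  | succ S ih =>
    intro l z hz
    have key := card_not_le_of_cons (fun ω : Fin (S + 1) → A =>
      RunsGood (IsRun step z ω) (good (l + (S + 1))))
      (fun a => DeterminesGood (step z a) (good (l + 1))) (q₀ := q) (q₁ := S * q) (by positivity)
      (h l z hz) ?_
    · refine key.trans (le_of_eq ?_)
      push_cast
      ring
    · intro a ha
      obtain ⟨z', hz'⟩ := ha.exists_of
      refine le_trans (Nat.cast_le.2 (Finset.card_le_card fun ω hω => ?_))
        (ih (l + 1) z' (ha.good z' hz'))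
      rw [Finset.mem_filter] at hω ⊢
      refine ⟨Finset.mem_univ _, fun hc => hω.2 ⟨?_, fun Z hZ => ?_⟩⟩
      · obtain ⟨Z, hZ⟩ := hc.1
        exact ⟨_, isRun_cons hz' hZ⟩
      · obtain ⟨h1, h2⟩ := hZ.tail
        -- Uniqueness identifies the state of an arbitrary run with `z'`, which depends on the first
        -- batch only; the later batches are therefore still uniform given this state.
        rw [ha.unique _ _ h1 hz'] at h2
        have := hc.2 _ h2
        rw [add_right_comm] at this
        exact this

/-- `Z` is a run of the relation `step`, with initial state determined by `init`. -/
def IsInitRun (init : A → St → Prop) (step : St → A → St → Prop) {S : ℕ} (ω : Fin (S + 1) → A)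
    (Z : Fin (S + 1) → St) : Prop :=
  init (ω 0) (Z 0) ∧ ∀ k : Fin S, step (Z k.castSucc) (ω k.succ) (Z k.succ)

open scoped Classical in
theorem card_not_init_run_good_le [Fintype A] (init : A → St → Prop) (step : St → A → St → Prop)
    (good : ℕ → St → Prop) {q₀ q : ℝ} (hq : 0 ≤ q)
    (h₀ : ((Finset.univ.filter fun a => ¬ DeterminesGood (init a) (good 0)).card : ℝ)
      ≤ q₀ * Fintype.card A)
    (h : ∀ l z, good l z → ((Finset.univ.filter fun a =>
      ¬ DeterminesGood (step z a) (good (l + 1))).card : ℝ) ≤ q * Fintype.card A) (S : ℕ) :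
    ((Finset.univ.filter fun ω : Fin (S + 1) → A =>
      ¬ RunsGood (IsInitRun init step ω) (good S)).card : ℝ)
      ≤ (q₀ + S * q) * Fintype.card A ^ (S + 1) := by
  refine card_not_le_of_cons _ (fun a => DeterminesGood (init a) (good 0)) (by positivity) h₀ ?_
  intro a ha
  obtain ⟨z, hz⟩ := ha.exists_of
  refine le_trans (Nat.cast_le.2 (Finset.card_le_card fun ω hω => ?_))
    (card_not_run_good_le step good hq h S 0 z (ha.good z hz))
  rw [Finset.mem_filter] at hω ⊢
  refine ⟨Finset.mem_univ _, fun hc => hω.2 ⟨?_, fun Z hZ => ?_⟩⟩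
  · obtain ⟨Z, hZ0, hZ⟩ := hc.1
    exact ⟨Z, by rw [hZ0]; exact hz, hZ⟩
  · have := hc.2 Z ⟨ha.unique _ _ hZ.1 hz, hZ.2⟩
    rwa [zero_add] at this

end Chain

/-! ### Incoherence and the sampling regime -/

theorem frobNorm_single_mul {n : ℕ} (i j : Fin n) (A : Matrix (Fin n) (Fin n) ℝ) :
    frobNorm (Matrix.single i j 1 * A) = vnorm (A j) := by
  have hrow : (Matrix.single i j (1 : ℝ) * A) i = A j := by
    ext k
    rw [Matrix.single_mul_apply_same, one_mul]
  rw [← sq_eq_sq₀ (frobNorm_nonneg _) (vnorm_nonneg _), frobNorm_sq, Finset.sum_eq_single i]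
  · rw [hrow]
  · intro b _ hb
    have : (Matrix.single i j (1 : ℝ) * A) b = 0 := by
      ext k
      exact Matrix.single_mul_apply_of_ne _ _ _ _ _ hb _
    rw [this, vnorm_zero]
    norm_num
  · simp

/-- `P_U e_ij` has the Frobenius norm of row `i` of the projection, and `11² < 128`. -/
theorem Incoherent.vnorm_row_le {n r : ℕ} {ν : ℝ} {U : Matrix (Fin n) (Fin r) ℝ}
    (h : Incoherent ν U) (hn : 2 ≤ n) (hU : Uᵀ * U = 1) (i : Fin n) :
    vnorm ((U * Uᵀ) i) ≤ Real.sqrt (ν * r / n) / 11 := by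
  have hP := isOrthProj_mul_transpose hU
  have hconst : Real.sqrt (ν * r / (128 * n)) ≤ Real.sqrt (ν * r / n) / 11 := by
    rw [le_div_iff₀ (by norm_num), mul_comm]
    have h11 : (11 : ℝ) = Real.sqrt (11 ^ 2) := (Real.sqrt_sq (by norm_num)).symm
    rw [h11, ← Real.sqrt_mul (by norm_num)]
    refine Real.sqrt_le_sqrt ?_
    have h0 : 0 ≤ ν * r / n := by
      have := h.one_le
      positivity
    have e : ν * r / (128 * n) = ν * r / n / 128 := by rw [div_div, mul_comm (n : ℝ)]
    rw [e]
    linarith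
  refine le_trans ?_ hconst
  by_cases hi : (i : ℕ) + 1 < n
  · have h1 := h.projU_e ⟨(i, ⟨i + 1, hi⟩), Fin.lt_def.2 (Nat.lt_succ_self _)⟩
    refine le_of_eq_of_le ?_ h1
    rw [projU, ← frobNorm_transpose, Matrix.transpose_mul, hP.symm, Matrix.transpose_single,
      frobNorm_single_mul]
  -- The last index is never the first entry of a pair, so `projU_e` says nothing about it. The
  -- tangent bound for `e_{0i}` does: multiplying `P_T e_{0i}` by the projection on the right leaves
  -- `e_{0i} * (U * Uᵀ)`.
  · have h0 : (⟨0, by omega⟩ : Fin n) < i := Fin.lt_def.2 (by simp only; omega)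
    have h1 := h.projT_e ⟨(⟨0, by omega⟩, i), h0⟩
    refine le_trans ?_ h1
    rw [projT_eq_tangent]
    have e : tangent (U * Uᵀ) (Matrix.single ⟨0, by omega⟩ i 1) * (U * Uᵀ)
        = Matrix.single ⟨0, by omega⟩ i 1 * (U * Uᵀ) := by
      rw [tangent, sub_mul, add_mul, Matrix.mul_assoc (Matrix.single _ i 1), hP.idem,
        Matrix.mul_assoc _ (U * Uᵀ) (U * Uᵀ), hP.idem]
      abel
    rw [← frobNorm_single_mul ⟨0, by omega⟩ i (U * Uᵀ), ← e]
    exact hP.frobNorm_mul_le' _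

theorem IsOrthProj.one_le_norm {n : ℕ} {P : Matrix (Fin n) (Fin n) ℝ} (hP : IsOrthProj P)
    (h0 : P ≠ 0) : 1 ≤ ‖P‖ := by
  have h1 := norm_mul_le P P
  rw [hP.idem] at h1
  have h2 : 0 < ‖P‖ := norm_pos_iff.2 h0
  exact le_of_mul_le_mul_right (by rwa [one_mul]) h2

theorem one_lt_log_of_three_le {n : ℕ} (hn : 3 ≤ n) : 1 < Real.log n := by
  rw [Real.lt_log_iff_exp_lt (by positivity)]
  have h1 := Real.exp_one_lt_d9
  have h2 : (3 : ℝ) ≤ n := by exact_mod_cast hn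
  linarith

/-- Dictionary to the parameters of the proof: `n * τ ^ 2 = ν * r`, `(n * B) ^ 2 = μ₁ ^ 2 * r * (κ *
σ) ^ 2` and `l = β * log n`. The two entries of the maximum give the two sample size conditions, and
`1 ≤ l` holds because `n ≥ 3 > e`. -/
theorem samplingRegime_of_incoherent {n r m : ℕ} (hn : 3 ≤ n) (hr : 1 ≤ r)
    {X : Matrix (Fin n) (Fin n) ℝ} (hXsymm : Xᵀ = X) (hXrow : X *ᵥ (fun _ => (1 : ℝ)) = 0)
    (hXrank : X.rank = r) {U : Matrix (Fin n) (Fin r) ℝ} {d : Fin r → ℝ} (hXeig : IsThinEig X U d)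
    {ν μ₁ β : ℝ} (hinc : Incoherent ν U)
    (hμ : ∀ i j, |X i j| ≤ μ₁ * Real.sqrt ((r : ℝ) / (n : ℝ) ^ 2) * specNorm X) (hβ : 1 < β)
    (hm : max (161000 * ν ^ 2) (777000 * condNum r X ^ 4 * μ₁ ^ 2)
        * condNum r X ^ 2 * (r : ℝ) ^ 2 * β * n * Real.log n ≤ m) :
    SamplingRegime n r m X U d (sigmaMin r X) (condNum r X)
      (μ₁ * Real.sqrt ((r : ℝ) / (n : ℝ) ^ 2) * specNorm X) (Real.sqrt (ν * r / n))
      (β * Real.log n) := by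
  have hσ := sigmaMin_pos hr hXrank
  have hn0 : (0 : ℝ) < n := by positivity
  have hr0 : (0 : ℝ) < r := by positivity
  have hν := hinc.one_le
  have hlog := one_lt_log_of_three_le hn
  have hT := topSplit_of_isThinEig hXeig hσ (hXeig.sigmaMin_le hXrank)
  have hκσ : ‖X‖ = condNum r X * sigmaMin r X := by
    rw [condNum, specNorm_eq, div_mul_cancel₀ _ hσ.ne']
  have hτ : (n : ℝ) * Real.sqrt (ν * r / n) ^ 2 = ν * r := by
    rw [Real.sq_sqrt (by positivity)]
    field_simp
  have hP0 : U * Uᵀ ≠ 0 := by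
    intro h0
    have := hT.trace_eq
    rw [h0, Matrix.trace_zero] at this
    exact hr0.ne this
  have hκ1 : 1 ≤ condNum r X := by
    rw [condNum, le_div_iff₀ hσ, one_mul, specNorm_eq]
    have h1 := hT.proj.one_le_norm hP0
    rw [← hT.inv_mul] at h1
    have h2 := (h1.trans (norm_mul_le _ _)).trans
      (mul_le_mul_of_nonneg_right hT.norm_inv (norm_nonneg X))
    rwa [← div_eq_inv_mul, le_div_iff₀ hσ, one_mul] at h2
  have hB0 : 0 ≤ μ₁ * Real.sqrt ((r : ℝ) / (n : ℝ) ^ 2) * specNorm X :=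
    (abs_nonneg _).trans (hμ ⟨0, by omega⟩ ⟨0, by omega⟩)
  have hw : 0 ≤ condNum r X ^ 2 * (r : ℝ) ^ 2 * β * n * Real.log n := by positivity
  have hmax := fun {c : ℝ} (hc : c ≤ max (161000 * ν ^ 2) (777000 * condNum r X ^ 4 * μ₁ ^ 2)) =>
    (mul_le_mul_of_nonneg_right hc hw).trans (le_of_eq_of_le (by ring) hm)
  have hnB : ((n : ℝ) * (μ₁ * Real.sqrt ((r : ℝ) / (n : ℝ) ^ 2) * specNorm X)) ^ 2
      = μ₁ ^ 2 * r * (condNum r X * sigmaMin r X) ^ 2 := by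
    rw [specNorm_eq, hκσ, mul_pow, mul_pow, mul_pow, Real.sq_sqrt (by positivity)]
    field_simp
  exact
    { three_le := hn
      one_le_rank := hr
      symm := hXsymm
      mulVec_one := hXrow
      eig := hXeig
      sigma_pos := hσ
      sigma_le := hXeig.sigmaMin_le hXrank
      one_le_kappa := hκ1
      norm_eq := hκσ
      tau_nonneg := Real.sqrt_nonneg _
      rank_le := by
        rw [hτ]
        exact le_mul_of_one_le_left hr0.le hν
      row_le := hinc.vnorm_row_le (by omega) hXeig.1
      entry_le := hμ
      kappa_sigma_le := by
        rw [← hκσ]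
        exact norm_le_of_entry_le hB0 hμ
      one_le_l := by nlinarith
      card_tau_le := by
        rw [hτ]
        refine le_trans (le_of_eq ?_) (hmax (le_max_left _ _))
        ring
      card_entry_le := by
        rw [hnB]
        have := mul_le_mul_of_nonneg_right (hmax (le_max_right _ _)) (sq_nonneg (sigmaMin r X))
        refine le_trans (le_of_eq ?_) this
        ring }

/-! ### From counting to probability -/

open scoped Classical in
theorem le_uniformOn_univ_real {Ω : Type*} [Fintype Ω] [Nonempty Ω] [MeasurableSpace Ω]
    [MeasurableSingletonClass Ω] {G : Ω → Prop} {q : ℝ}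
    (h : ((Finset.univ.filter fun ω => ¬ G ω).card : ℝ) ≤ q * Fintype.card Ω) :
    1 - q ≤ (uniformOn (Set.univ : Set Ω)).real {ω | G ω} := by
  have hpos : (0 : ℝ) < Fintype.card Ω := by exact_mod_cast Fintype.card_pos
  have e : (uniformOn (Set.univ : Set Ω)).real {ω | G ω}
      = ((Finset.univ.filter fun ω => G ω).card : ℝ) / Fintype.card Ω := by
    have : {ω | G ω} = ((Finset.univ.filter fun ω => G ω : Finset Ω) : Set Ω) := by simp
    rw [Measure.real, uniformOn_univ, this, Measure.count_apply_finset, ENNReal.toReal_div]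
    simp
  rw [e, le_div_iff₀ hpos]
  have hsum := Finset.card_filter_add_card_filter_not (s := (Finset.univ : Finset Ω)) fun ω => G ω
  have hsum' : ((Finset.univ.filter fun ω => G ω).card : ℝ)
      + ((Finset.univ.filter fun ω => ¬ G ω).card : ℝ) = Fintype.card Ω := by
    rw [← Finset.card_univ]
    exact_mod_cast hsum
  linarith

theorem isResamplingRun_iff {n S m r : ℕ} {ν : ℝ} {X : Matrix (Fin n) (Fin n) ℝ}
    {ω : Fin (S + 1) → Fin m → PairIdx n} {Z : Fin (S + 1) → Matrix (Fin n) (Fin n) ℝ} :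
    IsResamplingRun r ν X ω Z ↔
      IsInitRun (fun a : Fin m → PairIdx n => IsHardThreshold r ((numPairs n / m) • sampleOp a X))
        (fun z a => IsStep r ν X z a) ω Z :=
  ⟨fun h => ⟨h.init, h.step⟩, fun h => ⟨h.1, h.2⟩⟩

/-- The event also asserts that a run exists, so the bound over all runs is never vacuous on it;
quantifying over runs covers every choice of decompositions. -/
theorem lemma2 (n r S mhat : ℕ) (hn : 3 ≤ n) (hr : 1 ≤ r)
    (X : Matrix (Fin n) (Fin n) ℝ)
    (hXsymm : Xᵀ = X) (hXrow : X *ᵥ (fun _ => (1 : ℝ)) = 0) (hXrank : X.rank = r)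
    (U : Matrix (Fin n) (Fin r) ℝ) (d : Fin r → ℝ) (hXeig : IsThinEig X U d)
    (ν μ₁ β : ℝ) (hinc : Incoherent ν U)
    (hμ : ∀ i j, |X i j| ≤ μ₁ * Real.sqrt ((r : ℝ) / (n : ℝ) ^ 2) * specNorm X)
    (hβ : 1 < β)
    (hm : max (161000 * ν ^ 2) (777000 * condNum r X ^ 4 * μ₁ ^ 2)
        * condNum r X ^ 2 * (r : ℝ) ^ 2 * β * n * Real.log n ≤ mhat) :
    1 - (2 + 4 * (S : ℝ)) * (n : ℝ) ^ (1 - β) ≤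
      (sampleLaw n S mhat).real
        {ω | (∃ Z, IsResamplingRun r ν X ω Z) ∧
          ∀ Z, IsResamplingRun r ν X ω Z →
            frobNorm (Z (Fin.last S) - X)
              ≤ (5 / 6 : ℝ) ^ S * (sigmaMin r X / (256 * condNum r X ^ 2))} := by
  classical
  have h := samplingRegime_of_incoherent hn hr hXsymm hXrow hXrank hXeig hinc hμ hβ hm
  set τ := Real.sqrt (ν * r / n) with hτ
  set δ := sigmaMin r X / (256 * condNum r X ^ 2) with hδ
  have hσ := h.sigma_pos
  have hκ := h.one_le_kappa
  have hn0 := h.n_pos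
  have hδ0 : 0 < δ := by positivity
  have hδ1 : δ ≤ sigmaMin r X / 256 := by
    refine div_le_div_of_nonneg_left hσ.le (by norm_num) ?_
    have : 1 ≤ condNum r X ^ 2 := one_le_pow₀ hκ
    linarith
  have hcard : (Fintype.card (Fin mhat → PairIdx n) : ℝ)
      = (Fintype.card (PairIdx n) : ℝ) ^ mhat := by
    rw [Fintype.card_fun, Fintype.card_fin, Nat.cast_pow]
  have key := card_not_init_run_good_le
    (fun a : Fin mhat → PairIdx n => IsHardThreshold r ((numPairs n / mhat) • sampleOp a X))
    (fun z a => IsStep r ν X z a) (fun k => GoodIterate r X τ ((5 / 6) ^ k * δ))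
    -- Since `n * exp (-(β * log n)) = n ^ (1 - β)`, these are the failure rates `2 * n ^ (1 - β)`
    -- of the initialization and `4 * n ^ (1 - β)` of each step.
    (q₀ := 2 * n * Real.exp (-(β * Real.log n))) (q := 4 * n * Real.exp (-(β * Real.log n)))
    (by positivity)
    (by
      rw [hcard]
      simp only [pow_zero, one_mul]
      exact h.card_not_initGood_le)
    (fun k Z hZ => by
      rw [hcard]
      have e : (5 / 6 : ℝ) ^ (k + 1) * δ = 5 / 6 * ((5 / 6) ^ k * δ) := by ring
      simp only [e]
      refine h.card_not_stepGood_le hZ (by positivity) (le_trans ?_ hδ1)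
      exact mul_le_of_le_one_left hδ0.le (pow_le_one₀ (by norm_num) (by norm_num))) S
  have hexp : n * Real.exp (-(β * Real.log n)) = (n : ℝ) ^ (1 - β) := by
    rw [Real.rpow_sub hn0, Real.rpow_one, Real.rpow_def_of_pos hn0, Real.exp_neg, mul_comm β,
      div_eq_mul_inv]
  have hq : 2 * n * Real.exp (-(β * Real.log n)) + S * (4 * n * Real.exp (-(β * Real.log n)))
      = (2 + 4 * (S : ℝ)) * (n : ℝ) ^ (1 - β) := by
    rw [← hexp]
    ring
  rw [hq] at key
  have : Nonempty (PairIdx n) :=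
    ⟨⟨(⟨0, by omega⟩, ⟨1, by omega⟩), Fin.lt_def.2 Nat.zero_lt_one⟩⟩
  have hcard' : (Fintype.card (Fin mhat → PairIdx n) : ℝ) ^ (S + 1)
      = Fintype.card (Fin (S + 1) → Fin mhat → PairIdx n) := by
    rw [Fintype.card_fun (α := Fin (S + 1)), Fintype.card_fin, Nat.cast_pow]
  rw [hcard'] at key
  refine (le_uniformOn_univ_real key).trans (measureReal_mono fun ω hω => ?_)
  exact ⟨hω.1.imp fun Z => isResamplingRun_iff.2,
    fun Z hZ => (hω.2 Z (isResamplingRun_iff.1 hZ)).frob_le⟩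

end
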